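/- Let $X\subset\mathbb{R}^n$ be a bounded smooth domain (a bounded connected open set with smooth boundary, lying locally on one side of it) with boundary $M=\partial X$. Let $\nu$ be the outward unit normal along $M$, $v_n$ the derivative of $v$ in the direction $\nu$, $L(a,b)=\langle D_a\nu,b\rangle$ (for $a,b$ tangent to $M$) the second fundamental form, and $H=\operatorname{tr}L$ the mean curvature of $M$; let $\overline{\nabla}$ and $\overline{\Delta}$ be the gradient and the Laplacian of the induced metric on $M$, and let $dx$ and $d\mu$ be the volume measures of $X$ and $M$. Let $\sigma_2(A,B)=\frac12\left(\operatorname{tr}A\operatorname{tr}B-\operatorname{tr}(AB)\right)$ be the polarization of the second elementary symmetric function $\sigma_2(A)=\sum_{i<j}\lambda_i\lambda_j$ of the eigenvalues of a symmetric $n\times n$ matrix $A$, and let $D^2v$ be the Hessian of $v$. Then $$B_2(v,w)=\frac12\left(v_n\overline{\Delta}w+w_n\overline{\Delta}v+L(\overline{\nabla}v,\overline{\nabla}w)+Hv_nw_n\right)$$ defines a bilinear operator $B_2\colon\left(C^1(\overline{X})\cap C^2(M)\right)^2\to C^0(M)$, and $$\mathcal{Q}_2(u,v,w)=-\int_X u\,\sigma_2(D^2v,D^2w)\,dx+\oint_M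 u\,B_2(v,w)\,d\mu$$ (in which both integrals converge) defines a symmetric trilinear form $\mathcal{Q}_2\colon\left(C^2(\overline{X})\right)^3\to\mathbb{R}$, that is, a trilinear form invariant under all permutations of $u,v,w$. -/

import Mathlib

open Set MeasureTheory
open scoped ContDiff Topology InnerProductSpace MeasureTheory

noncomputable section

namespace HessianTrace

/-- Euclidean space `ℝⁿ`. -/
abbrev Rn (n : ℕ) : Type := EuclideanSpace ℝ (Fin n)

/-! ### Bounded smooth domains -/

/-- `ρ` is a smooth function with `dρ(p) ≠ 0` such that, in a neighbourhood of `p`, the set `X`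
is the region `{ρ < 0}`. -/
structure IsLocalDefiningFunction {n : ℕ} (X : Set (Rn n)) (p : Rn n) (ρ : Rn n → ℝ) : Prop where
  smooth : ContDiff ℝ ∞ ρ
  eventually_mem_iff : ∀ᶠ x in 𝓝 p, (x ∈ X ↔ ρ x < 0)
  gradient_ne_zero : gradient ρ p ≠ 0

/-- A bounded smooth domain: a bounded connected open set lying, near each of its boundary points,
on one side of a smooth hypersurface. -/
structure IsBoundedSmoothDomain {n : ℕ} (X : Set (Rn n)) : Prop where
  isOpen : IsOpen X
  isConnected : IsConnected X
  isBounded : Bornology.IsBounded X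
  smooth_boundary : ∀ p ∈ frontier X, ∃ ρ : Rn n → ℝ, IsLocalDefiningFunction X p ρ

/-! ### Function spaces

The members are functions on `ℝⁿ`, of which only the values on `closure X` matter. For a smooth
domain, `ContDiffOn ℝ k v (closure X)` says that the derivatives of `v` on `X` up to order `k`
extend continuously to `closure X`, and `ContDiffOn ℝ k v (frontier X)` says that the restriction
of `v` to the hypersurface `frontier X` is `C^k`. -/

/-- The functions that are `C^k` on `s`. -/
def contDiffOnSubmodule {n : ℕ} (k : ℕ∞) (s : Set (Rn n)) : Submodule ℝ (Rn n → ℝ) where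
  carrier := {v | ContDiffOn ℝ k v s}
  add_mem' hv hw := ContDiffOn.add hv hw
  zero_mem' := contDiffOn_const
  smul_mem' c _ hv := ContDiffOn.const_smul c hv

/-- The space `C²(X̄)`. -/
abbrev C2Closure {n : ℕ} (X : Set (Rn n)) : Submodule ℝ (Rn n → ℝ) :=
  contDiffOnSubmodule 2 (closure X)

/-- The space `C¹(X̄) ∩ C²(M)`, where `M = ∂X`. -/
abbrev C1ClosureC2Boundary {n : ℕ} (X : Set (Rn n)) : Submodule ℝ (Rn n → ℝ) :=
  contDiffOnSubmodule 1 (closure X) ⊓ contDiffOnSubmodule 2 (frontier X)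

/-! ### Geometry of the boundary `M = ∂X` -/

open Classical in
/-- The outward-pointing unit normal of `X` at the boundary point `p`, namely `∇ρ / |∇ρ|` for a
local defining function `ρ` (the value does not depend on which one; it is `0` if there is none). -/
def outwardNormal {n : ℕ} (X : Set (Rn n)) (p : Rn n) : Rn n :=
  if h : ∃ ρ : Rn n → ℝ, IsLocalDefiningFunction X p ρ then
    ‖gradient h.choose p‖⁻¹ • gradient h.choose p
  else 0

/-- The orthogonal projection of `ℝⁿ` onto the tangent space `T_p M`, the orthogonal complement of
the normal line. -/
def tangentProj {n : ℕ} (X : Set (Rn n)) (p : Rn n) : Rn n →L[ℝ] Rn n :=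
  (ℝ ∙ outwardNormal X p)ᗮ.starProjection

/-- The differential at `p ∈ M` of a map `F` on `M`, defined on `T_p M` and extended by zero to the
normal line. On tangent vectors `fderivWithin ℝ F (frontier X) p` is determined by `F` on `M`;
its undetermined value on the normal is discarded by the projection. -/
def tangentialDeriv {n : ℕ} {G : Type*} [NormedAddCommGroup G] [NormedSpace ℝ G]
    (X : Set (Rn n)) (F : Rn n → G) (p : Rn n) : Rn n →L[ℝ] G :=
  (fderivWithin ℝ F (frontier X) p).comp (tangentProj X p)

/-- The tangential gradient `∇̄v`: the vector of `T_p M` that represents the differential of `v|_M`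
in the induced metric. -/
def tangentialGradient {n : ℕ} (X : Set (Rn n)) (v : Rn n → ℝ) (p : Rn n) : Rn n :=
  (InnerProductSpace.toDual ℝ (Rn n)).symm (tangentialDeriv X v p)

/-- The divergence `∑ ⟪D_{e_α} V, e_α⟫` along `M` of a vector field `V` on `M`, where `e_α` is an
orthonormal basis of `T_p M`. For `V` tangent to `M` this is the divergence in the induced
metric. -/
def tangentialDiv {n : ℕ} (X : Set (Rn n)) (V : Rn n → Rn n) (p : Rn n) : ℝ :=
  LinearMap.trace ℝ (Rn n) (tangentialDeriv X V p).toLinearMap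

/-- The tangential Laplacian `Δ̄v`: the Laplacian of `v|_M` in the induced metric. -/
def tangentialLaplacian {n : ℕ} (X : Set (Rn n)) (v : Rn n → ℝ) (p : Rn n) : ℝ :=
  tangentialDiv X (tangentialGradient X v) p

/-- The second fundamental form `L(a, b) = ⟪D_a ν, b⟫` for `a, b ∈ T_p M`, where `ν` is the outward
unit normal (it is positive for a round ball). -/
def secondFundamentalForm {n : ℕ} (X : Set (Rn n)) (p a b : Rn n) : ℝ :=
  ⟪tangentialDeriv X (outwardNormal X) p a, b⟫_ℝ

/-- The mean curvature `H`, the trace of the second fundamental form. -/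
def meanCurvature {n : ℕ} (X : Set (Rn n)) (p : Rn n) : ℝ :=
  tangentialDiv X (outwardNormal X) p

/-- The derivative `v_n` of `v` at `p ∈ M` in the direction of the outward normal. -/
def normalDeriv {n : ℕ} (X : Set (Rn n)) (v : Rn n → ℝ) (p : Rn n) : ℝ :=
  fderivWithin ℝ v (closure X) p (outwardNormal X p)

/-- The volume measure of `M`: the Euclidean `(n - 1)`-dimensional Hausdorff measure (normalized
to agree with Lebesgue measure on `(n - 1)`-dimensional subspaces) restricted to `M`. -/
def surfaceMeasure {n : ℕ} (X : Set (Rn n)) : Measure (Rn n) :=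
  (Measure.euclideanHausdorffMeasure (n - 1)).restrict (frontier X)

/-! ### The polarized `k`-Hessian -/

/-- The generalized Kronecker delta. -/
def generalizedKronecker {n k : ℕ} (i j : Fin k → Fin n) : ℝ :=
  (Matrix.of fun a b : Fin k => if i a = j b then (1 : ℝ) else 0).det

/-- The polarization of the `k`-th elementary symmetric function of the eigenvalues,
`σ_k(A₁, …, A_k) = (1 / k!) δ^{i₁…i_k}_{j₁…j_k} (A₁)_{i₁j₁} ⋯ (A_k)_{i_k j_k}`. -/
def sigmaPolarized {n k : ℕ} (A : Fin k → Matrix (Fin n) (Fin n) ℝ) : ℝ :=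
  (1 / (k.factorial : ℝ)) *
    ∑ i : Fin k → Fin n, ∑ j : Fin k → Fin n, generalizedKronecker i j * ∏ a, A a (i a) (j a)

/-- The Hessian matrix `D²v(x)`. -/
def hessian {n : ℕ} (v : Rn n → ℝ) (x : Rn n) : Matrix (Fin n) (Fin n) ℝ :=
  Matrix.of fun i j =>
    fderiv ℝ (fderiv ℝ v) x (EuclideanSpace.single i 1) (EuclideanSpace.single j 1)

/-- The function `σ₂(D²v, D²w)`. -/
def sigmaTwo {n : ℕ} (v w : Rn n → ℝ) (x : Rn n) : ℝ :=
  sigmaPolarized ![hessian v x, hessian w x]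

/-! ### The boundary operator and the trilinear form -/

/-- `B₂(v, w) = ½ (v_n Δ̄w + w_n Δ̄v + L(∇̄v, ∇̄w) + H v_n w_n)`. -/
def boundaryOperator {n : ℕ} (X : Set (Rn n)) (v w : Rn n → ℝ) (p : Rn n) : ℝ :=
  (1 / 2) * (normalDeriv X v p * tangentialLaplacian X w p
    + normalDeriv X w p * tangentialLaplacian X v p
    + secondFundamentalForm X p (tangentialGradient X v p) (tangentialGradient X w p)
    + meanCurvature X p * normalDeriv X v p * normalDeriv X w p)

/-- `Q₂(u, v, w) = -∫_X u σ₂(D²v, D²w) dx + ∮_M u B₂(v, w) dμ`. -/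
def energyForm {n : ℕ} (X : Set (Rn n)) (u v w : Rn n → ℝ) : ℝ :=
  -(∫ x in X, u x * sigmaTwo v w x) + ∫ p, u p * boundaryOperator X v w p ∂(surfaceMeasure X)

end HessianTrace

end

/-!
The form is symmetric in its last two arguments because `σ₂(A, B)` is, and because the second
fundamental form is a symmetric bilinear form (in terms of a defining function `ρ` it is the Hessian
of `ρ` divided by `|∇ρ|`). So only the exchange of `u` and `w` has to be explained, and everything
else follows from it: linearity in the first argument is linearity of the integral.

For smooth functions there are two integrations by parts. The cofactor operator `tr(DZ) - DZ` of the
derivative of a vector field `Z` is divergence free, so that the divergence of `(tr DZ) S - DZ S` is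
`tr DZ tr DS - tr(DZ DS)`, which contains no second derivatives (`trace_fderiv_cofactorField`).
* With `Z = ∇v` and `S = u ∇w`, the integral of `u σ₂(D²v, D²w)` becomes an integral over `X` that is
  symmetric in `u` and `w`, plus the flux of `u (Δv ∇w - D²v ∇w)` through the boundary.
* The expression `tr DZ tr DS - tr(DZ DS)` is symmetric in `Z` and `S`, so their two cofactor fields
  have the same flux (`integral_cofactorField_comm`). For `Z = N`, an extension of the unit normal,
  and `S = u v_n ∇w` this is an integration by parts on the boundary, without boundary term since
  the boundary is closed. It moves the tangential derivatives away from `w`.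

Pointwise on the boundary, the two fluxes and `u B₂(v, w)` add up to
`-½ v_n (⟪∇u, ∇w⟫ - u_n w_n)`, which is symmetric in `u` and `w` (`boundary_integrand_eq`); the
formula `Δ̄v = tr_T D²v - H v_n` and the symmetry of the second fundamental form enter here. Hence
`energyForm_eq_of_contDiff`.

Functions of class `C²` up to the boundary are reached by approximation. The functions
`x ↦ v (x - t N x)`, for small `t > 0`, are `C²` near the closed domain, and mollifying them gives
smooth functions that converge to `v` boundedly with their first and second derivatives
(`exists_smooth_jetTendsto`). The energy form is continuous for this convergence
(`tendsto_energyForm`), by dominated convergence.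

The divergence theorem for the Hausdorff measure of the boundary (`integral_fderiv`) is obtained
without surface parametrizations. Near a boundary point and for a direction `e` transversal to the
boundary, integration along the lines of direction `e` expresses the flux `∫_X ∂ₑf`, for `f ≥ 0`,
as an integral over the shadow of the boundary in the hyperplane `eᗮ`. Projections do not increase
area, so this is at most `∮ f`; and for `e = ν` the projection nearly preserves distances between
boundary points, so it is nearly `∮ f`. Comparing the directions `ν` and `ν + s e` for small `s`
gives `∫_X ∂ₑf ≤ ∮ f ⟪ν, e⟫` up to a small error, for every `e`. Replacing `e` by `-e` gives equality
for `f ≥ 0`, and the general case follows by writing `f` as a difference of squares.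
-/

namespace HessianTrace

open Filter

/-! ### Local structure of a smooth domain near a boundary point -/

/-- A function decreases strictly, for small positive times, along a direction in which its
derivative is negative. -/
lemma eventually_lt_of_fderiv_neg {E : Type*} [NormedAddCommGroup E] [NormedSpace ℝ E]
    {f : E → ℝ} {f' : E →L[ℝ] ℝ} {x a : E} (hf : HasFDerivAt f f' x) (ha : f' a < 0) :
    ∀ᶠ t : ℝ in 𝓝[>] 0, f (x + t • a) < f x := by
  have h1 : HasDerivAt (fun t : ℝ => f (x + t • a)) (f' a) 0 := by
    have h2 : HasDerivAt (fun t : ℝ => x + t • a) a 0 := by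
      simpa using ((hasDerivAt_id (0 : ℝ)).smul_const a).const_add x
    have h3 : HasFDerivAt f f' (x + (0 : ℝ) • a) := by simpa using hf
    exact h3.comp_hasDerivAt (0 : ℝ) h2
  have h4 := (hasDerivAt_iff_tendsto_slope.1 h1).eventually_lt_const ha
  have h5 : 𝓝[>] (0 : ℝ) ≤ 𝓝[≠] 0 := nhdsWithin_mono _ fun t ht => ne_of_gt ht
  filter_upwards [h5 h4, self_mem_nhdsWithin] with t ht ht0
  have ht0' : (0 : ℝ) < t := ht0
  rw [slope_def_field] at ht
  simp only [zero_smul, add_zero, sub_zero] at ht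
  by_contra hcon
  push Not at hcon
  exact absurd ht (not_lt.2 (div_nonneg (sub_nonneg.2 hcon) ht0'.le))

lemma inner_gradient {n : ℕ} (ρ : Rn n → ℝ) (p a : Rn n) :
    ⟪gradient ρ p, a⟫_ℝ = fderiv ℝ ρ p a := by
  simp [gradient, InnerProductSpace.toDual_symm_apply]

lemma contDiff_gradient {n : ℕ} {ρ : Rn n → ℝ} (h : ContDiff ℝ ∞ ρ) :
    ContDiff ℝ ∞ (gradient ρ) :=
  (InnerProductSpace.toDual ℝ (Rn n)).symm.contDiff.comp (h.fderiv_right (by simp))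

namespace IsLocalDefiningFunction

variable {n : ℕ} {X : Set (Rn n)} {p : Rn n} {ρ : Rn n → ℝ}

lemma hasFDerivAt (h : IsLocalDefiningFunction X p ρ) (x : Rn n) :
    HasFDerivAt ρ (fderiv ℝ ρ x) x :=
  (h.smooth.differentiable (by simp) x).hasFDerivAt

lemma eventually (h : IsLocalDefiningFunction X p ρ) :
    ∀ᶠ x in 𝓝 p, IsLocalDefiningFunction X x ρ := by
  have h1 := h.eventually_mem_iff.eventually_nhds
  have h2 : ∀ᶠ x in 𝓝 p, gradient ρ x ≠ 0 :=
    (contDiff_gradient h.smooth).continuous.continuousAt.eventually_ne h.gradient_ne_zero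
  filter_upwards [h1, h2] with x hx1 hx2
  exact ⟨h.smooth, hx1, hx2⟩

lemma eventually_mem_of_fderiv_neg (h : IsLocalDefiningFunction X p ρ) (hp : ρ p ≤ 0) {a : Rn n}
    (ha : fderiv ℝ ρ p a < 0) : ∀ᶠ t : ℝ in 𝓝[>] 0, p + t • a ∈ X := by
  have h1 := eventually_lt_of_fderiv_neg (h.hasFDerivAt p) ha
  have h2 : Tendsto (fun t : ℝ => p + t • a) (𝓝[>] 0) (𝓝 p) := by
    have : Continuous fun t : ℝ => p + t • a := by fun_prop
    simpa using (this.tendsto 0).mono_left nhdsWithin_le_nhds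
  filter_upwards [h1, h2.eventually h.eventually_mem_iff] with t ht1 ht2
  exact ht2.2 (ht1.trans_le hp)

lemma fderiv_neg_gradient (h : IsLocalDefiningFunction X p ρ) :
    fderiv ℝ ρ p (-gradient ρ p) < 0 := by
  rw [← inner_gradient, inner_neg_right, real_inner_self_eq_norm_sq]
  have := norm_pos_iff.2 h.gradient_ne_zero
  nlinarith

lemma mem_closure_iff (h : IsLocalDefiningFunction X p ρ) : p ∈ closure X ↔ ρ p ≤ 0 := by
  constructor
  · intro hp
    by_contra hcon
    push Not at hcon
    have h1 : ∀ᶠ x in 𝓝 p, 0 < ρ x :=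
      h.smooth.continuous.continuousAt.eventually_const_lt hcon
    obtain ⟨x, hxX, hx1, hx2⟩ :=
      ((mem_closure_iff_frequently.1 hp).and_eventually (h1.and h.eventually_mem_iff)).exists
    exact absurd (hx2.1 hxX) (not_lt.2 hx1.le)
  · intro hp
    have h1 := h.eventually_mem_of_fderiv_neg hp h.fderiv_neg_gradient
    have h2 : Tendsto (fun t : ℝ => p + t • -gradient ρ p) (𝓝[>] 0) (𝓝 p) := by
      have : Continuous fun t : ℝ => p + t • -gradient ρ p := by fun_prop
      simpa using (this.tendsto 0).mono_left nhdsWithin_le_nhds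
    exact mem_closure_of_tendsto h2 h1

lemma mem_frontier_iff (h : IsLocalDefiningFunction X p ρ) (hX : IsOpen X) :
    p ∈ frontier X ↔ ρ p = 0 := by
  rw [hX.frontier_eq, Set.mem_sdiff, h.mem_closure_iff, h.eventually_mem_iff.self_of_nhds]
  constructor
  · rintro ⟨h1, h2⟩; linarith
  · intro h0; simp [h0]

/-- The normalized gradient of a local defining function does not depend on the function: two unit
vectors `n₁ ≠ n₂` would give the direction `n₂ - n₁`, along which one function says that the domain
is entered and the other that it is left. -/
lemma normalized_gradient_eq {ρ' : Rn n → ℝ} (h : IsLocalDefiningFunction X p ρ)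
    (h' : IsLocalDefiningFunction X p ρ') (hX : IsOpen X) (hp : p ∈ frontier X) :
    ‖gradient ρ p‖⁻¹ • gradient ρ p = ‖gradient ρ' p‖⁻¹ • gradient ρ' p := by
  have hpos := norm_pos_iff.2 h.gradient_ne_zero
  have hpos' := norm_pos_iff.2 h'.gradient_ne_zero
  set a := ‖gradient ρ p‖⁻¹ • gradient ρ p with ha
  set b := ‖gradient ρ' p‖⁻¹ • gradient ρ' p with hb
  have ha1 : ‖a‖ = 1 := by
    rw [ha, norm_smul, norm_inv, norm_norm, inv_mul_cancel₀ hpos.ne']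
  have hb1 : ‖b‖ = 1 := by
    rw [hb, norm_smul, norm_inv, norm_norm, inv_mul_cancel₀ hpos'.ne']
  by_contra hne
  have hlt : ⟪a, b⟫_ℝ < 1 := inner_lt_one_iff_real_of_norm_eq_one ha1 hb1 |>.2 hne
  have h1 : fderiv ℝ ρ p (b - a) < 0 := by
    have e : gradient ρ p = ‖gradient ρ p‖ • a := by
      rw [ha, smul_smul, mul_inv_cancel₀ hpos.ne', one_smul]
    rw [← inner_gradient, e, inner_smul_left, inner_sub_right, real_inner_self_eq_norm_sq, ha1]
    simp only [conj_trivial]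
    nlinarith
  have h2 : fderiv ℝ ρ' p (-(b - a)) < 0 := by
    have e : gradient ρ' p = ‖gradient ρ' p‖ • b := by
      rw [hb, smul_smul, mul_inv_cancel₀ hpos'.ne', one_smul]
    rw [← inner_gradient, e, inner_smul_left, inner_neg_right, inner_sub_right,
      real_inner_self_eq_norm_sq, hb1, real_inner_comm]
    simp only [conj_trivial]
    nlinarith
  have e1 := h.eventually_mem_of_fderiv_neg ((h.mem_frontier_iff hX).1 hp).le h1
  have e3 : ∀ᶠ t : ℝ in 𝓝[>] 0, 0 < ρ' (p + t • (b - a)) := by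
    have := eventually_lt_of_fderiv_neg (f := fun x => - ρ' x) (h'.hasFDerivAt p).neg
      (a := b - a) (by simpa using h2)
    have h0 := (h'.mem_frontier_iff hX).1 hp
    filter_upwards [this] with t ht
    simp only [h0] at ht
    linarith
  have h3 : Tendsto (fun t : ℝ => p + t • (b - a)) (𝓝[>] 0) (𝓝 p) := by
    have : Continuous fun t : ℝ => p + t • (b - a) := by fun_prop
    simpa using (this.tendsto 0).mono_left nhdsWithin_le_nhds
  obtain ⟨t, ht1, ht2, ht3⟩ := (e1.and (e3.and (h3.eventually h'.eventually_mem_iff))).exists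
  exact absurd (ht3.1 ht1) (not_lt.2 ht2.le)

lemma outwardNormal_eq (h : IsLocalDefiningFunction X p ρ) (hX : IsOpen X)
    (hp : p ∈ frontier X) : outwardNormal X p = ‖gradient ρ p‖⁻¹ • gradient ρ p := by
  have hex : ∃ ρ : Rn n → ℝ, IsLocalDefiningFunction X p ρ := ⟨ρ, h⟩
  rw [outwardNormal, dif_pos hex]
  exact hex.choose_spec.normalized_gradient_eq h hX hp

end IsLocalDefiningFunction

/-- The orthogonal projection onto the complement of the line spanned by `a`, written so that it
depends smoothly on `a`; it is the projection when `‖a‖ = 1`. -/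
noncomputable def projAlong {n : ℕ} (a : Rn n) : Rn n →L[ℝ] Rn n :=
  ContinuousLinearMap.id ℝ (Rn n) - (innerSL ℝ a).smulRight a

lemma projAlong_apply {n : ℕ} (a x : Rn n) : projAlong a x = x - ⟪a, x⟫_ℝ • a := by
  simp [projAlong]

lemma contDiff_projAlong {n : ℕ} {k : WithTop ℕ∞} : ContDiff ℝ k (projAlong (n := n)) := by
  unfold projAlong
  exact contDiff_const.sub
    ((ContinuousLinearMap.smulRightL ℝ (Rn n) (Rn n)).isBoundedBilinearMap.contDiff.comp
      ((innerSL ℝ).contDiff.prodMk contDiff_id))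

namespace IsBoundedSmoothDomain

variable {n : ℕ} {X : Set (Rn n)} {p : Rn n}

lemma isCompact_closure (hX : IsBoundedSmoothDomain X) : IsCompact (closure X) :=
  hX.isBounded.isCompact_closure

lemma isCompact_frontier (hX : IsBoundedSmoothDomain X) : IsCompact (frontier X) :=
  hX.isCompact_closure.of_isClosed_subset isClosed_frontier frontier_subset_closure

lemma norm_outwardNormal (hX : IsBoundedSmoothDomain X) (hp : p ∈ frontier X) :
    ‖outwardNormal X p‖ = 1 := by
  obtain ⟨ρ, h⟩ := hX.smooth_boundary p hp
  rw [h.outwardNormal_eq hX.isOpen hp, norm_smul, norm_inv, norm_norm,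
    inv_mul_cancel₀ (norm_pos_iff.2 h.gradient_ne_zero).ne']

lemma tangentProj_eq (hX : IsBoundedSmoothDomain X) (hp : p ∈ frontier X) :
    tangentProj X p = projAlong (outwardNormal X p) := by
  ext1 x
  rw [tangentProj, Submodule.starProjection_orthogonal, projAlong_apply]
  simp [Submodule.starProjection_unit_singleton ℝ (hX.norm_outwardNormal hp)]

/-- The outward normal is the restriction to the boundary of a smooth vector field on `ℝⁿ`: locally
it is `∇ρ / |∇ρ|`, and the condition of agreeing with the normal on the boundary is convex, so that
a partition of unity applies. -/
lemma exists_smooth_normal_extension (hX : IsBoundedSmoothDomain X) :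
    ∃ N : Rn n → Rn n, ContDiff ℝ ∞ N ∧ ∀ p ∈ frontier X, N p = outwardNormal X p := by
  let t : Rn n → Set (Rn n) := fun x => {y | x ∈ frontier X → y = outwardNormal X x}
  have ht : ∀ x, Convex ℝ (t x) := by
    intro x y hy z hz a b _ _ hab hx
    rw [hy hx, hz hx, ← add_smul, hab, one_smul]
  have hloc : ∀ x, ∃ U ∈ 𝓝 x, ∃ g : Rn n → Rn n,
      ContMDiffOn (modelWithCornersSelf ℝ (Rn n)) (modelWithCornersSelf ℝ (Rn n))
        ((⊤ : ℕ∞) : WithTop ℕ∞) g U ∧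
        ∀ y ∈ U, g y ∈ t y := by
    intro x
    by_cases hx : x ∈ frontier X
    · obtain ⟨ρ, h⟩ := hX.smooth_boundary x hx
      refine ⟨{y | IsLocalDefiningFunction X y ρ}, h.eventually,
        fun y => ‖gradient ρ y‖⁻¹ • gradient ρ y, ?_, ?_⟩
      · rw [contMDiffOn_iff_contDiffOn]
        intro y hy
        have hg := (contDiff_gradient h.smooth).contDiffAt (x := y)
        exact (((hg.norm ℝ hy.gradient_ne_zero).inv
          (norm_ne_zero_iff.2 hy.gradient_ne_zero)).smul hg).contDiffWithinAt
      · intro y hy hyX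
        exact (IsLocalDefiningFunction.outwardNormal_eq hy hX.isOpen hyX).symm
    · refine ⟨(frontier X)ᶜ, isClosed_frontier.isOpen_compl.mem_nhds hx, fun _ => 0,
        contMDiffOn_const, fun y hy hyX => absurd hyX hy⟩
  obtain ⟨g, hg⟩ := exists_contMDiffMap_forall_mem_convex_of_local
    (modelWithCornersSelf ℝ (Rn n)) ht hloc
  exact ⟨g, contMDiff_iff_contDiff.1 g.contMDiff, fun p hp => hg p hp⟩

/-- Vectors orthogonal to the normal are tangent to the boundary: on the segment from
`p + t (a - ε ν)` to `p + t (a + ε ν)` a defining function changes sign. -/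
lemma mem_tangentConeAt_frontier (hX : IsBoundedSmoothDomain X) (hp : p ∈ frontier X) {a : Rn n}
    (ha : ⟪outwardNormal X p, a⟫_ℝ = 0) : a ∈ tangentConeAt ℝ (frontier X) p := by
  obtain ⟨ρ, h⟩ := hX.smooth_boundary p hp
  set ν := outwardNormal X p with hν
  have hpos := norm_pos_iff.2 h.gradient_ne_zero
  have hgrad : gradient ρ p = ‖gradient ρ p‖ • ν := by
    rw [hν, h.outwardNormal_eq hX.isOpen hp, smul_smul, mul_inv_cancel₀ hpos.ne', one_smul]
  have hρ0 : ρ p = 0 := (h.mem_frontier_iff hX.isOpen).1 hp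
  have hν1 : ‖ν‖ = 1 := hX.norm_outwardNormal hp
  have hd : ∀ s : ℝ, fderiv ℝ ρ p (a + s • ν) = s * ‖gradient ρ p‖ := by
    intro s
    rw [← inner_gradient, hgrad, inner_smul_left, inner_add_right, ha, inner_smul_right,
      real_inner_self_eq_norm_sq, hν1]
    simp [mul_comm, norm_smul, hν1]
  rw [tangentConeAt_eq_biInter_closure]
  simp only [mem_iInter]
  intro U hU
  rw [Metric.mem_closure_iff]
  intro ε hε
  have hε2 : 0 < ε / 2 := by positivity
  have e1 := eventually_lt_of_fderiv_neg (a := a + (-(ε / 2)) • ν) (h.hasFDerivAt p)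
    (by rw [hd]; nlinarith)
  have e2 := eventually_lt_of_fderiv_neg (f := fun x => -ρ x) (a := a + (ε / 2) • ν)
    (h.hasFDerivAt p).neg (by simp only [neg_apply, hd]; nlinarith)
  -- all the points `p + t (a + s ν)` with `|s| ≤ ε / 2` are close to `p` when `t` is small
  have e3 : ∀ᶠ t : ℝ in 𝓝 0, ∀ s ∈ Icc (-(ε / 2)) (ε / 2),
      t • (a + s • ν) ∈ U ∧ IsLocalDefiningFunction X (p + t • (a + s • ν)) ρ := by
    apply IsCompact.eventually_forall_of_forall_eventually isCompact_Icc
    intro s _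
    have c1 : Continuous fun z : ℝ × ℝ => z.1 • (a + z.2 • ν) := by fun_prop
    have c2 : Continuous fun z : ℝ × ℝ => p + z.1 • (a + z.2 • ν) := by fun_prop
    have t1 := c1.tendsto (0, s)
    have t2 := c2.tendsto (0, s)
    simp only [zero_smul, add_zero] at t1 t2
    exact (t1.eventually (eventually_mem_set.2 hU)).and (t2.eventually h.eventually)
  obtain ⟨t, ht1, ht2, ht3, ht0⟩ := (e1.and (e2.and ((e3.filter_mono nhdsWithin_le_nhds).and
    (self_mem_nhdsWithin : ∀ᶠ t : ℝ in 𝓝[>] 0, t ∈ Ioi (0 : ℝ))))).exists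
  have ht0' : (0 : ℝ) < t := ht0
  have hcont : ContinuousOn (fun s : ℝ => ρ (p + t • (a + s • ν))) (Icc (-(ε / 2)) (ε / 2)) := by
    have := h.smooth.continuous
    fun_prop
  obtain ⟨s, hs, hs0⟩ := intermediate_value_Icc (by linarith) hcont
    (show (0 : ℝ) ∈ Icc _ _ by
      simp only [hρ0] at ht1 ht2
      exact ⟨ht1.le, by linarith⟩)
  refine ⟨a + s • ν, ?_, ?_⟩
  · obtain ⟨hU', hloc⟩ := ht3 s hs
    have : a + s • ν = t⁻¹ • (t • (a + s • ν)) := by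
      rw [smul_smul, inv_mul_cancel₀ ht0'.ne', one_smul]
    rw [this]
    exact smul_mem_smul (mem_univ _) ⟨hU', (hloc.mem_frontier_iff hX.isOpen).2 hs0⟩
  · rw [dist_eq_norm, sub_add_cancel_left, norm_neg, norm_smul, hν1, mul_one, Real.norm_eq_abs]
    exact (abs_le.2 hs).trans_lt (by linarith)

/-- At a boundary point the tangent cone of the closed domain contains an open half space. -/
lemma uniqueDiffOn_closure (hX : IsBoundedSmoothDomain X) : UniqueDiffOn ℝ (closure X) := by
  intro p hp
  by_cases hpX : p ∈ X
  · exact (hX.isOpen.uniqueDiffWithinAt hpX).mono subset_closure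
  have hpf : p ∈ frontier X := by rw [hX.isOpen.frontier_eq]; exact ⟨hp, hpX⟩
  obtain ⟨ρ, h⟩ := hX.smooth_boundary p hpf
  refine ⟨?_, subset_closure hp⟩
  have hsub : {a | fderiv ℝ ρ p a < 0} ⊆ tangentConeAt ℝ (closure X) p := by
    intro a ha
    have h1 := h.eventually_mem_of_fderiv_neg ((h.mem_frontier_iff hX.isOpen).1 hpf).le ha
    refine mem_tangentConeAt_of_add_smul_mem (l := 𝓝[>] (0 : ℝ)) (c := fun t => t) ?_
      (h1.mono fun t ht => subset_closure ht)
    exact nhdsWithin_mono _ fun t ht => ne_of_gt ht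
  have hopen : IsOpen {a | fderiv ℝ ρ p a < 0} :=
    isOpen_lt (fderiv ℝ ρ p).continuous continuous_const
  have htop : Submodule.span ℝ {a | fderiv ℝ ρ p a < 0} = ⊤ := by
    apply Submodule.eq_top_of_nonempty_interior'
    exact ⟨-gradient ρ p, mem_interior.2 ⟨_, Submodule.subset_span, hopen, h.fderiv_neg_gradient⟩⟩
  have : Submodule.span ℝ (tangentConeAt ℝ (closure X) p) = ⊤ :=
    top_le_iff.1 (htop ▸ Submodule.span_mono hsub)
  rw [this]
  exact dense_univ

end IsBoundedSmoothDomain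

/-! ### Tangential derivatives -/

section Tangential

variable {n : ℕ} {X : Set (Rn n)} {p : Rn n} {G : Type*} [NormedAddCommGroup G] [NormedSpace ℝ G]

lemma inner_projAlong_self {a : Rn n} (ha : ‖a‖ = 1) (x : Rn n) : ⟪a, projAlong a x⟫_ℝ = 0 := by
  rw [projAlong_apply, inner_sub_right, inner_smul_right, real_inner_self_eq_norm_sq, ha]
  ring

/-- Any derivative within the boundary computes the tangential derivative, since derivatives within
the boundary agree on tangent vectors. -/
lemma tangentialDeriv_eq (hX : IsBoundedSmoothDomain X) (hp : p ∈ frontier X) {F : Rn n → G}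
    {F' : Rn n →L[ℝ] G} (hF : HasFDerivWithinAt F F' (frontier X) p) :
    tangentialDeriv X F p = F'.comp (projAlong (outwardNormal X p)) := by
  rw [tangentialDeriv, hX.tangentProj_eq hp]
  ext1 x
  exact hF.differentiableWithinAt.hasFDerivWithinAt.unique_on hF
    (hX.mem_tangentConeAt_frontier hp (inner_projAlong_self (hX.norm_outwardNormal hp) x))

lemma tangentialDeriv_congr {F F' : Rn n → G} (hp : p ∈ frontier X)
    (h : EqOn F F' (frontier X)) : tangentialDeriv X F p = tangentialDeriv X F' p := by
  rw [tangentialDeriv, tangentialDeriv, fderivWithin_congr h (h hp)]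

lemma tangentialDeriv_add (hX : IsBoundedSmoothDomain X) (hp : p ∈ frontier X) {F F' : Rn n → G}
    (hF : DifferentiableWithinAt ℝ F (frontier X) p)
    (hF' : DifferentiableWithinAt ℝ F' (frontier X) p) :
    tangentialDeriv X (F + F') p = tangentialDeriv X F p + tangentialDeriv X F' p := by
  rw [tangentialDeriv_eq hX hp (hF.hasFDerivWithinAt.add hF'.hasFDerivWithinAt),
    tangentialDeriv_eq hX hp hF.hasFDerivWithinAt, tangentialDeriv_eq hX hp hF'.hasFDerivWithinAt,
    ContinuousLinearMap.add_comp]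

lemma tangentialDeriv_smul (hX : IsBoundedSmoothDomain X) (hp : p ∈ frontier X) (c : ℝ)
    {F : Rn n → G} (hF : DifferentiableWithinAt ℝ F (frontier X) p) :
    tangentialDeriv X (c • F) p = c • tangentialDeriv X F p := by
  rw [tangentialDeriv_eq hX hp (hF.hasFDerivWithinAt.const_smul c),
    tangentialDeriv_eq hX hp hF.hasFDerivWithinAt, ContinuousLinearMap.smul_comp]

lemma contDiffOn_outwardNormal (hX : IsBoundedSmoothDomain X) :
    ContDiffOn ℝ ∞ (outwardNormal X) (frontier X) := by
  obtain ⟨N, hN, hNX⟩ := hX.exists_smooth_normal_extension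
  exact hN.contDiffOn.congr fun p hp => (hNX p hp).symm

/-- The tangential derivative loses one degree of differentiability along the boundary, even though
the full `fderivWithin` along the boundary is undetermined in the normal direction. -/
lemma contDiffOn_tangentialDeriv (hX : IsBoundedSmoothDomain X) {k : ℕ} {F : Rn n → G}
    (hF : ContDiffOn ℝ (k + 1 : ℕ) F (frontier X)) :
    ContDiffOn ℝ k (tangentialDeriv X F) (frontier X) := by
  intro p hp
  obtain ⟨u, hu, hus, -, F', hF', hF'c⟩ :=
    (contDiffWithinAt_succ_iff_hasFDerivWithinAt' (n := (k : WithTop ℕ∞)) (by simp)).1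
      (by simpa using hF p hp)
  rw [insert_eq_of_mem hp] at hu hus
  have hP : ContDiffWithinAt ℝ k (fun x => projAlong (outwardNormal X x)) (frontier X) p :=
    (contDiff_projAlong.comp_contDiffOn
      ((contDiffOn_outwardNormal hX).of_le (by exact_mod_cast le_top))) p hp
  refine (hF'c.clm_comp hP).congr_of_eventuallyEq ?_ ?_
  · filter_upwards [hu] with x hx
    exact tangentialDeriv_eq hX (hus hx) (hF' x hx)
  · exact tangentialDeriv_eq hX hp (hF' p (mem_of_mem_nhdsWithin hp hu))

end Tangential

/-! ### Second fundamental form -/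

section SecondFundamentalForm

variable {n : ℕ} {X : Set (Rn n)} {p : Rn n}

lemma IsBoundedSmoothDomain.differentiableWithinAt_outwardNormal (hX : IsBoundedSmoothDomain X)
    (hp : p ∈ frontier X) : DifferentiableWithinAt ℝ (outwardNormal X) (frontier X) p :=
  (contDiffOn_outwardNormal hX).differentiableOn (by simp) p hp

/-- The derivative of the unit normal along the boundary is tangent to the boundary. -/
lemma inner_tangentialDeriv_normal_self (hX : IsBoundedSmoothDomain X) (hp : p ∈ frontier X)
    (a : Rn n) : ⟪tangentialDeriv X (outwardNormal X) p a, outwardNormal X p⟫_ℝ = 0 := by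
  have hN := (hX.differentiableWithinAt_outwardNormal hp).hasFDerivWithinAt
  have h1 := hN.inner ℝ hN
  have h2 : HasFDerivWithinAt (fun x => ⟪outwardNormal X x, outwardNormal X x⟫_ℝ)
      (0 : Rn n →L[ℝ] ℝ) (frontier X) p := by
    refine (hasFDerivWithinAt_const (1 : ℝ) p (frontier X)).congr (fun x hx => ?_) ?_
    · rw [real_inner_self_eq_norm_sq, hX.norm_outwardNormal hx]; norm_num
    · rw [real_inner_self_eq_norm_sq, hX.norm_outwardNormal hp]; norm_num
  have h3 := DFunLike.congr_fun ((tangentialDeriv_eq hX hp h1).symm.trans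
    (tangentialDeriv_eq hX hp h2)) a
  rw [tangentialDeriv_eq hX hp hN]
  simp only [ContinuousLinearMap.comp_apply, fderivInnerCLM_apply, ContinuousLinearMap.prod_apply,
    ContinuousLinearMap.zero_comp, zero_apply] at h3 ⊢
  rw [real_inner_comm] at h3
  linarith

/-- The second fundamental form is symmetric on the tangent space: in terms of a local defining
function `ρ` it is `D²ρ / |∇ρ|`. -/
lemma inner_tangentialDeriv_normal_symm (hX : IsBoundedSmoothDomain X) (hp : p ∈ frontier X)
    (a b : Rn n) :
    ⟪tangentialDeriv X (outwardNormal X) p a, projAlong (outwardNormal X p) b⟫_ℝ =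
      ⟪tangentialDeriv X (outwardNormal X) p b, projAlong (outwardNormal X p) a⟫_ℝ := by
  obtain ⟨ρ, h⟩ := hX.smooth_boundary p hp
  have hg := (contDiff_gradient h.smooth)
  have hgd : HasFDerivAt (gradient ρ) (fderiv ℝ (gradient ρ) p) p :=
    (hg.differentiable (by simp) p).hasFDerivAt
  have hcd : HasFDerivAt (fun x => ‖gradient ρ x‖⁻¹)
      (fderiv ℝ (fun x => ‖gradient ρ x‖⁻¹) p) p :=
    (((hg.contDiffAt (x := p)).norm ℝ h.gradient_ne_zero).inv
      (norm_ne_zero_iff.2 h.gradient_ne_zero)).differentiableAt (by simp) |>.hasFDerivAt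
  have hpos := norm_pos_iff.2 h.gradient_ne_zero
  set ν := outwardNormal X p with hν
  have hgrad : gradient ρ p = ‖gradient ρ p‖ • ν := by
    rw [hν, h.outwardNormal_eq hX.isOpen hp, smul_smul, mul_inv_cancel₀ hpos.ne', one_smul]
  have hN : HasFDerivWithinAt (outwardNormal X)
      (‖gradient ρ p‖⁻¹ • fderiv ℝ (gradient ρ) p +
        (fderiv ℝ (fun x => ‖gradient ρ x‖⁻¹) p).smulRight (gradient ρ p)) (frontier X) p := by
    refine (hcd.smul hgd).hasFDerivWithinAt.congr_of_eventuallyEq ?_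
      (h.outwardNormal_eq hX.isOpen hp)
    filter_upwards [nhdsWithin_le_nhds h.eventually, self_mem_nhdsWithin] with x hx hxX
    exact hx.outwardNormal_eq hX.isOpen hxX
  have hsecond : ∀ x y : Rn n,
      ⟪fderiv ℝ (gradient ρ) p x, y⟫_ℝ = fderiv ℝ (fderiv ℝ ρ) p x y := by
    intro x y
    have h1 : HasFDerivAt (fun z => ⟪gradient ρ z, y⟫_ℝ)
        ((innerSL ℝ y).comp (fderiv ℝ (gradient ρ) p)) p := by
      have := (innerSL ℝ y).hasFDerivAt.comp p hgd
      refine this.congr_of_eventuallyEq (Eventually.of_forall fun z => ?_)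
      simp
    have h2 : HasFDerivAt (fun z => fderiv ℝ ρ z y)
        ((ContinuousLinearMap.apply ℝ ℝ y).comp (fderiv ℝ (fderiv ℝ ρ) p)) p :=
      (ContinuousLinearMap.apply ℝ ℝ y).hasFDerivAt.comp p
        (((h.smooth.fderiv_right (m := ∞) (by simp)).differentiable (by simp) p).hasFDerivAt)
    have h3 : (fun z => ⟪gradient ρ z, y⟫_ℝ) = fun z => fderiv ℝ ρ z y := by
      ext z; exact inner_gradient ρ z y
    rw [h3] at h1
    have := DFunLike.congr_fun (h1.unique h2) x
    simp only [ContinuousLinearMap.comp_apply, innerSL_apply_apply] at this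
    rw [real_inner_comm, this]
    rfl
  have hsymm : ∀ x y : Rn n,
      fderiv ℝ (fderiv ℝ ρ) p x y = fderiv ℝ (fderiv ℝ ρ) p y x := fun x y =>
    (h.smooth.contDiffAt.isSymmSndFDerivAt
      (by simpa using WithTop.coe_le_coe.2 (le_top : (2 : ℕ∞) ≤ ⊤))) x y
  have key : ∀ x y : Rn n, ⟪tangentialDeriv X (outwardNormal X) p x, projAlong ν y⟫_ℝ =
      ‖gradient ρ p‖⁻¹ * fderiv ℝ (fderiv ℝ ρ) p (projAlong ν x) (projAlong ν y) := by
    intro x y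
    rw [tangentialDeriv_eq hX hp hN, ← hν]
    simp only [ContinuousLinearMap.comp_apply, add_apply,
      smul_apply, ContinuousLinearMap.smulRight_apply, inner_add_left,
      inner_smul_left, hsecond]
    have : ⟪gradient ρ p, projAlong ν y⟫_ℝ = 0 := by
      rw [hgrad, inner_smul_left, inner_projAlong_self (hX.norm_outwardNormal hp), mul_zero]
    rw [this]
    simp
  rw [key, key, hsymm]

end SecondFundamentalForm

/-! ### The boundary operator -/

section BoundaryOperator

variable {n : ℕ} {X : Set (Rn n)} {p : Rn n}

lemma inner_tangentialGradient (v : Rn n → ℝ) (a : Rn n) :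
    ⟪tangentialGradient X v p, a⟫_ℝ = tangentialDeriv X v p a := by
  rw [tangentialGradient, InnerProductSpace.toDual_symm_apply]

/-- The tangential gradient is tangent to the boundary. -/
lemma projAlong_tangentialGradient (hX : IsBoundedSmoothDomain X) (hp : p ∈ frontier X)
    {v : Rn n → ℝ} (hv : DifferentiableWithinAt ℝ v (frontier X) p) :
    projAlong (outwardNormal X p) (tangentialGradient X v p) = tangentialGradient X v p := by
  rw [projAlong_apply, real_inner_comm, inner_tangentialGradient,
    tangentialDeriv_eq hX hp hv.hasFDerivWithinAt]
  simp [projAlong_apply, hX.norm_outwardNormal hp]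

lemma secondFundamentalForm_symm (hX : IsBoundedSmoothDomain X) (hp : p ∈ frontier X)
    {v w : Rn n → ℝ} (hv : DifferentiableWithinAt ℝ v (frontier X) p)
    (hw : DifferentiableWithinAt ℝ w (frontier X) p) :
    secondFundamentalForm X p (tangentialGradient X v p) (tangentialGradient X w p) =
      secondFundamentalForm X p (tangentialGradient X w p) (tangentialGradient X v p) := by
  have := inner_tangentialDeriv_normal_symm hX hp (tangentialGradient X v p)
    (tangentialGradient X w p)
  rwa [projAlong_tangentialGradient hX hp hv, projAlong_tangentialGradient hX hp hw] at this

lemma boundaryOperator_symm (hX : IsBoundedSmoothDomain X) (hp : p ∈ frontier X)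
    {v w : Rn n → ℝ} (hv : DifferentiableWithinAt ℝ v (frontier X) p)
    (hw : DifferentiableWithinAt ℝ w (frontier X) p) :
    boundaryOperator X v w p = boundaryOperator X w v p := by
  rw [boundaryOperator, boundaryOperator, secondFundamentalForm_symm hX hp hv hw]
  ring

/-- The trace of a continuous endomorphism, as a linear functional. -/
noncomputable def traceFunctional (n : ℕ) : (Rn n →L[ℝ] Rn n) →L[ℝ] ℝ :=
  LinearMap.toContinuousLinearMap
    ((LinearMap.trace ℝ (Rn n)).comp (ContinuousLinearMap.coeLM ℝ))

lemma traceFunctional_apply (A : Rn n →L[ℝ] Rn n) :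
    traceFunctional n A = LinearMap.trace ℝ (Rn n) A.toLinearMap := rfl

lemma traceFunctional_eq_sum (A : Rn n →L[ℝ] Rn n) :
    traceFunctional n A =
      ∑ i, ⟪EuclideanSpace.single i (1 : ℝ), A (EuclideanSpace.single i 1)⟫_ℝ := by
  rw [traceFunctional_apply,
    LinearMap.trace_eq_sum_inner _ (EuclideanSpace.basisFun (Fin n) ℝ)]
  simp

lemma tangentialDiv_eq (V : Rn n → Rn n) :
    tangentialDiv X V p = traceFunctional n (tangentialDeriv X V p) := rfl

lemma contDiffOn_tangentialGradient (hX : IsBoundedSmoothDomain X) {k : ℕ} {v : Rn n → ℝ}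
    (hv : ContDiffOn ℝ (k + 1 : ℕ) v (frontier X)) :
    ContDiffOn ℝ k (tangentialGradient X v) (frontier X) :=
  (InnerProductSpace.toDual ℝ (Rn n)).symm.contDiff.comp_contDiffOn
    (contDiffOn_tangentialDeriv hX hv)

lemma continuousOn_tangentialDiv (hX : IsBoundedSmoothDomain X) {V : Rn n → Rn n}
    (hV : ContDiffOn ℝ 1 V (frontier X)) : ContinuousOn (tangentialDiv X V) (frontier X) :=
  (traceFunctional n).continuous.comp_continuousOn
    (contDiffOn_tangentialDeriv (k := 0) hX (by simpa using hV)).continuousOn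

lemma continuousOn_normalDeriv (hX : IsBoundedSmoothDomain X) {v : Rn n → ℝ}
    (hv : ContDiffOn ℝ 1 v (closure X)) : ContinuousOn (normalDeriv X v) (frontier X) :=
  ((hv.continuousOn_fderivWithin hX.uniqueDiffOn_closure (by simp)).mono
    frontier_subset_closure).clm_apply (contDiffOn_outwardNormal hX).continuousOn

lemma contDiffOn_two_of_mem {v : Rn n → ℝ} (hv : v ∈ C1ClosureC2Boundary X) :
    ContDiffOn ℝ (1 + 1 : ℕ) v (frontier X) := by
  have h : ContDiffOn ℝ 2 v (frontier X) := hv.2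
  simpa [one_add_one_eq_two] using h

lemma continuousOn_boundaryOperator (hX : IsBoundedSmoothDomain X) {v w : Rn n → ℝ}
    (hv : v ∈ C1ClosureC2Boundary X) (hw : w ∈ C1ClosureC2Boundary X) :
    ContinuousOn (boundaryOperator X v w) (frontier X) := by
  have hv1 := continuousOn_normalDeriv hX hv.1
  have hw1 := continuousOn_normalDeriv hX hw.1
  have gv := contDiffOn_tangentialGradient (k := 1) hX (contDiffOn_two_of_mem hv)
  have gw := contDiffOn_tangentialGradient (k := 1) hX (contDiffOn_two_of_mem hw)
  have lv := continuousOn_tangentialDiv hX (by simpa using gv)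
  have lw := continuousOn_tangentialDiv hX (by simpa using gw)
  have hN := contDiffOn_outwardNormal hX
  have hL := (contDiffOn_tangentialDeriv (k := 0) hX
    (hN.of_le (by exact_mod_cast le_top))).continuousOn
  have hH := continuousOn_tangentialDiv hX (hN.of_le (by exact_mod_cast le_top))
  exact continuousOn_const.mul ((((hv1.mul lw).add (hw1.mul lv)).add
    ((hL.clm_apply gv.continuousOn).inner gw.continuousOn)).add ((hH.mul hv1).mul hw1))

lemma differentiableWithinAt_of_mem {v : Rn n → ℝ}
    (hv : v ∈ C1ClosureC2Boundary X) (hp : p ∈ frontier X) :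
    DifferentiableWithinAt ℝ v (frontier X) p :=
  ContDiffOn.differentiableOn (n := 2) hv.2 (by simp) p hp

lemma differentiableWithinAt_tangentialGradient (hX : IsBoundedSmoothDomain X) {v : Rn n → ℝ}
    (hv : v ∈ C1ClosureC2Boundary X) (hp : p ∈ frontier X) :
    DifferentiableWithinAt ℝ (tangentialGradient X v) (frontier X) p :=
  (contDiffOn_tangentialGradient (k := 1) hX (contDiffOn_two_of_mem hv)).differentiableOn
    (by simp) p hp

lemma tangentialGradient_add (hX : IsBoundedSmoothDomain X) (hp : p ∈ frontier X)
    {v w : Rn n → ℝ} (hv : DifferentiableWithinAt ℝ v (frontier X) p)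
    (hw : DifferentiableWithinAt ℝ w (frontier X) p) :
    tangentialGradient X (v + w) p = tangentialGradient X v p + tangentialGradient X w p := by
  rw [tangentialGradient, tangentialDeriv_add hX hp hv hw, map_add]
  rfl

lemma tangentialGradient_smul (hX : IsBoundedSmoothDomain X) (hp : p ∈ frontier X) (c : ℝ)
    {v : Rn n → ℝ} (hv : DifferentiableWithinAt ℝ v (frontier X) p) :
    tangentialGradient X (c • v) p = c • tangentialGradient X v p := by
  rw [tangentialGradient, tangentialDeriv_smul hX hp c hv, map_smulₛₗ]
  rfl

lemma tangentialLaplacian_add (hX : IsBoundedSmoothDomain X) (hp : p ∈ frontier X)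
    {v w : Rn n → ℝ} (hv : v ∈ C1ClosureC2Boundary X) (hw : w ∈ C1ClosureC2Boundary X) :
    tangentialLaplacian X (v + w) p = tangentialLaplacian X v p + tangentialLaplacian X w p := by
  have h1 : EqOn (tangentialGradient X (v + w))
      (tangentialGradient X v + tangentialGradient X w) (frontier X) := fun q hq =>
    tangentialGradient_add hX hq (differentiableWithinAt_of_mem hv hq)
      (differentiableWithinAt_of_mem hw hq)
  rw [tangentialLaplacian, tangentialDiv_eq, tangentialDeriv_congr hp h1,
    tangentialDeriv_add hX hp (differentiableWithinAt_tangentialGradient hX hv hp)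
      (differentiableWithinAt_tangentialGradient hX hw hp), map_add]
  rfl

lemma tangentialLaplacian_smul (hX : IsBoundedSmoothDomain X) (hp : p ∈ frontier X) (c : ℝ)
    {v : Rn n → ℝ} (hv : v ∈ C1ClosureC2Boundary X) :
    tangentialLaplacian X (c • v) p = c * tangentialLaplacian X v p := by
  have h1 : EqOn (tangentialGradient X (c • v)) (c • tangentialGradient X v) (frontier X) :=
    fun q hq => tangentialGradient_smul hX hq c (differentiableWithinAt_of_mem hv hq)
  rw [tangentialLaplacian, tangentialDiv_eq, tangentialDeriv_congr hp h1,
    tangentialDeriv_smul hX hp c (differentiableWithinAt_tangentialGradient hX hv hp), map_smul]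
  rfl

lemma normalDeriv_add (hX : IsBoundedSmoothDomain X) (hp : p ∈ frontier X)
    {v w : Rn n → ℝ} (hv : v ∈ C1ClosureC2Boundary X) (hw : w ∈ C1ClosureC2Boundary X) :
    normalDeriv X (v + w) p = normalDeriv X v p + normalDeriv X w p := by
  have hp' := frontier_subset_closure hp
  rw [normalDeriv, fderivWithin_add (hX.uniqueDiffOn_closure p hp')
    (ContDiffOn.differentiableOn (n := 1) hv.1 (by simp) p hp')
    (ContDiffOn.differentiableOn (n := 1) hw.1 (by simp) p hp')]
  rfl

lemma normalDeriv_smul (hX : IsBoundedSmoothDomain X) (hp : p ∈ frontier X) (c : ℝ)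
    {v : Rn n → ℝ} (hv : v ∈ C1ClosureC2Boundary X) :
    normalDeriv X (c • v) p = c * normalDeriv X v p := by
  have hp' := frontier_subset_closure hp
  rw [normalDeriv, fderivWithin_const_smul (hX.uniqueDiffOn_closure p hp')
    (ContDiffOn.differentiableOn (n := 1) hv.1 (by simp) p hp')]
  rfl

lemma boundaryOperator_add_left (hX : IsBoundedSmoothDomain X) (hp : p ∈ frontier X)
    {v v' w : Rn n → ℝ} (hv : v ∈ C1ClosureC2Boundary X) (hv' : v' ∈ C1ClosureC2Boundary X) :
    boundaryOperator X (v + v') w p = boundaryOperator X v w p + boundaryOperator X v' w p := by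
  simp only [boundaryOperator, secondFundamentalForm, normalDeriv_add hX hp hv hv',
    tangentialLaplacian_add hX hp hv hv', tangentialGradient_add hX hp
      (differentiableWithinAt_of_mem hv hp) (differentiableWithinAt_of_mem hv' hp), map_add,
    inner_add_left]
  ring

lemma boundaryOperator_smul_left (hX : IsBoundedSmoothDomain X) (hp : p ∈ frontier X) (c : ℝ)
    {v w : Rn n → ℝ} (hv : v ∈ C1ClosureC2Boundary X) :
    boundaryOperator X (c • v) w p = c * boundaryOperator X v w p := by
  simp only [boundaryOperator, secondFundamentalForm, normalDeriv_smul hX hp c hv,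
    tangentialLaplacian_smul hX hp c hv, tangentialGradient_smul hX hp c
      (differentiableWithinAt_of_mem hv hp), map_smul, inner_smul_left, conj_trivial]
  ring

lemma boundaryOperator_add_right (hX : IsBoundedSmoothDomain X) (hp : p ∈ frontier X)
    {v w w' : Rn n → ℝ} (hv : v ∈ C1ClosureC2Boundary X) (hw : w ∈ C1ClosureC2Boundary X)
    (hw' : w' ∈ C1ClosureC2Boundary X) :
    boundaryOperator X v (w + w') p = boundaryOperator X v w p + boundaryOperator X v w' p := by
  have dv := differentiableWithinAt_of_mem hv hp
  have dw := differentiableWithinAt_of_mem hw hp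
  have dw' := differentiableWithinAt_of_mem hw' hp
  rw [boundaryOperator_symm hX hp dv (dw.add dw'), boundaryOperator_add_left hX hp hw hw',
    boundaryOperator_symm hX hp dv dw, boundaryOperator_symm hX hp dv dw']

lemma boundaryOperator_smul_right (hX : IsBoundedSmoothDomain X) (hp : p ∈ frontier X) (c : ℝ)
    {v w : Rn n → ℝ} (hv : v ∈ C1ClosureC2Boundary X) (hw : w ∈ C1ClosureC2Boundary X) :
    boundaryOperator X v (c • w) p = c * boundaryOperator X v w p := by
  have dv := differentiableWithinAt_of_mem hv hp
  have dw := differentiableWithinAt_of_mem hw hp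
  rw [boundaryOperator_symm hX hp dv (dw.const_smul c), boundaryOperator_smul_left hX hp c hw,
    boundaryOperator_symm hX hp dv dw]

/-- The boundary operator as a bilinear map into the continuous functions on the boundary. -/
theorem exists_bilinear_boundaryOperator (hX : IsBoundedSmoothDomain X) :
    ∃ B : C1ClosureC2Boundary X →ₗ[ℝ] C1ClosureC2Boundary X →ₗ[ℝ] C(frontier X, ℝ),
      ∀ (v w : C1ClosureC2Boundary X) (p : frontier X), B v w p = boundaryOperator X v w p := by
  refine ⟨LinearMap.mk₂ ℝ (fun v w => ⟨fun p => boundaryOperator X v w p,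
    (continuousOn_boundaryOperator hX v.2 w.2).domRestrict⟩) ?_ ?_ ?_ ?_, fun v w p => rfl⟩
  · intro v v' w
    ext p
    exact boundaryOperator_add_left hX p.2 v.2 v'.2
  · intro c v w
    ext p
    exact boundaryOperator_smul_left hX p.2 c v.2
  · intro v w w'
    ext p
    exact boundaryOperator_add_right hX p.2 v.2 w.2 w'.2
  · intro c v w
    ext p
    exact boundaryOperator_smul_right hX p.2 c v.2 w.2

end BoundaryOperator

/-! ### Integration along lines transversal to the boundary -/

section Divergence

variable {n : ℕ} {X : Set (Rn n)}

lemma euclideanHausdorffMeasure_image_le {A B : Type*} [MetricSpace A] [MetricSpace B]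
    [MeasurableSpace A] [BorelSpace A] [MeasurableSpace B] [BorelSpace B] {K : NNReal} {f : A → B}
    {s : Set A} (hf : LipschitzOnWith K f s) (d : ℕ) :
    μHE[d] (f '' s) ≤ (K : ENNReal) ^ d * μHE[d] s := by
  have := hf.hausdorffMeasure_image_le (d := d) (by positivity)
  simp only [Measure.euclideanHausdorffMeasure_def, Measure.smul_apply, ENNReal.smul_def,
    smul_eq_mul]
  calc _ ≤ _ * ((K : ENNReal) ^ (d : ℝ) * μH[d] s) := by gcongr
    _ = _ := by rw [ENNReal.rpow_natCast]; ring

/-- The hyperplane through the origin orthogonal to `e`. -/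
noncomputable abbrev hyperplane (e : Rn n) : Submodule ℝ (Rn n) := (ℝ ∙ e)ᗮ

/-- The orthogonal projection onto the hyperplane orthogonal to `e`. -/
noncomputable def toHyperplane (e : Rn n) : Rn n →L[ℝ] hyperplane e :=
  (hyperplane e).orthogonalProjectionOnto

lemma toHyperplane_coe {e : Rn n} (he : ‖e‖ = 1) (x : Rn n) :
    (toHyperplane e x : Rn n) = x - ⟪e, x⟫_ℝ • e := by
  have : (toHyperplane e x : Rn n) = (ℝ ∙ e)ᗮ.starProjection x := rfl
  rw [this, Submodule.starProjection_orthogonal]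
  simp [Submodule.starProjection_unit_singleton ℝ he]

/-- Fubini's theorem for the decomposition of `ℝⁿ` into the lines of direction `e`. -/
lemma integral_lines {e : Rn n} (he : ‖e‖ = 1) {F : Rn n → ℝ} (hF : Integrable F) :
    Integrable (fun y : hyperplane e => ∫ s : ℝ, F (y + s • e)) ∧
      ∫ x, F x = ∫ y : hyperplane e, ∫ s : ℝ, F (y + s • e) := by
  have h0 := (ℝ ∙ e).measurePreserving_measurableEquivProd (0 : Rn n)
  rw [InnerProductSpace.euclideanHausdorffMeasure_eq_volume] at h0
  have h1 := h0.symm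
  have hF1 : Integrable (fun z => F (((ℝ ∙ e).measurableEquivProd (0 : Rn n)).symm z)) :=
    (h1.integrable_comp_emb (MeasurableEquiv.measurableEmbedding _)).2 hF
  have e1 : ∫ x, F x = ∫ z, F (((ℝ ∙ e).measurableEquivProd (0 : Rn n)).symm z) :=
    (h1.integral_comp' F).symm
  have e2 : ∀ y : hyperplane e, ∫ a : (ℝ ∙ e : Submodule ℝ (Rn n)),
      F (((ℝ ∙ e).measurableEquivProd (0 : Rn n)).symm (a, y)) = ∫ s : ℝ, F (y + s • e) := by
    intro y
    have h2 := (LinearIsometryEquiv.toSpanUnitSingleton e he).measurePreserving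
    have := (h2.integral_comp
      (LinearIsometryEquiv.toSpanUnitSingleton e he).toHomeomorph.measurableEmbedding
      (fun a => F (((ℝ ∙ e).measurableEquivProd (0 : Rn n)).symm (a, y))))
    rw [← this]
    simp [add_comm]
  rw [Measure.volume_eq_prod] at hF1 e1
  refine ⟨?_, ?_⟩
  · have := hF1.integral_prod_right
    simpa only [e2] using this
  · rw [e1, integral_prod_symm _ hF1]
    simp only [e2]

lemma finrank_hyperplane {e : Rn n} (he : ‖e‖ = 1) : Module.finrank ℝ (hyperplane e) = n - 1 := by
  have h0 : e ≠ 0 := by rintro rfl; simp at he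
  have h1 := Submodule.finrank_add_finrank_orthogonal (ℝ ∙ e)
  rw [finrank_span_singleton h0] at h1
  simp at h1
  simp only [hyperplane]
  omega

/-- In the closed ball `B(q, δ)` the function `ρ` is a defining function of the domain, and it
increases strictly along every segment of direction `e`. -/
def IsTransversalBall (X : Set (Rn n)) (ρ : Rn n → ℝ) (e q : Rn n) (δ : ℝ) : Prop :=
  ∀ x ∈ Metric.closedBall q δ, IsLocalDefiningFunction X x ρ ∧ 0 < fderiv ℝ ρ x e

lemma fderiv_eq_zero_of_notMem_ball {q : Rn n} {δ : ℝ} {f : Rn n → ℝ}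
    (hs : tsupport f ⊆ Metric.ball q δ) {x : Rn n} (hx : x ∉ Metric.ball q δ) :
    fderiv ℝ f x = 0 := by
  by_contra hne
  exact hx (hs (support_fderiv_subset ℝ hne))

lemma hasCompactSupport_of_subset_ball {q : Rn n} {δ : ℝ} {f : Rn n → ℝ}
    (hs : tsupport f ⊆ Metric.ball q δ) : HasCompactSupport f :=
  (isCompact_closedBall q δ).of_isClosed_subset (isClosed_tsupport f)
    (hs.trans Metric.ball_subset_closedBall)

lemma hasDerivAt_line {f : Rn n → ℝ} (hf : Differentiable ℝ f) (y e : Rn n) (s : ℝ) :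
    HasDerivAt (fun s : ℝ => f (y + s • e)) (fderiv ℝ f (y + s • e) e) s := by
  have h2 : HasDerivAt (fun t : ℝ => y + t • e) e s := by
    simpa using ((hasDerivAt_id s).smul_const e).const_add y
  exact (hf _).hasFDerivAt.comp_hasDerivAt s h2

lemma hasCompactSupport_line {f : Rn n → ℝ} (hf : HasCompactSupport f) (y : Rn n) {e : Rn n}
    (he : ‖e‖ = 1) : HasCompactSupport (fun s : ℝ => f (y + s • e)) := by
  have he0 : e ≠ 0 := by rintro rfl; simp at he
  have hc : Topology.IsClosedEmbedding (fun s : ℝ => y + s • e) :=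
    (Homeomorph.addLeft y).isClosedEmbedding.comp (isClosedEmbedding_smul_left he0)
  exact hf.comp_isClosedEmbedding hc

lemma contDiff_line {f : Rn n → ℝ} (hf : ContDiff ℝ 1 f) (y e : Rn n) :
    ContDiff ℝ 1 (fun s : ℝ => f (y + s • e)) :=
  hf.comp (contDiff_const.add (contDiff_id.smul contDiff_const))

lemma integral_line_eq_zero {f : Rn n → ℝ} (hf : ContDiff ℝ 1 f) (hc : HasCompactSupport f)
    (y : Rn n) {e : Rn n} (he : ‖e‖ = 1) : ∫ s : ℝ, fderiv ℝ f (y + s • e) e = 0 := by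
  have hd := hasDerivAt_line (hf.differentiable (by simp)) y e
  have h1 := contDiff_line hf y e
  have h2 := hasCompactSupport_line hc y he
  refine integral_eq_zero_of_hasDerivAt_of_integrable (f := fun s : ℝ => f (y + s • e)) hd ?_
    (h1.continuous.integrable_of_hasCompactSupport h2)
  have : (fun s : ℝ => fderiv ℝ f (y + s • e) e) = deriv (fun s : ℝ => f (y + s • e)) := by
    ext s; exact (hd s).deriv.symm
  rw [this]
  exact (h1.continuous_deriv le_rfl).integrable_of_hasCompactSupport h2.deriv

section Ball

variable {ρ : Rn n → ℝ} {e q : Rn n} {δ : ℝ}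

lemma convex_line (q : Rn n) (δ : ℝ) (y e : Rn n) :
    Convex ℝ {s : ℝ | y + s • e ∈ Metric.closedBall q δ} := by
  have := (convex_closedBall q δ).affine_preimage (AffineMap.lineMap y (y + e) : ℝ →ᵃ[ℝ] Rn n)
  have h : {s : ℝ | y + s • e ∈ Metric.closedBall q δ} =
      (AffineMap.lineMap y (y + e) : ℝ →ᵃ[ℝ] Rn n) ⁻¹' Metric.closedBall q δ := by
    ext s
    simp [AffineMap.lineMap_apply, add_comm]
  rwa [h]

lemma IsTransversalBall.strictMonoOn (h : IsTransversalBall X ρ e q δ) (hδ : 0 < δ)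
    (y : Rn n) :
    StrictMonoOn (fun s : ℝ => ρ (y + s • e)) {s : ℝ | y + s • e ∈ Metric.closedBall q δ} := by
  have hsm : ContDiff ℝ ∞ ρ := (h q (Metric.mem_closedBall_self hδ.le)).1.smooth
  refine strictMonoOn_of_deriv_pos (convex_line q δ y e) ?_ ?_
  · have := hsm.continuous
    fun_prop
  · intro s hs
    rw [(hasDerivAt_line (hsm.differentiable (by simp)) y e s).deriv]
    exact (h _ (interior_subset hs : s ∈ {s : ℝ | y + s • e ∈ Metric.closedBall q δ})).2

/-- On a line that meets the boundary in the ball, the integral of the derivative over the part of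
the line inside the domain is the value at the boundary point. -/
lemma IsTransversalBall.line_integral_of_mem (h : IsTransversalBall X ρ e q δ) (hδ : 0 < δ)
    (hX : IsOpen X) (he : ‖e‖ = 1) {f : Rn n → ℝ} (hf : ContDiff ℝ 1 f)
    (hs : tsupport f ⊆ Metric.ball q δ) {y : Rn n} {s₀ : ℝ}
    (hx : y + s₀ • e ∈ frontier X ∩ Metric.closedBall q δ) :
    ∫ s : ℝ, X.indicator (fun x => fderiv ℝ f x e) (y + s • e) = f (y + s₀ • e) := by
  have hd := hasDerivAt_line (hf.differentiable (by simp)) y e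
  have h1 : ∀ s, X.indicator (fun x => fderiv ℝ f x e) (y + s • e) =
      (Iio s₀).indicator (deriv (fun s : ℝ => f (y + s • e))) s := by
    intro s
    by_cases hsb : y + s • e ∈ Metric.closedBall q δ
    · have hmono := h.strictMonoOn hδ y
      have h0 : ρ (y + s₀ • e) = 0 := ((h _ hx.2).1.mem_frontier_iff hX).1 hx.1
      have hiff : y + s • e ∈ X ↔ s ∈ Iio s₀ := by
        rw [(h _ hsb).1.eventually_mem_iff.self_of_nhds, mem_Iio, ← hmono.lt_iff_lt hsb hx.2]
        simp only [h0]
      by_cases hm : s ∈ Iio s₀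
      · rw [indicator_of_mem hm, indicator_of_mem (hiff.2 hm), (hd s).deriv]
      · rw [indicator_of_notMem hm, indicator_of_notMem (fun hh => hm (hiff.1 hh))]
    · have hz : fderiv ℝ f (y + s • e) = 0 :=
        fderiv_eq_zero_of_notMem_ball hs fun hh => hsb (Metric.ball_subset_closedBall hh)
      have hz' : deriv (fun s : ℝ => f (y + s • e)) s = 0 := by rw [(hd s).deriv, hz]; rfl
      simp [indicator, hz, hz']
  simp only [h1]
  rw [integral_indicator measurableSet_Iio, ← integral_Iic_eq_integral_Iio]
  exact HasCompactSupport.integral_Iic_deriv_eq (contDiff_line hf y e)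
    (hasCompactSupport_line (hasCompactSupport_of_subset_ball hs) y he) s₀

/-- A line that does not meet the boundary in the ball stays on one side of it there. -/
lemma IsTransversalBall.line_integral_of_notMem (h : IsTransversalBall X ρ e q δ) (hδ : 0 < δ)
    (hX : IsOpen X) (he : ‖e‖ = 1) {f : Rn n → ℝ} (hf : ContDiff ℝ 1 f)
    (hs : tsupport f ⊆ Metric.ball q δ) {y : Rn n}
    (hy : ∀ s : ℝ, y + s • e ∉ frontier X ∩ Metric.closedBall q δ) :
    ∫ s : ℝ, X.indicator (fun x => fderiv ℝ f x e) (y + s • e) = 0 := by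
  have hz : ∀ s : ℝ, y + s • e ∉ Metric.closedBall q δ → fderiv ℝ f (y + s • e) = 0 := fun s hsb =>
    fderiv_eq_zero_of_notMem_ball hs fun hh => hsb (Metric.ball_subset_closedBall hh)
  have hsm : ContDiff ℝ ∞ ρ := (h q (Metric.mem_closedBall_self hδ.le)).1.smooth
  by_cases hex : ∃ s : ℝ, y + s • e ∈ Metric.closedBall q δ ∧ y + s • e ∈ X
  · obtain ⟨s₁, hs₁, hs₁X⟩ := hex
    have hall : ∀ s : ℝ, y + s • e ∈ Metric.closedBall q δ → y + s • e ∈ X := by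
      intro s hsb
      rw [(h _ hsb).1.eventually_mem_iff.self_of_nhds]
      rw [(h _ hs₁).1.eventually_mem_iff.self_of_nhds] at hs₁X
      by_contra hcon
      push Not at hcon
      have hc : ContinuousOn (fun s : ℝ => ρ (y + s • e))
          {s : ℝ | y + s • e ∈ Metric.closedBall q δ} := by
        have := hsm.continuous
        fun_prop
      obtain ⟨s₂, hs₂, h0⟩ := (convex_line q δ y e).isPreconnected.intermediate_value hs₁ hsb hc
        (show (0 : ℝ) ∈ Icc _ _ from ⟨hs₁X.le, hcon⟩)
      exact hy s₂ ⟨((h _ hs₂).1.mem_frontier_iff hX).2 h0, hs₂⟩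
    rw [← integral_line_eq_zero hf (hasCompactSupport_of_subset_ball hs) y he]
    congr 1
    ext s
    by_cases hsb : y + s • e ∈ Metric.closedBall q δ
    · rw [indicator_of_mem (hall s hsb)]
    · simp [indicator, hz s hsb]
  · push Not at hex
    have : ∀ s : ℝ, X.indicator (fun x => fderiv ℝ f x e) (y + s • e) = 0 := by
      intro s
      by_cases hsb : y + s • e ∈ Metric.closedBall q δ
      · rw [indicator_of_notMem (hex s hsb)]
      · simp [indicator, hz s hsb]
    simp [this]

end Ball

end Divergence

/-! ### Area and projections -/

section Divergence

variable {n : ℕ} {X : Set (Rn n)}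

lemma toHyperplane_add_smul {e : Rn n} (he : ‖e‖ = 1) (y : hyperplane e) (s : ℝ) :
    toHyperplane e (y + s • e) = y := by
  have h1 : ⟪e, (y : Rn n)⟫_ℝ = 0 := Submodule.mem_orthogonal_singleton_iff_inner_right.1 y.2
  ext1
  rw [toHyperplane_coe he, inner_add_right, h1, inner_smul_right, real_inner_self_eq_norm_sq, he]
  simp

lemma add_inner_smul_eq {e : Rn n} (he : ‖e‖ = 1) (x : Rn n) :
    (toHyperplane e x : Rn n) + ⟪e, x⟫_ℝ • e = x := by
  rw [toHyperplane_coe he, sub_add_cancel]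

lemma norm_toHyperplane_sq {e : Rn n} (he : ‖e‖ = 1) (x : Rn n) :
    ‖toHyperplane e x‖ ^ 2 = ‖x‖ ^ 2 - ⟪e, x⟫_ℝ ^ 2 := by
  change ‖(toHyperplane e x : Rn n)‖ ^ 2 = _
  rw [toHyperplane_coe he, norm_sub_sq_real, inner_smul_right, norm_smul, he,
    real_inner_comm x e, Real.norm_eq_abs, mul_one, sq_abs]
  ring

lemma lipschitzWith_toHyperplane {e : Rn n} (he : ‖e‖ = 1) :
    LipschitzWith 1 (toHyperplane e) := by
  refine LipschitzWith.of_dist_le_mul fun x y => ?_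
  rw [dist_eq_norm, dist_eq_norm, ← map_sub, NNReal.coe_one, one_mul]
  refine abs_le_of_sq_le_sq' ?_ (norm_nonneg _) |>.2
  rw [norm_toHyperplane_sq he]
  nlinarith [sq_nonneg ⟪e, x - y⟫_ℝ]

lemma volume_hyperplane_eq {e : Rn n} (he : ‖e‖ = 1) :
    (volume : Measure (hyperplane e)) = μHE[n - 1] := by
  rw [← InnerProductSpace.euclideanHausdorffMeasure_eq_volume, finrank_hyperplane he]

/-- Projections do not increase area. -/
lemma volume_restrict_image_le {e : Rn n} (he : ‖e‖ = 1) (A : Set (Rn n)) :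
    (volume : Measure (hyperplane e)).restrict (toHyperplane e '' A) ≤
      (μHE[n - 1].restrict A).map (toHyperplane e) := by
  refine Measure.le_iff.2 fun s hs => ?_
  have hm : Measurable (toHyperplane e) := (toHyperplane e).continuous.measurable
  rw [Measure.restrict_apply hs, Measure.map_apply hm hs, Measure.restrict_apply (hm hs),
    ← image_preimage_inter, volume_hyperplane_eq he]
  simpa using euclideanHausdorffMeasure_image_le
    ((lipschitzWith_toHyperplane he).lipschitzOnWith (s := toHyperplane e ⁻¹' s ∩ A)) (n - 1)

/-- A projection that contracts distances on `A` by a factor at least `L⁻¹` decreases area by a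
factor at least `L⁻⁽ⁿ⁻¹⁾`. -/
lemma map_restrict_le {e : Rn n} (he : ‖e‖ = 1) {A : Set (Rn n)} {L : NNReal}
    (hL : ∀ x ∈ A, ∀ y ∈ A, ‖x - y‖ ≤ L * ‖toHyperplane e (x - y)‖) :
    (μHE[n - 1].restrict A).map (toHyperplane e) ≤
      (L : ENNReal) ^ (n - 1) •
        (volume : Measure (hyperplane e)).restrict (toHyperplane e '' A) := by
  refine Measure.le_iff.2 fun s hs => ?_
  have hm : Measurable (toHyperplane e) := (toHyperplane e).continuous.measurable
  have hinj : InjOn (toHyperplane e) A := by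
    intro x hx y hy hxy
    have := hL x hx y hy
    rw [map_sub, hxy, sub_self, norm_zero, mul_zero] at this
    exact sub_eq_zero.1 (norm_le_zero_iff.1 this)
  have hinv : LeftInvOn (Function.invFunOn (toHyperplane e) A) (toHyperplane e) A :=
    hinj.leftInvOn_invFunOn
  have hlip : LipschitzOnWith L (Function.invFunOn (toHyperplane e) A)
      (toHyperplane e '' (toHyperplane e ⁻¹' s ∩ A)) := by
    rw [lipschitzOnWith_iff_dist_le_mul]
    rintro _ ⟨x, hx, rfl⟩ _ ⟨y, hy, rfl⟩
    rw [hinv hx.2, hinv hy.2, dist_eq_norm, dist_eq_norm, ← map_sub]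
    exact hL x hx.2 y hy.2
  have himg : Function.invFunOn (toHyperplane e) A ''
      (toHyperplane e '' (toHyperplane e ⁻¹' s ∩ A)) = toHyperplane e ⁻¹' s ∩ A :=
    (hinv.mono inter_subset_right).image_image
  rw [Measure.smul_apply, Measure.restrict_apply hs, Measure.map_apply hm hs,
    Measure.restrict_apply (hm hs), ← image_preimage_inter, volume_hyperplane_eq he, smul_eq_mul]
  conv_lhs => rw [← himg]
  exact euclideanHausdorffMeasure_image_le hlip (n - 1)

lemma lintegral_surfaceMeasure_eq {q : Rn n} {δ : ℝ} {f : Rn n → ℝ}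
    (hs : tsupport f ⊆ Metric.ball q δ) :
    ∫⁻ x, ENNReal.ofReal (f x) ∂(surfaceMeasure X) =
      ∫⁻ x in frontier X ∩ Metric.closedBall q δ, ENNReal.ofReal (f x) ∂μHE[n - 1] := by
  have h1 : (fun x => ENNReal.ofReal (f x)) =
      (Metric.closedBall q δ).indicator fun x => ENNReal.ofReal (f x) := by
    ext x
    by_cases hx : x ∈ Metric.closedBall q δ
    · rw [indicator_of_mem hx]
    · rw [indicator_of_notMem hx, image_eq_zero_of_notMem_tsupport
        fun hh => hx (Metric.ball_subset_closedBall (hs hh)), ENNReal.ofReal_zero]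
  rw [h1, lintegral_indicator Metric.isClosed_closedBall.measurableSet, surfaceMeasure,
    Measure.restrict_restrict Metric.isClosed_closedBall.measurableSet, inter_comm, ← h1]

/-! ### The flux in a transversal direction -/

variable {ρ : Rn n → ℝ} {e q : Rn n} {δ : ℝ}

/-- The flux `∫_X ∂ₑf` as an integral over the projection of the boundary along `e`. -/
lemma IsTransversalBall.flux_eq (h : IsTransversalBall X ρ e q δ) (hδ : 0 < δ)
    (hX : IsOpen X) (he : ‖e‖ = 1) {f : Rn n → ℝ} (hf : ContDiff ℝ 1 f)
    (hs : tsupport f ⊆ Metric.ball q δ) (hf0 : ∀ x, 0 ≤ f x) :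
    ∃ G : hyperplane e → ℝ, Measurable G ∧
      (∀ x ∈ frontier X ∩ Metric.closedBall q δ, G (toHyperplane e x) = f x) ∧
      0 ≤ ∫ x in X, fderiv ℝ f x e ∧
      ENNReal.ofReal (∫ x in X, fderiv ℝ f x e) =
        ∫⁻ y in toHyperplane e '' (frontier X ∩ Metric.closedBall q δ), ENNReal.ofReal (G y) := by
  have hcs := hasCompactSupport_of_subset_ball hs
  have hcd : Continuous (fun x => fderiv ℝ f x e) :=
    (hf.continuous_fderiv (by simp)).clm_apply continuous_const
  have hint : Integrable (X.indicator fun x => fderiv ℝ f x e) :=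
    (hcd.integrable_of_hasCompactSupport (hcs.fderiv_apply ℝ e)).indicator hX.measurableSet
  obtain ⟨hGi, hGe⟩ := integral_lines he hint
  set G : hyperplane e → ℝ :=
    fun y => ∫ s : ℝ, X.indicator (fun x => fderiv ℝ f x e) (y + s • e) with hG
  have hGm : Measurable G := by
    have h1 : StronglyMeasurable (X.indicator fun x => fderiv ℝ f x e) :=
      hcd.stronglyMeasurable.indicator hX.measurableSet
    have h2 : StronglyMeasurable (Function.uncurry fun (y : hyperplane e) (s : ℝ) =>
        X.indicator (fun x => fderiv ℝ f x e) (y + s • e)) :=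
      h1.comp_measurable (g := fun z : hyperplane e × ℝ => (z.1 : Rn n) + z.2 • e)
        (by fun_prop)
    exact h2.integral_prod_right.measurable
  have hG1 : ∀ x ∈ frontier X ∩ Metric.closedBall q δ, G (toHyperplane e x) = f x := by
    intro x hx
    have hx' : (toHyperplane e x : Rn n) + ⟪e, x⟫_ℝ • e ∈
        frontier X ∩ Metric.closedBall q δ := by rwa [add_inner_smul_eq he]
    have := h.line_integral_of_mem hδ hX he hf hs hx'
    rwa [add_inner_smul_eq he] at this
  have hG0 : ∀ y, y ∉ toHyperplane e '' (frontier X ∩ Metric.closedBall q δ) → G y = 0 := by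
    intro y hy
    refine h.line_integral_of_notMem hδ hX he hf hs fun s hss => hy ?_
    exact ⟨_, hss, toHyperplane_add_smul he y s⟩
  have hGnn : ∀ y, 0 ≤ G y := by
    intro y
    by_cases hy : y ∈ toHyperplane e '' (frontier X ∩ Metric.closedBall q δ)
    · obtain ⟨x, hx, rfl⟩ := hy
      rw [hG1 x hx]
      exact hf0 x
    · rw [hG0 y hy]
  have hΛ : ∫ x in X, fderiv ℝ f x e = ∫ y, G y := by
    rw [← integral_indicator hX.measurableSet, hGe]
  refine ⟨G, hGm, hG1, ?_, ?_⟩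
  · rw [hΛ]
    exact integral_nonneg hGnn
  · rw [hΛ, ofReal_integral_eq_lintegral_ofReal hGi (Eventually.of_forall hGnn)]
    refine (setLIntegral_eq_of_support_subset ?_).symm
    intro y hy
    by_contra hcon
    exact hy (by simp [hG0 y hcon])

/-- The flux in a unit direction is at most the surface integral. -/
lemma IsTransversalBall.flux_le (h : IsTransversalBall X ρ e q δ) (hδ : 0 < δ)
    (hX : IsOpen X) (he : ‖e‖ = 1) {f : Rn n → ℝ} (hf : ContDiff ℝ 1 f)
    (hs : tsupport f ⊆ Metric.ball q δ) (hf0 : ∀ x, 0 ≤ f x) :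
    ENNReal.ofReal (∫ x in X, fderiv ℝ f x e) ≤
      ∫⁻ x, ENNReal.ofReal (f x) ∂(surfaceMeasure X) := by
  obtain ⟨G, hGm, hG1, -, hGe⟩ := h.flux_eq hδ hX he hf hs hf0
  rw [hGe, lintegral_surfaceMeasure_eq hs]
  calc _ ≤ ∫⁻ y, ENNReal.ofReal (G y)
        ∂((μHE[n - 1].restrict (frontier X ∩ Metric.closedBall q δ)).map (toHyperplane e)) :=
        lintegral_mono' (volume_restrict_image_le he _) le_rfl
    _ = ∫⁻ x in frontier X ∩ Metric.closedBall q δ, ENNReal.ofReal (G (toHyperplane e x))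
          ∂μHE[n - 1] :=
        lintegral_map hGm.ennreal_ofReal (toHyperplane e).continuous.measurable
    _ = _ := setLIntegral_congr_fun (isClosed_frontier.inter
        Metric.isClosed_closedBall).measurableSet fun x hx => by simp only [hG1 x hx]

/-- If the projection along `e` nearly preserves distances on the boundary, then the surface
integral is not much larger than the flux in direction `e`. -/
lemma IsTransversalBall.le_flux (h : IsTransversalBall X ρ e q δ) (hδ : 0 < δ)
    (hX : IsOpen X) (he : ‖e‖ = 1) {f : Rn n → ℝ} (hf : ContDiff ℝ 1 f)
    (hs : tsupport f ⊆ Metric.ball q δ) (hf0 : ∀ x, 0 ≤ f x) {L : NNReal}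
    (hL : ∀ x ∈ frontier X ∩ Metric.closedBall q δ, ∀ y ∈ frontier X ∩ Metric.closedBall q δ,
      ‖x - y‖ ≤ L * ‖toHyperplane e (x - y)‖) :
    ∫⁻ x, ENNReal.ofReal (f x) ∂(surfaceMeasure X) ≤
      (L : ENNReal) ^ (n - 1) * ENNReal.ofReal (∫ x in X, fderiv ℝ f x e) := by
  obtain ⟨G, hGm, hG1, -, hGe⟩ := h.flux_eq hδ hX he hf hs hf0
  rw [hGe, lintegral_surfaceMeasure_eq hs]
  calc _ = ∫⁻ x in frontier X ∩ Metric.closedBall q δ, ENNReal.ofReal (G (toHyperplane e x))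
          ∂μHE[n - 1] := setLIntegral_congr_fun (isClosed_frontier.inter
        Metric.isClosed_closedBall).measurableSet fun x hx => by simp only [hG1 x hx]
    _ = ∫⁻ y, ENNReal.ofReal (G y)
        ∂((μHE[n - 1].restrict (frontier X ∩ Metric.closedBall q δ)).map (toHyperplane e)) :=
        (lintegral_map hGm.ennreal_ofReal (toHyperplane e).continuous.measurable).symm
    _ ≤ ∫⁻ y, ENNReal.ofReal (G y) ∂((L : ENNReal) ^ (n - 1) • (volume.restrict
          (toHyperplane e '' (frontier X ∩ Metric.closedBall q δ)))) :=
        lintegral_mono' (map_restrict_le he hL) le_rfl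
    _ = _ := by rw [lintegral_smul_measure, smul_eq_mul]

end Divergence

/-! ### The divergence theorem -/

section Divergence

variable {n : ℕ} {X : Set (Rn n)} {ρ : Rn n → ℝ} {q : Rn n}

lemma eventually_forall_closedBall {P : Rn n → Prop} (h : ∀ᶠ x in 𝓝 q, P x) :
    ∀ᶠ δ : ℝ in 𝓝[>] 0, ∀ x ∈ Metric.closedBall q δ, P x := by
  obtain ⟨ε, hε, hball⟩ := Metric.nhds_basis_closedBall.eventually_iff.1 h
  filter_upwards [Ioc_mem_nhdsGT hε] with δ hδ x hx
  exact hball (Metric.closedBall_subset_closedBall hδ.2 hx)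

lemma IsLocalDefiningFunction.eventually_isTransversalBall (h : IsLocalDefiningFunction X q ρ)
    {e : Rn n} (he : 0 < fderiv ℝ ρ q e) : ∀ᶠ δ : ℝ in 𝓝[>] 0, IsTransversalBall X ρ e q δ := by
  have hc : Continuous fun x => fderiv ℝ ρ x e :=
    (h.smooth.continuous_fderiv (by simp)).clm_apply continuous_const
  exact eventually_forall_closedBall
    (h.eventually.and (hc.continuousAt.eventually_const_lt he))

lemma IsBoundedSmoothDomain.fderiv_eq (hX : IsBoundedSmoothDomain X) (hq : q ∈ frontier X)
    (h : IsLocalDefiningFunction X q ρ) (a : Rn n) :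
    fderiv ℝ ρ q a = ‖gradient ρ q‖ * ⟪outwardNormal X q, a⟫_ℝ := by
  have hpos := norm_pos_iff.2 h.gradient_ne_zero
  rw [← inner_gradient, h.outwardNormal_eq hX.isOpen hq, inner_smul_left, ← mul_assoc]
  simp [hpos.ne']

/-- Near a boundary point, secants of the boundary are almost tangent to it, so that the orthogonal
projection to the tangent space almost preserves distances. -/
lemma IsBoundedSmoothDomain.eventually_norm_sub_le (hX : IsBoundedSmoothDomain X)
    (hq : q ∈ frontier X) {L : NNReal} (hL : 1 < L) :
    ∀ᶠ δ : ℝ in 𝓝[>] 0, ∀ x ∈ frontier X ∩ Metric.closedBall q δ,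
      ∀ y ∈ frontier X ∩ Metric.closedBall q δ,
        ‖x - y‖ ≤ L * ‖toHyperplane (outwardNormal X q) (x - y)‖ := by
  obtain ⟨ρ, h⟩ := hX.smooth_boundary q hq
  have hν := hX.norm_outwardNormal hq
  have hpos := norm_pos_iff.2 h.gradient_ne_zero
  have hL1 : (1 : ℝ) < L := by exact_mod_cast hL
  set c : ℝ := 1 - ((L : ℝ) ^ 2)⁻¹ with hc
  have hc0 : 0 < c := by
    have : ((L : ℝ) ^ 2)⁻¹ < 1 := inv_lt_one_of_one_lt₀ (by nlinarith)
    linarith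
  have hstrict := (h.smooth.hasStrictFDerivAt (x := q) (by simp)).isLittleO.def
    (c := Real.sqrt c * ‖gradient ρ q‖) (by positivity)
  rw [nhds_prod_eq, eventually_prod_self_iff'] at hstrict
  obtain ⟨t, ht, hts⟩ := hstrict
  filter_upwards [eventually_forall_closedBall (eventually_mem_set.2 ht),
    eventually_forall_closedBall h.eventually] with δ h1 h2 x hx y hy
  have h3 := hts x (h1 x hx.2) y (h1 y hy.2)
  simp only at h3
  rw [((h2 x hx.2).mem_frontier_iff hX.isOpen).1 hx.1,
    ((h2 y hy.2).mem_frontier_iff hX.isOpen).1 hy.1, hX.fderiv_eq hq h, sub_self, zero_sub,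
    norm_neg, norm_mul, norm_norm, Real.norm_eq_abs] at h3
  have h4 : |⟪outwardNormal X q, x - y⟫_ℝ| ≤ Real.sqrt c * ‖x - y‖ := by
    by_contra hcon
    push Not at hcon
    nlinarith
  have h5 : ⟪outwardNormal X q, x - y⟫_ℝ ^ 2 ≤ c * ‖x - y‖ ^ 2 := by
    rw [← sq_abs]
    calc _ ≤ (Real.sqrt c * ‖x - y‖) ^ 2 := by gcongr
      _ = _ := by rw [mul_pow, Real.sq_sqrt hc0.le]
  refine abs_le_of_sq_le_sq' ?_ (by positivity) |>.2
  rw [mul_pow, norm_toHyperplane_sq hν]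
  have h6 : (L : ℝ) ^ 2 * (1 - c) = 1 := by
    rw [hc, sub_sub_cancel, mul_inv_cancel₀ (by positivity)]
  nlinarith [sq_nonneg ‖x - y‖, sq_nonneg (L : ℝ)]

/-- The boundary has finite area: near each of its points, its area is comparable to that of its
projection to the tangent space. -/
lemma IsBoundedSmoothDomain.isFiniteMeasure_surfaceMeasure (hX : IsBoundedSmoothDomain X) :
    IsFiniteMeasure (surfaceMeasure X) := by
  refine ⟨?_⟩
  rw [surfaceMeasure, Measure.restrict_apply_univ]
  refine hX.isCompact_frontier.measure_lt_top_of_nhdsWithin fun q hq => ?_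
  obtain ⟨δ, hδ, hδ0⟩ := ((hX.eventually_norm_sub_le hq (L := 2) (by norm_num)).and
    (self_mem_nhdsWithin : ∀ᶠ δ : ℝ in 𝓝[>] 0, δ ∈ Ioi (0 : ℝ))).exists
  refine ⟨frontier X ∩ Metric.closedBall q δ,
    inter_mem_nhdsWithin _ (Metric.closedBall_mem_nhds q hδ0), ?_⟩
  have h1 := Measure.le_iff'.1 (map_restrict_le (hX.norm_outwardNormal hq) hδ) univ
  rw [Measure.map_apply (toHyperplane _).continuous.measurable MeasurableSet.univ, preimage_univ,
    Measure.restrict_apply_univ, Measure.smul_apply, Measure.restrict_apply_univ, smul_eq_mul] at h1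
  refine h1.trans_lt (ENNReal.mul_lt_top (by simp) ?_)
  exact (((isCompact_closedBall q δ).inter_left isClosed_frontier).image
    (toHyperplane _).continuous).measure_lt_top

lemma IsBoundedSmoothDomain.integrable_surfaceMeasure (hX : IsBoundedSmoothDomain X)
    {f : Rn n → ℝ} (hf : ContinuousOn f (frontier X)) : Integrable f (surfaceMeasure X) := by
  have := hX.isFiniteMeasure_surfaceMeasure
  have hfin : μHE[n - 1] (frontier X) ≠ ⊤ := by
    have h := measure_ne_top (surfaceMeasure X) univ
    rwa [surfaceMeasure, Measure.restrict_apply_univ] at h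
  exact hf.integrableOn_of_subset_isCompact hX.isCompact_frontier
    isClosed_frontier.measurableSet subset_rfl hfin

lemma IsBoundedSmoothDomain.integrableOn (hX : IsBoundedSmoothDomain X)
    {f : Rn n → ℝ} (hf : ContinuousOn f (closure X)) : IntegrableOn f X :=
  (hf.integrableOn_compact hX.isCompact_closure).mono_set subset_closure

lemma integral_fderiv_eq_zero {f : Rn n → ℝ} (hf : ContDiff ℝ 1 f) (hc : HasCompactSupport f)
    (e : Rn n) : ∫ x, fderiv ℝ f x e = 0 := by
  have h1 : Integrable (fun x => fderiv ℝ f x e) :=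
    ((hf.continuous_fderiv (by simp)).clm_apply continuous_const).integrable_of_hasCompactSupport
      (hc.fderiv_apply ℝ e)
  have := integral_mul_fderiv_eq_neg_fderiv_mul_of_integrable (μ := volume) (f := fun _ => (1 : ℝ))
    (g := f) (v := e) (by simp) (by simpa using h1)
    (by simpa using hf.continuous.integrable_of_hasCompactSupport hc)
    (fun x _ => by fun_prop) (fun x _ => hf.differentiable (by simp) x)
  simpa using this

/-- One half of the local divergence theorem, up to an arbitrarily small error. The estimates
`Λ_w ≤ |w| ∮ f` for `w = ν + s e` and `Λ_ν ≥ (1 - ε) ∮ f`, where `Λ_w = ∫_X ∂_w f` and `ν` is the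
normal at the centre of the ball, give `Λ_e ≤ (⟪e, ν⟫ + s |e|² / 2 + ε / s) ∮ f`. -/
lemma IsBoundedSmoothDomain.exists_ball_flux_le (hX : IsBoundedSmoothDomain X)
    (hq : q ∈ closure X) (e : Rn n) {η : ℝ} (hη : 0 < η) :
    ∃ δ > 0, ∀ f : Rn n → ℝ, ContDiff ℝ 1 f → (∀ x, 0 ≤ f x) →
      tsupport f ⊆ Metric.ball q δ →
      ∫ x in X, fderiv ℝ f x e ≤
        ∫ x, f x * (⟪outwardNormal X x, e⟫_ℝ + η) ∂(surfaceMeasure X) := by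
  by_cases hqX : q ∈ X
  · obtain ⟨δ, hδ, hball⟩ := Metric.isOpen_iff.1 hX.isOpen q hqX
    refine ⟨δ, hδ, fun f hf hf0 hs => ?_⟩
    have h1 : ∫ x in X, fderiv ℝ f x e = 0 := by
      rw [setIntegral_eq_integral_of_forall_compl_eq_zero, integral_fderiv_eq_zero hf
        (hasCompactSupport_of_subset_ball hs)]
      intro x hx
      rw [fderiv_eq_zero_of_notMem_ball hs fun hh => hx (hball hh)]
      rfl
    have h2 : ∫ x, f x * (⟪outwardNormal X x, e⟫_ℝ + η) ∂(surfaceMeasure X) = 0 := by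
      refine setIntegral_eq_zero_of_forall_eq_zero fun x hx => ?_
      rw [image_eq_zero_of_notMem_tsupport (f := f), zero_mul]
      intro hh
      rw [hX.isOpen.frontier_eq] at hx
      exact hx.2 (hball (hs hh))
    rw [h1, h2]
  have hqf : q ∈ frontier X := by rw [hX.isOpen.frontier_eq]; exact ⟨hq, hqX⟩
  obtain ⟨ρ, h⟩ := hX.smooth_boundary q hqf
  set ν := outwardNormal X q with hνdef
  have hν : ‖ν‖ = 1 := hX.norm_outwardNormal hqf
  have hpos := norm_pos_iff.2 h.gradient_ne_zero
  -- the size of the perturbation of the normal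
  obtain ⟨s, ⟨hs1, hs2⟩, hs0⟩ : ∃ s : ℝ, (s * ‖e‖ < 1 ∧ s * ‖e‖ ^ 2 / 2 < η / 3) ∧ 0 < s := by
    have c1 : ∀ᶠ s : ℝ in 𝓝 0, s * ‖e‖ < 1 :=
      (by fun_prop : Continuous fun s : ℝ => s * ‖e‖).continuousAt.eventually_lt_const (by simp)
    have c2 : ∀ᶠ s : ℝ in 𝓝 0, s * ‖e‖ ^ 2 / 2 < η / 3 :=
      (by fun_prop : Continuous fun s : ℝ => s * ‖e‖ ^ 2 / 2).continuousAt.eventually_lt_const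
        (by simpa using hη)
    exact (((c1.and c2).filter_mono (nhdsWithin_le_nhds (s := Ioi 0))).and
      (self_mem_nhdsWithin : ∀ᶠ δ : ℝ in 𝓝[>] 0, δ ∈ Ioi (0 : ℝ))).exists
  -- with this `ε` the error `ε / s` is `η / 3`
  set ε := s * η / 3 with hε
  have hε0 : 0 < ε := by positivity
  obtain ⟨L, hL, hL1⟩ : ∃ L : NNReal, (L : ℝ) ^ (n - 1) ≤ 1 + ε ∧ 1 < L := by
    have c1 : ∀ᶠ L : NNReal in 𝓝 1, (L : ℝ) ^ (n - 1) < 1 + ε :=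
      (by fun_prop : Continuous fun L : NNReal =>
        (L : ℝ) ^ (n - 1)).continuousAt.eventually_lt_const (by simpa using hε0)
    obtain ⟨L, h1, h2⟩ := ((c1.filter_mono (nhdsWithin_le_nhds (s := Ioi 1))).and
      (self_mem_nhdsWithin : ∀ᶠ L : NNReal in 𝓝[>] 1, L ∈ Ioi (1 : NNReal))).exists
    exact ⟨L, h1.le, h2⟩
  set w := ν + s • e with hw
  have hinner : -‖e‖ ≤ ⟪ν, e⟫_ℝ := by
    have := abs_le.1 (abs_real_inner_le_norm ν e)
    rw [hν, one_mul] at this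
    exact this.1
  have hνw : 0 < ⟪ν, w⟫_ℝ := by
    rw [hw, inner_add_right, inner_smul_right, real_inner_self_eq_norm_sq, hν]
    nlinarith
  have hw0 : 0 < ‖w‖ := norm_pos_iff.2 fun h0 => by
    rw [h0, inner_zero_right] at hνw
    exact hνw.false
  have hwle : ‖w‖ ≤ 1 + s * ⟪ν, e⟫_ℝ + s ^ 2 * ‖e‖ ^ 2 / 2 := by
    have : ‖w‖ ^ 2 = 1 + 2 * (s * ⟪ν, e⟫_ℝ) + s ^ 2 * ‖e‖ ^ 2 := by
      rw [hw, norm_add_sq_real, inner_smul_right, norm_smul, hν, Real.norm_eq_abs, mul_pow, sq_abs]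
      ring
    nlinarith [sq_nonneg (‖w‖ - 1)]
  have hwhat : ‖‖w‖⁻¹ • w‖ = 1 := by
    rw [norm_smul, norm_inv, norm_norm, inv_mul_cancel₀ hw0.ne']
  have hνcont : ∀ᶠ x in 𝓝 q, x ∈ frontier X → |⟪outwardNormal X x, e⟫_ℝ - ⟪ν, e⟫_ℝ| < η / 3 := by
    have hc : ContinuousWithinAt (fun x => |⟪outwardNormal X x, e⟫_ℝ - ⟪ν, e⟫_ℝ|)
        (frontier X) q :=
      ((((contDiffOn_outwardNormal hX).continuousOn q hqf).inner
        continuousWithinAt_const).sub continuousWithinAt_const).abs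
    exact eventually_nhdsWithin_iff.1 (hc.eventually_lt_const (by simpa [← hνdef] using hη))
  have htr1 := h.eventually_isTransversalBall (e := ν)
    (by rw [hX.fderiv_eq hqf h, ← hνdef, real_inner_self_eq_norm_sq, hν]; simpa using hpos)
  have htr2 := h.eventually_isTransversalBall (e := ‖w‖⁻¹ • w)
    (by rw [hX.fderiv_eq hqf h, ← hνdef, inner_smul_right]; positivity)
  obtain ⟨δ, h1, h2, h3, h4, hδ0⟩ := (htr1.and (htr2.and
    ((hX.eventually_norm_sub_le hqf hL1).and ((eventually_forall_closedBall hνcont).and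
    (self_mem_nhdsWithin : ∀ᶠ δ : ℝ in 𝓝[>] 0, δ ∈ Ioi (0 : ℝ)))))).exists
  refine ⟨δ, hδ0, fun f hf hf0 hs => ?_⟩
  have hfc := hf.continuous
  have hfin : IsFiniteMeasure (surfaceMeasure X) := hX.isFiniteMeasure_surfaceMeasure
  have hfi : Integrable f (surfaceMeasure X) := hX.integrable_surfaceMeasure hfc.continuousOn
  set I := ∫ x, f x ∂(surfaceMeasure X) with hI
  have hI0 : 0 ≤ I := integral_nonneg hf0
  have hIl : ∫⁻ x, ENNReal.ofReal (f x) ∂(surfaceMeasure X) = ENNReal.ofReal I :=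
    (ofReal_integral_eq_lintegral_ofReal hfi (Eventually.of_forall hf0)).symm
  have hdint : ∀ a : Rn n, IntegrableOn (fun x => fderiv ℝ f x a) X := fun a =>
    hX.integrableOn ((hf.continuous_fderiv (by simp)).clm_apply continuous_const).continuousOn
  have hΛν : ∫ x in X, fderiv ℝ f x ν ≤ I := by
    have := h1.flux_le hδ0 hX.isOpen hν hf hs hf0
    rw [hIl] at this
    exact (ENNReal.ofReal_le_ofReal_iff hI0).1 this
  have hΛν0 : 0 ≤ ∫ x in X, fderiv ℝ f x ν := by
    obtain ⟨_, _, _, h0, _⟩ := h1.flux_eq hδ0 hX.isOpen hν hf hs hf0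
    exact h0
  have hΛν' : I ≤ (1 + ε) * ∫ x in X, fderiv ℝ f x ν := by
    have := h1.le_flux hδ0 hX.isOpen hν hf hs hf0 h3
    rw [hIl, ← ENNReal.ofReal_coe_nnreal, ← ENNReal.ofReal_pow (NNReal.coe_nonneg L),
      ← ENNReal.ofReal_mul (by positivity), ENNReal.ofReal_le_ofReal_iff (by positivity)] at this
    exact this.trans (mul_le_mul_of_nonneg_right hL hΛν0)
  have hΛw : ∫ x in X, fderiv ℝ f x w ≤ ‖w‖ * I := by
    have := h2.flux_le hδ0 hX.isOpen hwhat hf hs hf0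
    rw [hIl, ENNReal.ofReal_le_ofReal_iff hI0] at this
    simp only [map_smul, smul_eq_mul] at this
    rw [integral_const_mul] at this
    calc _ = ‖w‖ * (‖w‖⁻¹ * ∫ x in X, fderiv ℝ f x w) := by
          rw [← mul_assoc, mul_inv_cancel₀ hw0.ne', one_mul]
      _ ≤ _ := by gcongr
  have hlin : ∫ x in X, fderiv ℝ f x w =
      (∫ x in X, fderiv ℝ f x ν) + s * ∫ x in X, fderiv ℝ f x e := by
    simp only [hw, map_add, map_smul, smul_eq_mul]
    rw [integral_add (hdint ν) ((hdint e).const_mul s), integral_const_mul]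
  have hmain : ∫ x in X, fderiv ℝ f x e ≤ (⟪ν, e⟫_ℝ + 2 * η / 3) * I := by
    have : s * ∫ x in X, fderiv ℝ f x e ≤ s * ((⟪ν, e⟫_ℝ + 2 * η / 3) * I) := by
      have k1 : ‖w‖ * I ≤ (1 + s * ⟪ν, e⟫_ℝ + s ^ 2 * ‖e‖ ^ 2 / 2) * I := by gcongr
      have k2 : s ^ 2 * ‖e‖ ^ 2 / 2 * I ≤ s * (η / 3) * I := by
        have : s ^ 2 * ‖e‖ ^ 2 / 2 = s * (s * ‖e‖ ^ 2 / 2) := by ring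
        rw [this]; gcongr
      have k3 : ε * ∫ x in X, fderiv ℝ f x ν ≤ ε * I := by gcongr
      have k4 : ε * I = s * (η / 3) * I := by rw [hε]; ring
      nlinarith
    exact le_of_mul_le_mul_left this hs0
  refine hmain.trans ?_
  rw [hI, ← integral_const_mul]
  refine integral_mono_ae (hfi.const_mul _) (hX.integrable_surfaceMeasure ?_) ?_
  · exact hfc.continuousOn.mul
      (((contDiffOn_outwardNormal hX).continuousOn.inner continuousOn_const).add continuousOn_const)
  · refine (ae_restrict_iff' isClosed_frontier.measurableSet).2
      (Eventually.of_forall fun x hx => ?_)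
    by_cases hxs : x ∈ tsupport f
    · have := abs_lt.1 (h4 x (Metric.ball_subset_closedBall (hs hxs)) hx)
      simp only
      rw [mul_comm]
      exact mul_le_mul_of_nonneg_left (by linarith) (hf0 x)
    · simp [image_eq_zero_of_notMem_tsupport hxs]

/-- One half of the divergence theorem for nonnegative functions, from the local estimates by a
partition of unity. -/
lemma IsBoundedSmoothDomain.flux_le_of_nonneg (hX : IsBoundedSmoothDomain X) (e : Rn n)
    {f : Rn n → ℝ} (hf : ContDiff ℝ 1 f) (hf0 : ∀ x, 0 ≤ f x) :
    ∫ x in X, fderiv ℝ f x e ≤ ∫ x, f x * ⟪outwardNormal X x, e⟫_ℝ ∂(surfaceMeasure X) := by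
  have hνe : ContinuousOn (fun x => ⟪outwardNormal X x, e⟫_ℝ) (frontier X) :=
    (contDiffOn_outwardNormal hX).continuousOn.inner continuousOn_const
  have hfi : Integrable f (surfaceMeasure X) :=
    hX.integrable_surfaceMeasure hf.continuous.continuousOn
  have hfi' : Integrable (fun x => f x * ⟪outwardNormal X x, e⟫_ℝ) (surfaceMeasure X) :=
    hX.integrable_surfaceMeasure (hf.continuous.continuousOn.mul hνe)
  have key : ∀ η : ℝ, 0 < η → ∫ x in X, fderiv ℝ f x e ≤
      (∫ x, f x * ⟪outwardNormal X x, e⟫_ℝ ∂(surfaceMeasure X)) +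
        η * ∫ x, f x ∂(surfaceMeasure X) := by
    intro η hη
    choose! δ hδ hest using fun q (hq : q ∈ closure X) => hX.exists_ball_flux_le hq e hη
    obtain ⟨t, htX, htcov⟩ := hX.isCompact_closure.elim_nhds_subcover
      (fun q => Metric.ball q (δ q)) fun q hq => Metric.ball_mem_nhds q (hδ q hq)
    obtain ⟨χ, hχ⟩ := SmoothPartitionOfUnity.exists_isSubordinate
      (modelWithCornersSelf ℝ (Rn n)) (isClosed_closure (s := X))
      (fun q : t => Metric.ball (q : Rn n) (δ q)) (fun q => Metric.isOpen_ball)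
      (by simpa [iUnion_subtype] using htcov)
    have hχs : ∀ q : t, ContDiff ℝ 1 (χ q) := fun q =>
      (contMDiff_iff_contDiff.1 (χ q).contMDiff).of_le (by exact_mod_cast le_top)
    have hsum : ∀ x ∈ closure X, ∑ q : t, χ q x = 1 := by
      intro x hx
      rw [← finsum_eq_sum_of_fintype]
      exact χ.sum_eq_one hx
    have hχf : ∀ q : t, ContDiff ℝ 1 (fun x => χ q x * f x) := fun q => (hχs q).mul hf
    have hsupp : ∀ q : t, tsupport (fun x => χ q x * f x) ⊆ Metric.ball (q : Rn n) (δ q) :=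
      fun q => (tsupport_mul_subset_left (f := χ q) (g := f)).trans (hχ q)
    have hloc : ∀ q : t, ∫ x in X, fderiv ℝ (fun x => χ q x * f x) x e ≤
        ∫ x, χ q x * f x * (⟪outwardNormal X x, e⟫_ℝ + η) ∂(surfaceMeasure X) := fun q =>
      hest q (htX q q.2) _ (hχf q) (fun x => mul_nonneg (χ.nonneg q x) (hf0 x)) (hsupp q)
    have h1 : ∫ x in X, fderiv ℝ f x e =
        ∑ q : t, ∫ x in X, fderiv ℝ (fun x => χ q x * f x) x e := by
      rw [← integral_finsetSum]
      · refine setIntegral_congr_fun hX.isOpen.measurableSet fun x hx => ?_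
        have hev : f =ᶠ[𝓝 x] fun y => ∑ q : t, χ q y * f y := by
          filter_upwards [hX.isOpen.mem_nhds hx] with y hy
          rw [← Finset.sum_mul, hsum y (subset_closure hy), one_mul]
        rw [hev.fderiv_eq, fderiv_fun_sum fun q _ => (hχf q).differentiable (by simp) x]
        simp
      · exact fun q _ => hX.integrableOn
          (((hχf q).continuous_fderiv (by simp)).clm_apply continuous_const).continuousOn
    have h2 : ∑ q : t, ∫ x, χ q x * f x * (⟪outwardNormal X x, e⟫_ℝ + η) ∂(surfaceMeasure X) =
        ∫ x, f x * (⟪outwardNormal X x, e⟫_ℝ + η) ∂(surfaceMeasure X) := by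
      rw [← integral_finsetSum]
      · refine setIntegral_congr_fun isClosed_frontier.measurableSet fun x hx => ?_
        simp only [mul_assoc]
        rw [← Finset.sum_mul, hsum x (frontier_subset_closure hx), one_mul]
      · exact fun q _ => hX.integrable_surfaceMeasure
          ((hχf q).continuous.continuousOn.mul (hνe.add continuousOn_const))
    calc _ ≤ ∫ x, f x * (⟪outwardNormal X x, e⟫_ℝ + η) ∂(surfaceMeasure X) := by
          rw [h1, ← h2]
          exact Finset.sum_le_sum fun q _ => hloc q
      _ = _ := by
          rw [← integral_const_mul, ← integral_add hfi' (hfi.const_mul η)]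
          congr 1
          ext x
          ring
  have hlim : Tendsto (fun η : ℝ => (∫ x, f x * ⟪outwardNormal X x, e⟫_ℝ ∂(surfaceMeasure X)) +
      η * ∫ x, f x ∂(surfaceMeasure X)) (𝓝[>] 0)
      (𝓝 (∫ x, f x * ⟪outwardNormal X x, e⟫_ℝ ∂(surfaceMeasure X))) := by
    have : Continuous fun η : ℝ => (∫ x, f x * ⟪outwardNormal X x, e⟫_ℝ ∂(surfaceMeasure X)) +
      η * ∫ x, f x ∂(surfaceMeasure X) := by fun_prop
    simpa using (this.tendsto 0).mono_left nhdsWithin_le_nhds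
  exact ge_of_tendsto hlim (eventually_mem_nhdsWithin.mono fun η hη => key η hη)

/-- **Divergence theorem** on a bounded smooth domain, with respect to the Hausdorff measure of the
boundary, for a vector field of constant direction. -/
theorem IsBoundedSmoothDomain.integral_fderiv (hX : IsBoundedSmoothDomain X) (e : Rn n)
    {f : Rn n → ℝ} (hf : ContDiff ℝ 1 f) :
    ∫ x in X, fderiv ℝ f x e = ∫ x, f x * ⟪outwardNormal X x, e⟫_ℝ ∂(surfaceMeasure X) := by
  have hsq : ∀ g : Rn n → ℝ, ContDiff ℝ 1 g → ∫ x in X, fderiv ℝ (fun x => g x ^ 2) x e =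
      ∫ x, g x ^ 2 * ⟪outwardNormal X x, e⟫_ℝ ∂(surfaceMeasure X) := by
    intro g hg
    refine le_antisymm (hX.flux_le_of_nonneg e (hg.pow 2) fun x => sq_nonneg _) ?_
    have := hX.flux_le_of_nonneg (-e) (hg.pow 2) fun x => sq_nonneg _
    simp only [map_neg, inner_neg_right, mul_neg, integral_neg] at this
    linarith
  have hνe : ContinuousOn (fun x => ⟪outwardNormal X x, e⟫_ℝ) (frontier X) :=
    (contDiffOn_outwardNormal hX).continuousOn.inner continuousOn_const
  -- the general case follows by polarization, `4 f = (f + 1)² - (f - 1)²`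
  have hp := hf.add (contDiff_const (c := (1 : ℝ)))
  have hm := hf.sub (contDiff_const (c := (1 : ℝ)))
  have h1 : ∀ x, fderiv ℝ f x e =
      (1 / 4) * (fderiv ℝ (fun x => (f x + 1) ^ 2) x e -
        fderiv ℝ (fun x => (f x - 1) ^ 2) x e) := by
    intro x
    have hd := hf.differentiable (by simp) x
    rw [fderiv_fun_pow 2 (hd.add_const 1), fderiv_fun_pow 2 (hd.sub_const 1), fderiv_add_const,
      fderiv_sub_const]
    simp
    ring
  have i1 : ∀ g : Rn n → ℝ, ContDiff ℝ 1 g →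
      IntegrableOn (fun x => fderiv ℝ (fun x => g x ^ 2) x e) X := fun g hg =>
    hX.integrableOn (((hg.pow 2).continuous_fderiv (by simp)).clm_apply
      continuous_const).continuousOn
  have i2 : ∀ g : Rn n → ℝ, ContDiff ℝ 1 g →
      Integrable (fun x => g x ^ 2 * ⟪outwardNormal X x, e⟫_ℝ) (surfaceMeasure X) := fun g hg =>
    hX.integrable_surfaceMeasure ((hg.pow 2).continuous.continuousOn.mul hνe)
  simp only [h1]
  rw [integral_const_mul, integral_sub (i1 _ hp) (i1 _ hm), hsq _ hp, hsq _ hm,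
    ← integral_sub (i2 _ hp) (i2 _ hm), ← integral_const_mul]
  congr 1
  ext x
  ring

end Divergence

/-! ### Second order jets up to the boundary -/

section Jets

variable {n : ℕ} {X : Set (Rn n)} {p x : Rn n} {v w : Rn n → ℝ}

/-- The Riesz isomorphism, as a linear isometry from covectors to vectors. -/
noncomputable def riesz (n : ℕ) : (Rn n →L[ℝ] ℝ) ≃ₗᵢ[ℝ] Rn n :=
  (InnerProductSpace.toDual ℝ (Rn n)).symm

lemma inner_riesz (φ : Rn n →L[ℝ] ℝ) (a : Rn n) : ⟪riesz n φ, a⟫_ℝ = φ a :=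
  InnerProductSpace.toDual_symm_apply

lemma riesz_eq_iff {φ : Rn n →L[ℝ] ℝ} {g : Rn n} : riesz n φ = g ↔ φ = innerSL ℝ g := by
  constructor
  · rintro rfl
    ext a
    simp [inner_riesz]
  · rintro rfl
    exact ext_inner_right ℝ fun a => by simp [inner_riesz]

lemma innerSL_riesz (φ : Rn n →L[ℝ] ℝ) : innerSL ℝ (riesz n φ) = φ :=
  (riesz_eq_iff.1 rfl).symm

/-- The gradient of `v`, extended from `X` to its closure. -/
noncomputable def closureGradient (X : Set (Rn n)) (v : Rn n → ℝ) (x : Rn n) : Rn n :=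
  riesz n (fderivWithin ℝ v (closure X) x)

/-- The Hessian of `v` as an endomorphism, extended from `X` to its closure. -/
noncomputable def closureHessian (X : Set (Rn n)) (v : Rn n → ℝ) (x : Rn n) : Rn n →L[ℝ] Rn n :=
  fderivWithin ℝ (closureGradient X v) (closure X) x

lemma contDiffOn_of_mem (hv : v ∈ C2Closure X) : ContDiffOn ℝ 2 v (closure X) := hv

lemma C2Closure_le : C2Closure X ≤ C1ClosureC2Boundary X := fun v hv =>
  ⟨(contDiffOn_of_mem hv).of_le (by norm_num),
    (contDiffOn_of_mem hv).mono frontier_subset_closure⟩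

lemma contDiffOn_closureGradient (hX : IsBoundedSmoothDomain X) (hv : v ∈ C2Closure X) :
    ContDiffOn ℝ 1 (closureGradient X v) (closure X) :=
  (riesz n).contDiff.comp_contDiffOn
    ((contDiffOn_of_mem hv).fderivWithin hX.uniqueDiffOn_closure (by norm_num))

lemma continuousOn_closureHessian (hX : IsBoundedSmoothDomain X) (hv : v ∈ C2Closure X) :
    ContinuousOn (closureHessian X v) (closure X) :=
  (contDiffOn_closureGradient hX hv).continuousOn_fderivWithin hX.uniqueDiffOn_closure (by simp)

lemma hasFDerivWithinAt_of_mem (hv : v ∈ C2Closure X) (hx : x ∈ closure X) :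
    HasFDerivWithinAt v (innerSL ℝ (closureGradient X v x)) (closure X) x := by
  rw [closureGradient, innerSL_riesz]
  exact ((contDiffOn_of_mem hv).differentiableOn (by simp) x hx).hasFDerivWithinAt

lemma hasFDerivWithinAt_closureGradient (hX : IsBoundedSmoothDomain X) (hv : v ∈ C2Closure X)
    (hx : x ∈ closure X) :
    HasFDerivWithinAt (closureGradient X v) (closureHessian X v x) (closure X) x :=
  ((contDiffOn_closureGradient hX hv).differentiableOn (by simp) x hx).hasFDerivWithinAt

lemma closureGradient_eq (hX : IsBoundedSmoothDomain X) (hx : x ∈ closure X) {g : Rn n}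
    (h : HasFDerivWithinAt v (innerSL ℝ g) (closure X) x) : closureGradient X v x = g := by
  rw [closureGradient, h.fderivWithin (hX.uniqueDiffOn_closure x hx)]
  exact riesz_eq_iff.2 rfl

lemma closureHessian_eq (hX : IsBoundedSmoothDomain X) (hx : x ∈ closure X)
    {G : Rn n → Rn n} {A : Rn n →L[ℝ] Rn n}
    (hG : ∀ y ∈ closure X, HasFDerivWithinAt v (innerSL ℝ (G y)) (closure X) y)
    (hA : HasFDerivWithinAt G A (closure X) x) : closureHessian X v x = A := by
  have h : EqOn (closureGradient X v) G (closure X) := fun y hy =>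
    closureGradient_eq hX hy (hG y hy)
  rw [closureHessian, fderivWithin_congr h (h hx)]
  exact hA.fderivWithin (hX.uniqueDiffOn_closure x hx)

/-! ### The interior integrand -/

lemma hessian_apply (hX : IsBoundedSmoothDomain X) (hv : v ∈ C2Closure X) (hx : x ∈ X)
    (i j : Fin n) :
    hessian v x i j = closureHessian X v x (EuclideanSpace.single i 1) j := by
  have h1 : ∀ y ∈ X, fderiv ℝ v y = innerSL ℝ (closureGradient X v y) := fun y hy =>
    ((hasFDerivWithinAt_of_mem hv (subset_closure hy)).hasFDerivAt
      (mem_of_superset (hX.isOpen.mem_nhds hy) subset_closure)).fderiv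
  have h2 : fderiv ℝ v =ᶠ[𝓝 x] fun y => innerSL ℝ (closureGradient X v y) := by
    filter_upwards [hX.isOpen.mem_nhds hx] with y hy using h1 y hy
  have h3 : HasFDerivAt (closureGradient X v) (closureHessian X v x) x :=
    (hasFDerivWithinAt_closureGradient hX hv (subset_closure hx)).hasFDerivAt
      (mem_of_superset (hX.isOpen.mem_nhds hx) subset_closure)
  have h4 := ((innerSL ℝ).hasFDerivAt.comp x h3).congr_of_eventuallyEq h2
  rw [hessian, Matrix.of_apply, h4.fderiv]
  change ⟪closureHessian X v x (EuclideanSpace.single i 1), EuclideanSpace.single j 1⟫_ℝ = _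
  rw [EuclideanSpace.inner_single_right]
  simp

/-- The polarized `σ₂` of two endomorphisms, in coordinates. -/
@[irreducible] noncomputable def endSigmaTwo (A B : Rn n →L[ℝ] Rn n) : ℝ :=
  (1 / 2) * ∑ i, ∑ j, (A (EuclideanSpace.single i 1) i * B (EuclideanSpace.single j 1) j -
    A (EuclideanSpace.single i 1) j * B (EuclideanSpace.single j 1) i)

lemma generalizedKronecker_pair (a b c d : Fin n) :
    generalizedKronecker ![a, b] ![c, d] =
      (if a = c then 1 else 0) * (if b = d then 1 else 0) -
        (if a = d then 1 else 0) * (if b = c then 1 else 0) := by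
  rw [generalizedKronecker, Matrix.det_fin_two]
  rfl

lemma sigmaPolarized_two (A B : Matrix (Fin n) (Fin n) ℝ) :
    sigmaPolarized ![A, B] = (1 / 2) * ∑ i, ∑ j, (A i i * B j j - A i j * B j i) := by
  have hsum : ∀ F : (Fin 2 → Fin n) → ℝ, ∑ i, F i = ∑ a, ∑ b, F ![a, b] := by
    intro F
    rw [← (finTwoArrowEquiv (Fin n)).symm.sum_comp F, Fintype.sum_prod_type]
    rfl
  have h2 : ((Nat.factorial 2 : ℕ) : ℝ) = 2 := by norm_num [Nat.factorial]
  rw [sigmaPolarized, h2]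
  congr 1
  simp only [hsum, generalizedKronecker_pair, Fin.prod_univ_two,
    Matrix.cons_val_zero, Matrix.cons_val_one]
  refine Finset.sum_congr rfl fun i _ => Finset.sum_congr rfl fun j _ => ?_
  simp [sub_mul, Finset.sum_sub_distrib]

lemma sigmaTwo_eq (hX : IsBoundedSmoothDomain X) (hv : v ∈ C2Closure X) (hw : w ∈ C2Closure X)
    (hx : x ∈ X) :
    sigmaTwo v w x = endSigmaTwo (closureHessian X v x) (closureHessian X w x) := by
  rw [sigmaTwo, sigmaPolarized_two, endSigmaTwo]
  simp only [hessian_apply hX hv hx, hessian_apply hX hw hx]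

lemma continuous_endSigmaTwo :
    Continuous fun z : (Rn n →L[ℝ] Rn n) × (Rn n →L[ℝ] Rn n) => endSigmaTwo z.1 z.2 := by
  unfold endSigmaTwo
  fun_prop

lemma continuousOn_endSigmaTwo {α : Type*} [TopologicalSpace α] {s : Set α}
    {A B : α → Rn n →L[ℝ] Rn n} (hA : ContinuousOn A s) (hB : ContinuousOn B s) :
    ContinuousOn (fun z => endSigmaTwo (A z) (B z)) s := by
  unfold endSigmaTwo
  fun_prop

lemma tendsto_endSigmaTwo {A B : ℕ → Rn n →L[ℝ] Rn n} {A₀ B₀ : Rn n →L[ℝ] Rn n}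
    (hA : Tendsto A atTop (𝓝 A₀)) (hB : Tendsto B atTop (𝓝 B₀)) :
    Tendsto (fun k => endSigmaTwo (A k) (B k)) atTop (𝓝 (endSigmaTwo A₀ B₀)) :=
  (continuous_endSigmaTwo.tendsto (A₀, B₀)).comp (hA.prodMk_nhds hB)

/-! ### The boundary integrand -/

lemma hasFDerivWithinAt_frontier (hv : v ∈ C2Closure X) (hp : p ∈ frontier X) :
    HasFDerivWithinAt v (innerSL ℝ (closureGradient X v p)) (frontier X) p :=
  (hasFDerivWithinAt_of_mem hv (frontier_subset_closure hp)).mono frontier_subset_closure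

lemma normalDeriv_eq (hX : IsBoundedSmoothDomain X) (hv : v ∈ C2Closure X) (hp : p ∈ frontier X) :
    normalDeriv X v p = ⟪closureGradient X v p, outwardNormal X p⟫_ℝ := by
  rw [normalDeriv, (hasFDerivWithinAt_of_mem hv (frontier_subset_closure hp)).fderivWithin
    (hX.uniqueDiffOn_closure p (frontier_subset_closure hp)), innerSL_apply_apply]

lemma inner_projAlong_left (a x y : Rn n) : ⟪projAlong a x, y⟫_ℝ = ⟪x, projAlong a y⟫_ℝ := by
  simp only [projAlong_apply, inner_sub_left, inner_sub_right, inner_smul_left, inner_smul_right,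
    conj_trivial, real_inner_comm]
  ring

lemma tangentialGradient_eq (hX : IsBoundedSmoothDomain X) (hv : v ∈ C2Closure X)
    (hp : p ∈ frontier X) :
    tangentialGradient X v p = projAlong (outwardNormal X p) (closureGradient X v p) := by
  refine ext_inner_right ℝ fun a => ?_
  rw [inner_tangentialGradient, tangentialDeriv_eq hX hp (hasFDerivWithinAt_frontier hv hp),
    inner_projAlong_left]
  simp

lemma projAlong_self {a : Rn n} (ha : ‖a‖ = 1) : projAlong a a = 0 := by
  rw [projAlong_apply, real_inner_self_eq_norm_sq, ha]
  simp

lemma traceFunctional_smulRight (φ : Rn n →L[ℝ] ℝ) (a : Rn n) :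
    traceFunctional n (φ.smulRight a) = φ a := by
  rw [traceFunctional_apply]
  exact LinearMap.trace_smulRight (φ : Rn n →ₗ[ℝ] ℝ) a

lemma traceFunctional_comp_comm (A B : Rn n →L[ℝ] Rn n) :
    traceFunctional n (A.comp B) = traceFunctional n (B.comp A) := by
  rw [traceFunctional_apply, traceFunctional_apply]
  exact LinearMap.trace_mul_comm ℝ (A : Rn n →ₗ[ℝ] Rn n) (B : Rn n →ₗ[ℝ] Rn n)

lemma traceFunctional_comp_projAlong (A : Rn n →L[ℝ] Rn n) (a : Rn n) :
    traceFunctional n (A.comp (projAlong a)) = traceFunctional n A - ⟪a, A a⟫_ℝ := by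
  have : A.comp (projAlong a) = A - (innerSL ℝ a).smulRight (A a) := by
    ext1 x
    simp [projAlong_apply]
  rw [this, map_sub, traceFunctional_smulRight]
  simp

/-- `Δ̄v = tr_T D²v - H v_n`, where `tr_T` is the trace over the tangent space. -/
lemma tangentialLaplacian_eq (hX : IsBoundedSmoothDomain X) (hv : v ∈ C2Closure X)
    (hp : p ∈ frontier X) :
    tangentialLaplacian X v p =
      traceFunctional n ((closureHessian X v p).comp (projAlong (outwardNormal X p))) -
        ⟪closureGradient X v p, outwardNormal X p⟫_ℝ * meanCurvature X p := by
  have hν := hX.norm_outwardNormal hp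
  have hN := (hX.differentiableWithinAt_outwardNormal hp).hasFDerivWithinAt
  have hG := (hasFDerivWithinAt_closureGradient hX hv (frontier_subset_closure hp)).mono
    frontier_subset_closure
  have hinner := hN.inner ℝ hG
  set N' := fderivWithin ℝ (outwardNormal X) (frontier X) p
  set ψ := (fderivInnerCLM ℝ (outwardNormal X p, closureGradient X v p)).comp
    (N'.prod (closureHessian X v p)) with hψ
  have hV := hG.sub (hinner.smul hN)
  have heq : EqOn (tangentialGradient X v) (closureGradient X v -
      (fun x => ⟪outwardNormal X x, closureGradient X v x⟫_ℝ) • outwardNormal X)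
      (frontier X) := fun x hx => by
    rw [tangentialGradient_eq hX hv hx, projAlong_apply]
    rfl
  rw [tangentialLaplacian, tangentialDiv_eq, tangentialDeriv_congr hp heq,
    tangentialDeriv_eq hX hp hV, meanCurvature, tangentialDiv_eq, tangentialDeriv_eq hX hp hN,
    ContinuousLinearMap.sub_comp, map_sub, ContinuousLinearMap.add_comp, map_add,
    ContinuousLinearMap.smul_comp, map_smul, smul_eq_mul, traceFunctional_comp_comm
      (ψ.smulRight (outwardNormal X p))]
  have h0 : (projAlong (outwardNormal X p)).comp (ψ.smulRight (outwardNormal X p)) = 0 := by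
    ext1 x
    simp [projAlong_self hν]
  rw [h0, map_zero, add_zero, real_inner_comm]

/-- The boundary operator at `p` as a function of the gradients `g`, `g'` and the Hessians `A`, `A'`
at `p` of the two functions. -/
@[irreducible] noncomputable def jetBoundaryOperator (X : Set (Rn n)) (p g : Rn n)
    (A : Rn n →L[ℝ] Rn n) (g' : Rn n) (A' : Rn n →L[ℝ] Rn n) : ℝ :=
  (1 / 2) * (⟪g, outwardNormal X p⟫_ℝ *
      (traceFunctional n (A'.comp (projAlong (outwardNormal X p))) -
        ⟪g', outwardNormal X p⟫_ℝ * meanCurvature X p)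
    + ⟪g', outwardNormal X p⟫_ℝ *
      (traceFunctional n (A.comp (projAlong (outwardNormal X p))) -
        ⟪g, outwardNormal X p⟫_ℝ * meanCurvature X p)
    + ⟪tangentialDeriv X (outwardNormal X) p (projAlong (outwardNormal X p) g),
        projAlong (outwardNormal X p) g'⟫_ℝ
    + meanCurvature X p * ⟪g, outwardNormal X p⟫_ℝ * ⟪g', outwardNormal X p⟫_ℝ)

lemma boundaryOperator_eq (hX : IsBoundedSmoothDomain X) (hv : v ∈ C2Closure X)
    (hw : w ∈ C2Closure X) (hp : p ∈ frontier X) :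
    boundaryOperator X v w p = jetBoundaryOperator X p (closureGradient X v p)
      (closureHessian X v p) (closureGradient X w p) (closureHessian X w p) := by
  rw [boundaryOperator, jetBoundaryOperator, normalDeriv_eq hX hv hp, normalDeriv_eq hX hw hp,
    tangentialLaplacian_eq hX hv hp, tangentialLaplacian_eq hX hw hp, secondFundamentalForm,
    tangentialGradient_eq hX hv hp, tangentialGradient_eq hX hw hp]

lemma continuousOn_jetBoundaryOperator (hX : IsBoundedSmoothDomain X) {α : Type*}
    [TopologicalSpace α] {s : Set α} {π g g' : α → Rn n} {A A' : α → Rn n →L[ℝ] Rn n}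
    (hπ : ContinuousOn π s) (hπX : MapsTo π s (frontier X)) (hg : ContinuousOn g s)
    (hA : ContinuousOn A s) (hg' : ContinuousOn g' s) (hA' : ContinuousOn A' s) :
    ContinuousOn (fun z => jetBoundaryOperator X (π z) (g z) (A z) (g' z) (A' z)) s := by
  have hν : ContinuousOn (fun z => outwardNormal X (π z)) s :=
    (contDiffOn_outwardNormal hX).continuousOn.comp hπ hπX
  have hL : ContinuousOn (fun z => tangentialDeriv X (outwardNormal X) (π z)) s :=
    (contDiffOn_tangentialDeriv (k := 0) hX
      ((contDiffOn_outwardNormal hX).of_le (by exact_mod_cast le_top))).continuousOn.comp hπ hπX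
  have hH : ContinuousOn (fun z => meanCurvature X (π z)) s :=
    (continuousOn_tangentialDiv hX
      ((contDiffOn_outwardNormal hX).of_le (by exact_mod_cast le_top))).comp hπ hπX
  have hP : ContinuousOn (fun z => projAlong (outwardNormal X (π z))) s :=
    (contDiff_projAlong (n := n) (k := 0)).continuous.comp_continuousOn hν
  unfold jetBoundaryOperator
  have htr := (traceFunctional n).continuous
  have c1 := hg.inner (𝕜 := ℝ) hν
  have c2 := hg'.inner (𝕜 := ℝ) hν
  have c3 := htr.comp_continuousOn (hA.clm_comp hP)
  have c4 := htr.comp_continuousOn (hA'.clm_comp hP)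
  have c5 := (hL.clm_apply (hP.clm_apply hg)).inner (𝕜 := ℝ) (hP.clm_apply hg')
  exact continuousOn_const.mul ((((c1.mul (c4.sub (c2.mul hH))).add
    (c2.mul (c3.sub (c1.mul hH)))).add c5).add ((hH.mul c1).mul c2))

/-- The boundary operator is bounded on jets of bounded size. -/
lemma exists_bound_jetBoundaryOperator (hX : IsBoundedSmoothDomain X) (C C' : ℝ) :
    ∃ K, ∀ p ∈ frontier X, ∀ (g g' : Rn n) (A A' : Rn n →L[ℝ] Rn n), ‖g‖ ≤ C → ‖A‖ ≤ C →
      ‖g'‖ ≤ C' → ‖A'‖ ≤ C' → ‖jetBoundaryOperator X p g A g' A'‖ ≤ K := by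
  have : ProperSpace (Rn n →L[ℝ] Rn n) := FiniteDimensional.proper ℝ _
  obtain ⟨K, hK⟩ := (hX.isCompact_frontier.prod
      (((isCompact_closedBall (0 : Rn n) C).prod
        (isCompact_closedBall (0 : Rn n →L[ℝ] Rn n) C)).prod
      ((isCompact_closedBall (0 : Rn n) C').prod
        (isCompact_closedBall (0 : Rn n →L[ℝ] Rn n) C')))).exists_bound_of_continuousOn
        (continuousOn_jetBoundaryOperator hX
          (α := Rn n × (Rn n × (Rn n →L[ℝ] Rn n)) × (Rn n × (Rn n →L[ℝ] Rn n)))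
          (π := fun z => z.1) (g := fun z => z.2.1.1)
          (A := fun z => z.2.1.2) (g' := fun z => z.2.2.1) (A' := fun z => z.2.2.2)
          (by fun_prop) (fun z hz => hz.1) (by fun_prop) (by fun_prop) (by fun_prop)
          (by fun_prop))
  refine ⟨K, fun p hp g g' A A' hg hA hg' hA' => hK (p, (g, A), (g', A')) ⟨hp, ⟨?_, ?_⟩, ?_, ?_⟩⟩
  · exact mem_closedBall_zero_iff.2 hg
  · exact mem_closedBall_zero_iff.2 hA
  · exact mem_closedBall_zero_iff.2 hg'
  · exact mem_closedBall_zero_iff.2 hA'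

lemma tendsto_jetBoundaryOperator (hX : IsBoundedSmoothDomain X) (hp : p ∈ frontier X)
    {g g' : ℕ → Rn n} {A A' : ℕ → Rn n →L[ℝ] Rn n} {g₀ g₀' : Rn n} {A₀ A₀' : Rn n →L[ℝ] Rn n}
    (hg : Tendsto g atTop (𝓝 g₀)) (hA : Tendsto A atTop (𝓝 A₀))
    (hg' : Tendsto g' atTop (𝓝 g₀')) (hA' : Tendsto A' atTop (𝓝 A₀')) :
    Tendsto (fun k => jetBoundaryOperator X p (g k) (A k) (g' k) (A' k)) atTop
      (𝓝 (jetBoundaryOperator X p g₀ A₀ g₀' A₀')) := by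
  have hc : Continuous fun z : (Rn n × (Rn n →L[ℝ] Rn n)) × (Rn n × (Rn n →L[ℝ] Rn n)) =>
      jetBoundaryOperator X p z.1.1 z.1.2 z.2.1 z.2.2 :=
    continuousOn_univ.1 (continuousOn_jetBoundaryOperator hX
      (α := (Rn n × (Rn n →L[ℝ] Rn n)) × (Rn n × (Rn n →L[ℝ] Rn n)))
      (π := fun _ => p) (g := fun z => z.1.1) (A := fun z => z.1.2) (g' := fun z => z.2.1)
      (A' := fun z => z.2.2) continuousOn_const (fun _ _ => hp) (by fun_prop) (by fun_prop)
      (by fun_prop) (by fun_prop))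
  exact (hc.tendsto ((g₀, A₀), (g₀', A₀'))).comp
    ((hg.prodMk_nhds hA).prodMk_nhds (hg'.prodMk_nhds hA'))

/-! ### Integrability and convergence -/

lemma integrable_interior (hX : IsBoundedSmoothDomain X) {u : Rn n → ℝ} (hu : u ∈ C2Closure X)
    (hv : v ∈ C2Closure X) (hw : w ∈ C2Closure X) :
    IntegrableOn (fun x => u x * sigmaTwo v w x) X := by
  refine (hX.integrableOn (f := fun x => u x *
    endSigmaTwo (closureHessian X v x) (closureHessian X w x)) ?_).congr_fun ?_
    hX.isOpen.measurableSet
  · exact (contDiffOn_of_mem hu).continuousOn.mul (continuousOn_endSigmaTwo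
      (continuousOn_closureHessian hX hv) (continuousOn_closureHessian hX hw))
  · exact fun x hx => by simp only [sigmaTwo_eq hX hv hw hx]

lemma integrable_boundary (hX : IsBoundedSmoothDomain X) {u : Rn n → ℝ} (hu : u ∈ C2Closure X)
    (hv : v ∈ C2Closure X) (hw : w ∈ C2Closure X) :
    Integrable (fun p => u p * boundaryOperator X v w p) (surfaceMeasure X) :=
  hX.integrable_surfaceMeasure (((contDiffOn_of_mem hu).continuousOn.mono
    frontier_subset_closure).mul (continuousOn_boundaryOperator hX (C2Closure_le hv)
      (C2Closure_le hw)))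

/-- Bounded pointwise convergence on `closure X` of a sequence in `C²(X̄)`, together with the first
and second derivatives. -/
structure JetTendsto (X : Set (Rn n)) (f : ℕ → Rn n → ℝ) (v : Rn n → ℝ) : Prop where
  mem : ∀ k, f k ∈ C2Closure X
  value : ∀ x ∈ closure X, Tendsto (fun k => f k x) atTop (𝓝 (v x))
  gradient : ∀ x ∈ closure X,
    Tendsto (fun k => closureGradient X (f k) x) atTop (𝓝 (closureGradient X v x))
  hessian : ∀ x ∈ closure X,
    Tendsto (fun k => closureHessian X (f k) x) atTop (𝓝 (closureHessian X v x))
  bounded : ∃ C : ℝ, ∀ k, ∀ x ∈ closure X,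
    ‖f k x‖ ≤ C ∧ ‖closureGradient X (f k) x‖ ≤ C ∧ ‖closureHessian X (f k) x‖ ≤ C

/-- The energy form is continuous with respect to bounded convergence of second order jets. -/
lemma tendsto_energyForm (hX : IsBoundedSmoothDomain X) {u : Rn n → ℝ} {f g h : ℕ → Rn n → ℝ}
    (hv : v ∈ C2Closure X) (hw : w ∈ C2Closure X)
    (hf : JetTendsto X f u) (hg : JetTendsto X g v) (hh : JetTendsto X h w) :
    Tendsto (fun k => energyForm X (f k) (g k) (h k)) atTop (𝓝 (energyForm X u v w)) := by
  obtain ⟨C₁, hC₁⟩ := hf.bounded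
  obtain ⟨C₂, hC₂⟩ := hg.bounded
  obtain ⟨C₃, hC₃⟩ := hh.bounded
  have : ProperSpace (Rn n →L[ℝ] Rn n) := FiniteDimensional.proper ℝ _
  have hfin := hX.isFiniteMeasure_surfaceMeasure
  have hvol : IsFiniteMeasure (volume.restrict X) :=
    ⟨by rw [Measure.restrict_apply_univ]; exact hX.isBounded.measure_lt_top⟩
  refine (Tendsto.neg ?_).add ?_
  · obtain ⟨K, hK⟩ := ((isCompact_closedBall (0 : Rn n →L[ℝ] Rn n) C₂).prod
      (isCompact_closedBall (0 : Rn n →L[ℝ] Rn n) C₃)).exists_bound_of_continuousOn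
        continuous_endSigmaTwo.continuousOn
    refine tendsto_integral_of_dominated_convergence (fun _ => C₁ * K)
      (fun k => (integrable_interior hX (hf.mem k) (hg.mem k) (hh.mem k)).aestronglyMeasurable)
      (integrable_const _) (fun k => ?_) ?_
    · refine (ae_restrict_iff' hX.isOpen.measurableSet).2 (Eventually.of_forall fun x hx => ?_)
      have hx' := subset_closure hx
      rw [norm_mul, sigmaTwo_eq hX (hg.mem k) (hh.mem k) hx]
      refine mul_le_mul (hC₁ k x hx').1 (hK (_, _) ⟨?_, ?_⟩) (norm_nonneg _)
        ((norm_nonneg _).trans (hC₁ k x hx').1)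
      · exact mem_closedBall_zero_iff.2 (hC₂ k x hx').2.2
      · exact mem_closedBall_zero_iff.2 (hC₃ k x hx').2.2
    · refine (ae_restrict_iff' hX.isOpen.measurableSet).2 (Eventually.of_forall fun x hx => ?_)
      have hx' := subset_closure hx
      rw [sigmaTwo_eq hX hv hw hx]
      refine (hf.value x hx').mul ?_
      simp only [sigmaTwo_eq hX (hg.mem _) (hh.mem _) hx]
      exact tendsto_endSigmaTwo (hg.hessian x hx') (hh.hessian x hx')
  · obtain ⟨K, hK⟩ := exists_bound_jetBoundaryOperator hX C₂ C₃
    refine tendsto_integral_of_dominated_convergence (fun _ => C₁ * K)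
      (fun k => (integrable_boundary hX (hf.mem k) (hg.mem k) (hh.mem k)).aestronglyMeasurable)
      (integrable_const _) (fun k => ?_) ?_
    · refine (ae_restrict_iff' isClosed_frontier.measurableSet).2
        (Eventually.of_forall fun x hx => ?_)
      have hx' := frontier_subset_closure hx
      rw [norm_mul, boundaryOperator_eq hX (hg.mem k) (hh.mem k) hx]
      exact mul_le_mul (hC₁ k x hx').1 (hK x hx _ _ _ _ (hC₂ k x hx').2.1 (hC₂ k x hx').2.2
        (hC₃ k x hx').2.1 (hC₃ k x hx').2.2)
        (norm_nonneg _) ((norm_nonneg _).trans (hC₁ k x hx').1)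
    · refine (ae_restrict_iff' isClosed_frontier.measurableSet).2
        (Eventually.of_forall fun x hx => ?_)
      have hx' := frontier_subset_closure hx
      rw [boundaryOperator_eq hX hv hw hx]
      refine (hf.value x hx').mul ?_
      simp only [boundaryOperator_eq hX (hg.mem _) (hh.mem _) hx]
      exact tendsto_jetBoundaryOperator hX hx (hg.gradient x hx') (hg.hessian x hx')
        (hh.gradient x hx') (hh.hessian x hx')

end Jets

/-! ### Density of smooth functions -/

section Mollification

open ContinuousLinearMap
open scoped Convolution

variable {n : ℕ} {F : Type*} [NormedAddCommGroup F] [NormedSpace ℝ F]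

lemma hasFDerivAt_normed_convolution [CompleteSpace F] (φ : ContDiffBump (0 : Rn n)) {g : Rn n → F}
    (hg : ContDiff ℝ 1 g) (hc : HasCompactSupport g) (x : Rn n) :
    HasFDerivAt (φ.normed volume ⋆[lsmul ℝ ℝ, volume] g)
      ((φ.normed volume ⋆[lsmul ℝ ℝ, volume] fderiv ℝ g) x) x := by
  have h := hc.hasFDerivAt_convolution_right (μ := volume) (lsmul ℝ ℝ)
    (φ.continuous_normed (μ := volume)).locallyIntegrable hg x
  exact h

/-- Convolution with bump functions of small support approximates a compactly supported continuous
function uniformly, with a radius that depends on the function only. -/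
lemma exists_forall_dist_normed_convolution_le {g : Rn n → F} [CompleteSpace F]
    (hg : Continuous g) (hc : HasCompactSupport g) {ε : ℝ} (hε : 0 < ε) :
    ∃ δ > 0, ∀ φ : ContDiffBump (0 : Rn n), φ.rOut ≤ δ → ∀ x,
      ‖(φ.normed volume ⋆[lsmul ℝ ℝ, volume] g) x - g x‖ ≤ ε := by
  obtain ⟨δ, hδ, h⟩ := Metric.uniformContinuous_iff.1
    (hc.uniformContinuous_of_continuous hg) ε hε
  refine ⟨δ, hδ, fun φ hφ x => ?_⟩
  rw [← dist_eq_norm]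
  exact φ.dist_normed_convolution_le hg.aestronglyMeasurable
    fun y hy => (h ((Metric.mem_ball.1 hy).trans_le hφ)).le

/-- Compactly supported functions of class `C²` are approximated by smooth functions, uniformly
together with their first and second derivatives. -/
lemma exists_smooth_approx {g : Rn n → ℝ} (hg : ContDiff ℝ 2 g) (hc : HasCompactSupport g)
    {ε : ℝ} (hε : 0 < ε) :
    ∃ (h : Rn n → ℝ) (G : Rn n → Rn n) (A : Rn n → Rn n →L[ℝ] Rn n), ContDiff ℝ ∞ h ∧
      (∀ x, HasFDerivAt h (innerSL ℝ (G x)) x) ∧ (∀ x, HasFDerivAt G (A x) x) ∧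
      ∀ x, ‖h x - g x‖ ≤ ε ∧ ‖G x - riesz n (fderiv ℝ g x)‖ ≤ ε ∧
        ‖A x - fderiv ℝ (fun y => riesz n (fderiv ℝ g y)) x‖ ≤ ε := by
  set γ : Rn n → Rn n := fun y => riesz n (fderiv ℝ g y) with hγ
  have hg' : ContDiff ℝ 1 (fderiv ℝ g) := hg.fderiv_right (by norm_num)
  have hγ1 : ContDiff ℝ 1 γ := (riesz n).contDiff.comp hg'
  have hγc : HasCompactSupport γ := (hc.fderiv ℝ).comp_left (map_zero (riesz n))
  obtain ⟨δ₁, hδ₁, h₁⟩ := exists_forall_dist_normed_convolution_le hg.continuous hc hε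
  obtain ⟨δ₂, hδ₂, h₂⟩ := exists_forall_dist_normed_convolution_le hγ1.continuous hγc hε
  obtain ⟨δ₃, hδ₃, h₃⟩ := exists_forall_dist_normed_convolution_le
    (hγ1.continuous_fderiv (by simp)) (hγc.fderiv ℝ) hε
  set δ := min δ₁ (min δ₂ δ₃)
  have hδ : 0 < δ := lt_min hδ₁ (lt_min hδ₂ hδ₃)
  let φ : ContDiffBump (0 : Rn n) := ⟨δ / 2, δ, by positivity, by linarith⟩
  have hφ : φ.rOut = δ := rfl
  refine ⟨φ.normed volume ⋆[lsmul ℝ ℝ, volume] g, φ.normed volume ⋆[lsmul ℝ ℝ, volume] γ,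
    φ.normed volume ⋆[lsmul ℝ ℝ, volume] fderiv ℝ γ, ?_, ?_, ?_, ?_⟩
  · exact φ.hasCompactSupport_normed.contDiff_convolution_left _ φ.contDiff_normed
      hg.continuous.locallyIntegrable
  · intro x
    have h := hasFDerivAt_normed_convolution φ (hg.of_le (by norm_num)) hc x
    have heq : (φ.normed volume ⋆[lsmul ℝ ℝ, volume] γ) x =
        riesz n ((φ.normed volume ⋆[lsmul ℝ ℝ, volume] fderiv ℝ g) x) := by
      rw [convolution_def, convolution_def]
      have hint : Integrable fun t => lsmul ℝ ℝ (φ.normed volume t) (fderiv ℝ g (x - t)) :=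
        (φ.hasCompactSupport_normed.convolutionExists_left (lsmul ℝ ℝ) φ.continuous_normed
          (hg'.continuous.locallyIntegrable (μ := volume))) x
      have := ((riesz n).toContinuousLinearEquiv : (Rn n →L[ℝ] ℝ) →L[ℝ] Rn n).integral_comp_comm
        hint
      refine Eq.trans ?_ this
      congr 1
      ext1 t
      simp [γ]
    rw [heq, innerSL_riesz]
    exact h
  · exact fun x => hasFDerivAt_normed_convolution φ hγ1 hγc x
  · exact fun x => ⟨h₁ φ (hφ ▸ min_le_left _ _) x,
      h₂ φ (hφ ▸ (min_le_right _ _).trans (min_le_left _ _)) x,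
      h₃ φ (hφ ▸ (min_le_right _ _).trans (min_le_right _ _)) x⟩

/-- A cutoff turns a `C²` function near a compact set into one defined everywhere. -/
lemma exists_contDiff_eventuallyEq {K U : Set (Rn n)} (hK : IsCompact K) (hU : IsOpen U)
    (hKU : K ⊆ U) {f : Rn n → ℝ} (hf : ContDiffOn ℝ 2 f U) :
    ∃ g : Rn n → ℝ, ContDiff ℝ 2 g ∧ HasCompactSupport g ∧ ∀ x ∈ K, g =ᶠ[𝓝 x] f := by
  obtain ⟨L, hL, hKL, hLU⟩ := exists_compact_between hK hU hKU
  obtain ⟨χ, hχ1, hχ0, -⟩ := exists_contMDiffMap_one_nhds_of_subset_interior (n := ⊤)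
    (modelWithCornersSelf ℝ (Rn n)) hK.isClosed hKL
  have hχs : ContDiff ℝ 2 χ :=
    (contMDiff_iff_contDiff.1 χ.contMDiff).of_le (WithTop.coe_le_coe.2 (le_top : (2 : ℕ∞) ≤ ⊤))
  have hsupp : tsupport χ ⊆ L :=
    closure_minimal (fun x hx => by by_contra hxL; exact hx (hχ0 x hxL)) hL.isClosed
  refine ⟨fun x => χ x * f x, ?_, ?_, ?_⟩
  · rw [contDiff_iff_contDiffAt]
    intro x
    by_cases hx : x ∈ tsupport χ
    · exact hχs.contDiffAt.mul (hf.contDiffAt (hU.mem_nhds (hLU (hsupp hx))))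
    · have : (fun x => χ x * f x) =ᶠ[𝓝 x] fun _ => 0 := by
        filter_upwards [(isClosed_tsupport χ).isOpen_compl.mem_nhds hx] with y hy
        rw [image_eq_zero_of_notMem_tsupport hy, zero_mul]
      exact contDiffAt_const.congr_of_eventuallyEq this
  · exact HasCompactSupport.mul_right (f := χ) (hL.of_isClosed_subset (isClosed_tsupport _) hsupp)
  · intro x hx
    filter_upwards [(eventually_nhdsSet_iff_forall.1 hχ1) x hx] with y hy
    rw [hy, one_mul]

end Mollification

section Shrinking

variable {n : ℕ} {X : Set (Rn n)} {v : Rn n → ℝ} {N : Rn n → Rn n}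

/-- Moving along an extension of the outward normal in the negative direction pushes the closed
domain into the open one. -/
lemma IsBoundedSmoothDomain.eventually_sub_smul_mem (hX : IsBoundedSmoothDomain X)
    (hN : Continuous N) (hNX : ∀ p ∈ frontier X, N p = outwardNormal X p) :
    ∀ᶠ t : ℝ in 𝓝[>] 0, ∀ x ∈ closure X, x - t • N x ∈ X := by
  have key : ∀ᶠ t : ℝ in 𝓝 0, ∀ x ∈ closure X, 0 < t → x ∈ closure X → x - t • N x ∈ X := by
    refine hX.isCompact_closure.eventually_forall_of_forall_eventually fun y hy => ?_
    have hφ : Continuous fun z : ℝ × Rn n => z.2 - z.1 • N z.2 := by fun_prop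
    have hφ0 := hφ.tendsto (0, y)
    simp only [zero_smul, sub_zero] at hφ0
    by_cases hyX : y ∈ X
    · filter_upwards [hφ0.eventually (hX.isOpen.mem_nhds hyX)] with z hz _ _ using hz
    have hyf : y ∈ frontier X := by rw [hX.isOpen.frontier_eq]; exact ⟨hy, hyX⟩
    obtain ⟨ρ, h⟩ := hX.smooth_boundary y hyf
    have hpos := norm_pos_iff.2 h.gradient_ne_zero
    have hsnd : Tendsto (fun z : ℝ × Rn n => z.2) (𝓝 (0, y)) (𝓝 y) := continuous_snd.tendsto _
    have e1 := (hφ0.prodMk_nhds hsnd).eventually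
      ((h.smooth.hasStrictFDerivAt (x := y) (by simp)).isLittleO.def
        (c := ‖gradient ρ y‖ / 8) (by positivity))
    have hν := hX.norm_outwardNormal hyf
    have e2 : ∀ᶠ x in 𝓝 y, ‖gradient ρ y‖ / 2 < fderiv ℝ ρ y (N x) := by
      refine ((fderiv ℝ ρ y).continuous.comp hN).continuousAt.eventually_const_lt ?_
      simp only [Function.comp_apply]
      rw [hX.fderiv_eq hyf h, hNX y hyf, real_inner_self_eq_norm_sq, hν]
      linarith
    have e3 : ∀ᶠ x in 𝓝 y, ‖N x‖ < 2 :=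
      hN.norm.continuousAt.eventually_lt_const (by simp only [hNX y hyf, hν]; norm_num)
    filter_upwards [e1, hsnd.eventually e2, hsnd.eventually e3, hsnd.eventually h.eventually,
      hφ0.eventually h.eventually] with z h1 h2 h3 h4 h5 hz0 hzX
    rw [h5.eventually_mem_iff.self_of_nhds]
    have h6 := h4.mem_closure_iff.1 hzX
    have h7 : z.2 - z.1 • N z.2 - z.2 = -(z.1 • N z.2) := by abel
    rw [h7, norm_neg, norm_smul, Real.norm_eq_abs, Real.norm_eq_abs, abs_of_pos hz0, map_neg,
      map_smul, smul_eq_mul] at h1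
    have h8 := (abs_le.1 h1).2
    nlinarith [mul_pos hz0 hpos, mul_lt_mul_of_pos_left h2 hz0, mul_lt_mul_of_pos_left h3 hz0]
  filter_upwards [nhdsWithin_le_nhds key, self_mem_nhdsWithin] with t ht ht0 x hx
  exact ht x hx ht0 hx

/-- If `F` is continuous on `[0, τ] × K`, then functions that approximate `F (τ / (k + 1), ·)` to
within `1 / (k + 1)` converge boundedly to `F (0, ·)` on `K`. -/
lemma tendsto_of_continuousOn_of_norm_sub_le {E : Type*} [NormedAddCommGroup E] {K : Set (Rn n)}
    (hK : IsCompact K) {τ : ℝ} (hτ : 0 < τ) {F : ℝ × Rn n → E}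
    (hF : ContinuousOn F (Icc 0 τ ×ˢ K)) {a : ℕ → Rn n → E}
    (ha : ∀ k, ∀ x ∈ K, ‖a k x - F (τ / (k + 1), x)‖ ≤ 1 / ((k : ℝ) + 1)) :
    (∀ x ∈ K, Tendsto (fun k => a k x) atTop (𝓝 (F (0, x)))) ∧
      ∃ C, ∀ k, ∀ x ∈ K, ‖a k x‖ ≤ C := by
  have hmem : ∀ k : ℕ, τ / (k + 1) ∈ Icc 0 τ := fun k =>
    ⟨by positivity, div_le_self hτ.le (by simp)⟩
  constructor
  · intro x hx
    have h1 : Tendsto (fun k : ℕ => F (τ / (k + 1), x)) atTop (𝓝 (F (0, x))) := by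
      have h2 : Tendsto (fun k : ℕ => (τ / ((k : ℝ) + 1), x)) atTop
          (𝓝[Icc 0 τ ×ˢ K] (0, x)) := by
        refine tendsto_nhdsWithin_iff.2 ⟨?_, Eventually.of_forall fun k => ⟨hmem k, hx⟩⟩
        have h3 := tendsto_one_div_add_atTop_nhds_zero_nat (𝕜 := ℝ) |>.const_mul τ
        simp only [mul_one_div, mul_zero] at h3
        exact h3.prodMk_nhds tendsto_const_nhds
      exact (hF (0, x) ⟨⟨le_rfl, hτ.le⟩, hx⟩).tendsto.comp h2
    have h4 : Tendsto (fun k => a k x - F (τ / (k + 1), x)) atTop (𝓝 0) :=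
      squeeze_zero_norm (fun k => ha k x hx) tendsto_one_div_add_atTop_nhds_zero_nat
    simpa using h4.add h1
  · obtain ⟨C, hC⟩ := (isCompact_Icc.prod hK).exists_bound_of_continuousOn hF
    refine ⟨1 + C, fun k x hx => ?_⟩
    calc ‖a k x‖ = ‖(a k x - F (τ / (k + 1), x)) + F (τ / (k + 1), x)‖ := by rw [sub_add_cancel]
      _ ≤ 1 / ((k : ℝ) + 1) + C :=
        (norm_add_le _ _).trans (add_le_add (ha k x hx) (hC _ ⟨hmem k, hx⟩))
      _ ≤ _ := by
        gcongr
        rw [div_le_one (by positivity)]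
        simp

/-- Smooth functions are dense in `C²(X̄)`: `v (x - t N x)`, where `N` extends the normal, is of
class `C²` in a neighbourhood of `closure X` and can be mollified. -/
theorem IsBoundedSmoothDomain.exists_smooth_jetTendsto (hX : IsBoundedSmoothDomain X)
    (hv : v ∈ C2Closure X) :
    ∃ f : ℕ → Rn n → ℝ, (∀ k, ContDiff ℝ ∞ (f k)) ∧ JetTendsto X f v := by
  obtain ⟨N, hN, hNX⟩ := hX.exists_smooth_normal_extension
  obtain ⟨t₁, ht₁, hmap⟩ : ∃ t₁ > 0, ∀ t ∈ Ioc (0 : ℝ) t₁, ∀ x ∈ closure X, x - t • N x ∈ X :=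
    (mem_nhdsGT_iff_exists_Ioc_subset).1 (hX.eventually_sub_smul_mem hN.continuous hNX)
  set φ : ℝ × Rn n → Rn n := fun z => z.2 - z.1 • N z.2 with hφ
  set K : Set (ℝ × Rn n) := Icc 0 t₁ ×ˢ closure X with hK
  have hφc : Continuous φ := by
    have := hN.continuous
    fun_prop
  have hφK : MapsTo φ K (closure X) := by
    rintro ⟨t, x⟩ ⟨⟨h0, h1⟩, hx⟩
    rcases h0.eq_or_lt with h | h
    · subst h
      simpa [hφ] using hx
    · exact subset_closure (hmap t ⟨h, h1⟩ x hx)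
  -- the first and second derivatives of `x ↦ v (x - t N x)`
  set T : Rn n → Rn n →L[ℝ] Rn n := fun x => ContinuousLinearMap.adjoint (fderiv ℝ N x) with hT
  have hTs : ContDiff ℝ ∞ T := (ContinuousLinearMap.adjoint (𝕜 := ℝ) (E := Rn n)
    (F := Rn n)).contDiff.comp (hN.fderiv_right (by simp))
  set B : ℝ × Rn n → Rn n →L[ℝ] Rn n :=
    fun z => ContinuousLinearMap.id ℝ (Rn n) - z.1 • fderiv ℝ N z.2 with hB
  have hφd : ∀ z : ℝ × Rn n, HasFDerivAt (fun x => φ (z.1, x)) (B z) z.2 := fun z =>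
    (hasFDerivAt_id z.2).sub ((hN.differentiable (by simp) z.2).hasFDerivAt.const_smul z.1)
  set V : ℝ × Rn n → ℝ := fun z => v (φ z) with hV
  set G : ℝ × Rn n → Rn n := fun z =>
    closureGradient X v (φ z) - z.1 • T z.2 (closureGradient X v (φ z)) with hG
  set A : ℝ × Rn n → Rn n →L[ℝ] Rn n := fun z =>
    (closureHessian X v (φ z)).comp (B z) -
      z.1 • ((T z.2).comp ((closureHessian X v (φ z)).comp (B z)) +
        (fderiv ℝ T z.2).flip (closureGradient X v (φ z))) with hA
  have hXn : ∀ {y}, y ∈ X → closure X ∈ 𝓝 y := fun hy =>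
    mem_of_superset (hX.isOpen.mem_nhds hy) subset_closure
  have hVd : ∀ z : ℝ × Rn n, φ z ∈ X →
      HasFDerivAt (fun x => V (z.1, x)) (innerSL ℝ (G z)) z.2 := by
    intro z hz
    have h1 := ((hasFDerivWithinAt_of_mem hv (subset_closure hz)).hasFDerivAt (hXn hz)).comp z.2
      (hφd z)
    have heq : innerSL ℝ (G z) = (innerSL ℝ (closureGradient X v (φ z))).comp (B z) := by
      ext a
      simp [hG, hB, hT, ContinuousLinearMap.adjoint_inner_left]
    rw [heq]
    exact h1
  have hGd : ∀ z : ℝ × Rn n, φ z ∈ X → HasFDerivAt (fun x => G (z.1, x)) (A z) z.2 := by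
    intro z hz
    have h1 := ((hasFDerivWithinAt_closureGradient hX hv (subset_closure hz)).hasFDerivAt
      (hXn hz)).comp z.2 (hφd z)
    have h2 := (hTs.differentiable (by simp) z.2).hasFDerivAt.clm_apply h1
    exact h1.sub (h2.const_smul z.1)
  have hcφ : ContinuousOn φ K := hφc.continuousOn
  have hcV : ContinuousOn V K := (contDiffOn_of_mem hv).continuousOn.comp hcφ hφK
  have hcg : ContinuousOn (fun z => closureGradient X v (φ z)) K :=
    (contDiffOn_closureGradient hX hv).continuousOn.comp hcφ hφK
  have hch : ContinuousOn (fun z => closureHessian X v (φ z)) K :=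
    (continuousOn_closureHessian hX hv).comp hcφ hφK
  have hcT : ContinuousOn (fun z : ℝ × Rn n => T z.2) K :=
    (hTs.continuous.comp continuous_snd).continuousOn
  have hcT' : ContinuousOn (fun z : ℝ × Rn n => (fderiv ℝ T z.2).flip) K :=
    ((ContinuousLinearMap.flipₗᵢ ℝ (Rn n) (Rn n) (Rn n)).continuous.comp
      ((hTs.continuous_fderiv (by simp)).comp continuous_snd)).continuousOn
  have hcB : ContinuousOn B K := by
    have := hN.continuous_fderiv (by simp)
    exact (by fun_prop : Continuous B).continuousOn
  have hcG : ContinuousOn G K := hcg.sub (continuous_fst.continuousOn.smul (hcT.clm_apply hcg))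
  have hcA : ContinuousOn A K := (hch.clm_comp hcB).sub (continuous_fst.continuousOn.smul
    ((hcT.clm_comp (hch.clm_comp hcB)).add (hcT'.clm_apply hcg)))
  -- the approximating sequence
  have hex : ∀ k : ℕ, ∃ (h : Rn n → ℝ) (g : Rn n → Rn n) (H : Rn n → Rn n →L[ℝ] Rn n),
      ContDiff ℝ ∞ h ∧ (∀ x, HasFDerivAt h (innerSL ℝ (g x)) x) ∧ (∀ x, HasFDerivAt g (H x) x) ∧
      ∀ x ∈ closure X, ‖h x - V (t₁ / (k + 1), x)‖ ≤ 1 / ((k : ℝ) + 1) ∧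
        ‖g x - G (t₁ / (k + 1), x)‖ ≤ 1 / ((k : ℝ) + 1) ∧
        ‖H x - A (t₁ / (k + 1), x)‖ ≤ 1 / ((k : ℝ) + 1) := by
    intro k
    set t : ℝ := t₁ / (k + 1) with ht
    have htmem : t ∈ Ioc 0 t₁ := ⟨by positivity, div_le_self ht₁.le (by simp)⟩
    set U : Set (Rn n) := (fun x => φ (t, x)) ⁻¹' X with hU
    have hN2 : ContDiff ℝ 2 N := hN.of_le (WithTop.coe_le_coe.2 (le_top : (2 : ℕ∞) ≤ ⊤))
    have hφt : ContDiff ℝ 2 fun x => φ (t, x) := contDiff_id.sub (hN2.const_smul t)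
    have hUo : IsOpen U := hX.isOpen.preimage hφt.continuous
    have hXU : closure X ⊆ U := fun x hx => hmap t htmem x hx
    have hVU : ContDiffOn ℝ 2 (fun x => V (t, x)) U :=
      (contDiffOn_of_mem hv).comp hφt.contDiffOn fun x hx => subset_closure hx
    obtain ⟨w, hw, hwc, hwV⟩ := exists_contDiff_eventuallyEq hX.isCompact_closure hUo hXU hVU
    obtain ⟨h, g, H, hh, hg, hH, hest⟩ := exists_smooth_approx hw hwc
      (show 0 < 1 / ((k : ℝ) + 1) by positivity)
    refine ⟨h, g, H, hh, hg, hH, fun x hx => ?_⟩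
    obtain ⟨e1, e2, e3⟩ := hest x
    have d1 : (fun y => riesz n (fderiv ℝ w y)) =ᶠ[𝓝 x] fun y => G (t, y) := by
      filter_upwards [(hwV x hx).eventuallyEq_nhds, hUo.mem_nhds (hXU hx)] with y hy hyU
      rw [hy.fderiv_eq, (hVd (t, y) hyU).fderiv]
      exact riesz_eq_iff.2 rfl
    rw [(hwV x hx).eq_of_nhds] at e1
    rw [d1.eq_of_nhds] at e2
    rw [d1.fderiv_eq, (hGd (t, x) (hXU hx)).fderiv] at e3
    exact ⟨e1, e2, e3⟩
  choose h g H hh hg hH hest using hex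
  have hgw : ∀ k x, x ∈ closure X → closureGradient X (h k) x = g k x := fun k x hx =>
    closureGradient_eq hX hx (hg k x).hasFDerivWithinAt
  have hHw : ∀ k x, x ∈ closure X → closureHessian X (h k) x = H k x := fun k x hx =>
    closureHessian_eq hX hx (fun y _ => (hg k y).hasFDerivWithinAt) (hH k x).hasFDerivWithinAt
  obtain ⟨l1, C₁, b1⟩ := tendsto_of_continuousOn_of_norm_sub_le hX.isCompact_closure ht₁ hcV
    fun k x hx => (hest k x hx).1
  obtain ⟨l2, C₂, b2⟩ := tendsto_of_continuousOn_of_norm_sub_le hX.isCompact_closure ht₁ hcG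
    fun k x hx => (hest k x hx).2.1
  obtain ⟨l3, C₃, b3⟩ := tendsto_of_continuousOn_of_norm_sub_le hX.isCompact_closure ht₁ hcA
    fun k x hx => (hest k x hx).2.2
  refine ⟨h, hh, ⟨fun k => ?_, fun x hx => ?_, fun x hx => ?_, fun x hx => ?_,
    max C₁ (max C₂ C₃), fun k x hx => ⟨?_, ?_, ?_⟩⟩⟩
  · exact ((hh k).of_le (WithTop.coe_le_coe.2 (le_top : (2 : ℕ∞) ≤ ⊤))).contDiffOn
  · simpa [hV, hφ] using l1 x hx
  · simp only [hgw _ x hx]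
    simpa [hG, hφ] using l2 x hx
  · simp only [hHw _ x hx]
    have hA0 : A (0, x) = closureHessian X v x := by
      ext a
      simp [hA, hφ, hB]
    exact hA0 ▸ l3 x hx
  · exact (b1 k x hx).trans (le_max_left _ _)
  · rw [hgw k x hx]
    exact (b2 k x hx).trans ((le_max_left _ _).trans (le_max_right _ _))
  · rw [hHw k x hx]
    exact (b3 k x hx).trans ((le_max_right _ _).trans (le_max_right _ _))

end Shrinking

/-! ### Integration by parts against cofactor fields -/

section CofactorField

variable {n : ℕ} {X : Set (Rn n)} {Y Z S : Rn n → Rn n}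

lemma IsBoundedSmoothDomain.integral_divergence (hX : IsBoundedSmoothDomain X)
    (hY : ContDiff ℝ 1 Y) :
    ∫ x in X, traceFunctional n (fderiv ℝ Y x) =
      ∫ x, ⟪outwardNormal X x, Y x⟫_ℝ ∂(surfaceMeasure X) := by
  set e : Fin n → Rn n := fun i => EuclideanSpace.single i 1
  have hYi : ∀ i, ContDiff ℝ 1 fun x => ⟪e i, Y x⟫_ℝ := fun i => contDiff_const.inner ℝ hY
  have hd : ∀ i x, fderiv ℝ (fun x => ⟪e i, Y x⟫_ℝ) x (e i) = ⟪e i, fderiv ℝ Y x (e i)⟫_ℝ := by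
    intro i x
    have h := (innerSL ℝ (e i)).hasFDerivAt.comp x (hY.differentiable (by simp) x).hasFDerivAt
    have h' : HasFDerivAt (fun x => ⟪e i, Y x⟫_ℝ) ((innerSL ℝ (e i)).comp (fderiv ℝ Y x)) x := h
    rw [h'.fderiv]
    simp
  have hν : ContinuousOn (outwardNormal X) (frontier X) :=
    (contDiffOn_outwardNormal hX).continuousOn
  have h1 : ∀ x, traceFunctional n (fderiv ℝ Y x) =
      ∑ i, fderiv ℝ (fun x => ⟪e i, Y x⟫_ℝ) x (e i) := fun x => by
    rw [traceFunctional_eq_sum]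
    simp only [hd, e]
  have h2 : ∀ x, ⟪outwardNormal X x, Y x⟫_ℝ =
      ∑ i, ⟪e i, Y x⟫_ℝ * ⟪outwardNormal X x, e i⟫_ℝ := fun x => by
    simp [e, PiLp.inner_apply]
  simp only [h1, h2]
  rw [integral_finsetSum, integral_finsetSum]
  · exact Finset.sum_congr rfl fun i _ => hX.integral_fderiv (e i) (hYi i)
  · exact fun i _ => hX.integrable_surfaceMeasure
      ((hYi i).continuous.continuousOn.mul (hν.inner continuousOn_const))
  · exact fun i _ => hX.integrableOn
      (((hYi i).continuous_fderiv (by simp)).clm_apply continuous_const).continuousOn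

/-- The vector field `(tr DZ) S - DZ S`, that is, the cofactor operator of `DZ` applied to `S`
at the level of `σ₂`. -/
noncomputable def cofactorField (Z S : Rn n → Rn n) (x : Rn n) : Rn n :=
  traceFunctional n (fderiv ℝ Z x) • S x - fderiv ℝ Z x (S x)

lemma contDiff_cofactorField (hZ : ContDiff ℝ ∞ Z) (hS : ContDiff ℝ ∞ S) :
    ContDiff ℝ ∞ (cofactorField Z S) := by
  have hZ' : ContDiff ℝ ∞ (fderiv ℝ Z) := hZ.fderiv_right (by simp)
  exact (((traceFunctional n).contDiff.comp hZ').smul hS).sub (hZ'.clm_apply hS)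

/-- The divergence of a cofactor field contains no second derivatives of `Z`: the two terms
`D_S (tr DZ)` and `tr (a ↦ D²Z(a, S))` cancel because `D²Z` is symmetric. -/
lemma trace_fderiv_cofactorField (hZ : ContDiff ℝ ∞ Z) (hS : ContDiff ℝ ∞ S) (x : Rn n) :
    traceFunctional n (fderiv ℝ (cofactorField Z S) x) =
      traceFunctional n (fderiv ℝ Z x) * traceFunctional n (fderiv ℝ S x) -
        traceFunctional n ((fderiv ℝ Z x).comp (fderiv ℝ S x)) := by
  have hZ' : HasFDerivAt (fderiv ℝ Z) (fderiv ℝ (fderiv ℝ Z) x) x :=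
    ((hZ.fderiv_right (m := ∞) (by simp)).differentiable (by simp) x).hasFDerivAt
  have hS' : HasFDerivAt S (fderiv ℝ S x) x := (hS.differentiable (by simp) x).hasFDerivAt
  have hsymm : (fderiv ℝ (fderiv ℝ Z) x).flip (S x) = fderiv ℝ (fderiv ℝ Z) x (S x) := by
    ext1 a
    exact (hZ.contDiffAt.isSymmSndFDerivAt
      (by simpa using WithTop.coe_le_coe.2 (le_top : (2 : ℕ∞) ≤ ⊤))) a (S x)
  have h1 : HasFDerivAt (cofactorField Z S) _ x :=
    (((traceFunctional n).hasFDerivAt.comp x hZ').smul hS').sub (hZ'.clm_apply hS')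
  rw [h1.fderiv, hsymm]
  simp only [map_sub, map_add, map_smul, smul_eq_mul, traceFunctional_smulRight,
    Function.comp_apply, ContinuousLinearMap.comp_apply]
  ring

lemma IsBoundedSmoothDomain.integral_cofactorField (hX : IsBoundedSmoothDomain X)
    (hZ : ContDiff ℝ ∞ Z) (hS : ContDiff ℝ ∞ S) :
    ∫ x in X, (traceFunctional n (fderiv ℝ Z x) * traceFunctional n (fderiv ℝ S x) -
        traceFunctional n ((fderiv ℝ Z x).comp (fderiv ℝ S x))) =
      ∫ x, ⟪outwardNormal X x, cofactorField Z S x⟫_ℝ ∂(surfaceMeasure X) := by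
  rw [← hX.integral_divergence ((contDiff_cofactorField hZ hS).of_le (by simp))]
  simp only [trace_fderiv_cofactorField hZ hS]

/-- For `Z` an extension of the unit normal this is an integration by parts on the boundary. -/
lemma IsBoundedSmoothDomain.integral_cofactorField_comm (hX : IsBoundedSmoothDomain X)
    (hZ : ContDiff ℝ ∞ Z) (hS : ContDiff ℝ ∞ S) :
    ∫ x, ⟪outwardNormal X x, cofactorField Z S x⟫_ℝ ∂(surfaceMeasure X) =
      ∫ x, ⟪outwardNormal X x, cofactorField S Z x⟫_ℝ ∂(surfaceMeasure X) := by
  rw [← hX.integral_cofactorField hZ hS, ← hX.integral_cofactorField hS hZ]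
  refine integral_congr_ae (Eventually.of_forall fun x => ?_)
  simp only [traceFunctional_comp_comm (fderiv ℝ Z x), mul_comm (traceFunctional n (fderiv ℝ Z x))]

lemma IsBoundedSmoothDomain.integrable_inner_outwardNormal (hX : IsBoundedSmoothDomain X)
    (hY : Continuous Y) :
    Integrable (fun x => ⟪outwardNormal X x, Y x⟫_ℝ) (surfaceMeasure X) :=
  hX.integrable_surfaceMeasure
    ((contDiffOn_outwardNormal hX).continuousOn.inner hY.continuousOn)

end CofactorField

/-! ### The symmetric expression for smooth functions -/

section Smooth

variable {n : ℕ} {X : Set (Rn n)} {u v w : Rn n → ℝ}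

lemma mem_C2Closure_of_contDiff (hv : ContDiff ℝ ∞ v) : v ∈ C2Closure X :=
  (hv.of_le (WithTop.coe_le_coe.2 (le_top : (2 : ℕ∞) ≤ ⊤))).contDiffOn

lemma hasFDerivAt_innerSL_gradient (hv : ContDiff ℝ ∞ v) (x : Rn n) :
    HasFDerivAt v (innerSL ℝ (gradient v x)) x := by
  have h : innerSL ℝ (gradient v x) = fderiv ℝ v x := by
    ext a
    exact inner_gradient v x a
  rw [h]
  exact (hv.differentiable (by simp) x).hasFDerivAt

lemma hasFDerivAt_gradient (hv : ContDiff ℝ ∞ v) (x : Rn n) :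
    HasFDerivAt (gradient v) (fderiv ℝ (gradient v) x) x :=
  ((contDiff_gradient hv).differentiable (by simp) x).hasFDerivAt

lemma closureGradient_eq_gradient (hX : IsBoundedSmoothDomain X) (hv : ContDiff ℝ ∞ v) {x : Rn n}
    (hx : x ∈ closure X) : closureGradient X v x = gradient v x :=
  closureGradient_eq hX hx (hasFDerivAt_innerSL_gradient hv x).hasFDerivWithinAt

lemma closureHessian_eq_fderiv_gradient (hX : IsBoundedSmoothDomain X) (hv : ContDiff ℝ ∞ v)
    {x : Rn n} (hx : x ∈ closure X) : closureHessian X v x = fderiv ℝ (gradient v) x :=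
  closureHessian_eq hX hx (fun y _ => (hasFDerivAt_innerSL_gradient hv y).hasFDerivWithinAt)
    (hasFDerivAt_gradient hv x).hasFDerivWithinAt

lemma inner_fderiv_gradient_comm (hv : ContDiff ℝ ∞ v) (x a b : Rn n) :
    ⟪fderiv ℝ (gradient v) x a, b⟫_ℝ = ⟪a, fderiv ℝ (gradient v) x b⟫_ℝ := by
  have key : ∀ a b, fderiv ℝ (fderiv ℝ v) x a b = ⟪fderiv ℝ (gradient v) x a, b⟫_ℝ := by
    intro a b
    have h : fderiv ℝ v = fun y => innerSL ℝ (gradient v y) :=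
      funext fun y => (hasFDerivAt_innerSL_gradient hv y).fderiv
    have h' := ((innerSL ℝ).hasFDerivAt.comp x (hasFDerivAt_gradient hv x)).fderiv
    have h2 : fderiv ℝ (fderiv ℝ v) x = (innerSL ℝ).comp (fderiv ℝ (gradient v) x) := by
      rw [h]; exact h'
    rw [h2]
    rfl
  rw [← key, real_inner_comm, ← key]
  exact (hv.contDiffAt.isSymmSndFDerivAt
    (by simpa using WithTop.coe_le_coe.2 (le_top : (2 : ℕ∞) ≤ ⊤))) a b

lemma endSigmaTwo_eq_trace (A B : Rn n →L[ℝ] Rn n) :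
    endSigmaTwo A B =
      (1 / 2) * (traceFunctional n A * traceFunctional n B - traceFunctional n (A.comp B)) := by
  have hcomp : traceFunctional n (A.comp B) = ∑ i, ∑ j,
      A (EuclideanSpace.single i 1) j * B (EuclideanSpace.single j 1) i := by
    have h : ∀ x : Rn n, A x = ∑ i, x i • A (EuclideanSpace.single i 1) := by
      intro x
      conv_lhs => rw [← (EuclideanSpace.basisFun (Fin n) ℝ).sum_repr x]
      simp
    rw [Finset.sum_comm, traceFunctional_eq_sum]
    refine Finset.sum_congr rfl fun j _ => ?_
    rw [ContinuousLinearMap.comp_apply, h (B _), EuclideanSpace.inner_single_left]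
    simp [mul_comm]
  rw [endSigmaTwo, hcomp, traceFunctional_eq_sum, traceFunctional_eq_sum, Finset.sum_mul_sum]
  simp [Finset.sum_sub_distrib, EuclideanSpace.inner_single_left]

lemma endSigmaTwo_comm (A B : Rn n →L[ℝ] Rn n) : endSigmaTwo A B = endSigmaTwo B A := by
  rw [endSigmaTwo_eq_trace, endSigmaTwo_eq_trace, traceFunctional_comp_comm, mul_comm
    (traceFunctional n A)]

/-- The pointwise identity on the boundary. The cofactor flux of `∇v` in the direction `u ∇w`,
the boundary operator, and the two cofactor fluxes built from the normal `N` and from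
`T = u v_n ∇w` combine to an expression that is symmetric in `u` and `w`. Here `c` is the value of
`u`, the vectors `U`, `V`, `W` are the gradients, `A` and `B` are the Hessians of `v` and `w`, and
`D` and `T'` are the derivatives of `N` and `T`. -/
lemma boundary_integrand_eq (hX : IsBoundedSmoothDomain X) {p : Rn n} (hp : p ∈ frontier X)
    {D T' A B : Rn n →L[ℝ] Rn n} {U V W : Rn n} {c : ℝ}
    (hD : tangentialDeriv X (outwardNormal X) p = D.comp (projAlong (outwardNormal X p)))
    (hT : T' = (⟪V, outwardNormal X p⟫_ℝ * c) • B +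
      ((⟪V, outwardNormal X p⟫_ℝ • innerSL ℝ U) + c • ((innerSL ℝ (outwardNormal X p)).comp A +
        (innerSL ℝ V).comp D)).smulRight W) :
    -(1 / 2) * ⟪outwardNormal X p, c • (traceFunctional n A • W - A W)⟫_ℝ
      + c * jetBoundaryOperator X p V A W B
      + (1 / 2) * (⟪outwardNormal X p, traceFunctional n D •
            ((⟪V, outwardNormal X p⟫_ℝ * c) • W) - D ((⟪V, outwardNormal X p⟫_ℝ * c) • W)⟫_ℝ
        - ⟪outwardNormal X p, traceFunctional n T' • outwardNormal X p -
            T' (outwardNormal X p)⟫_ℝ) =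
      -(1 / 2) * (⟪V, outwardNormal X p⟫_ℝ *
        (⟪U, W⟫_ℝ - ⟪U, outwardNormal X p⟫_ℝ * ⟪W, outwardNormal X p⟫_ℝ)) := by
  have hν := hX.norm_outwardNormal hp
  have h1 := inner_tangentialDeriv_normal_self hX hp W
  have h2 := inner_tangentialDeriv_normal_symm hX hp V W
  have hH : meanCurvature X p =
      traceFunctional n D - ⟪outwardNormal X p, D (outwardNormal X p)⟫_ℝ := by
    rw [meanCurvature, tangentialDiv_eq, hD, traceFunctional_comp_projAlong]
  have hself : ⟪outwardNormal X p, outwardNormal X p⟫_ℝ = 1 := by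
    rw [real_inner_self_eq_norm_sq, hν, one_pow]
  have hproj : projAlong (outwardNormal X p) (projAlong (outwardNormal X p) V) =
      projAlong (outwardNormal X p) V := by
    rw [projAlong_apply, inner_projAlong_self hν, zero_smul, sub_zero]
  rw [hD] at h1 h2
  rw [ContinuousLinearMap.comp_apply] at h1 h2
  rw [hT, jetBoundaryOperator, hH, hD, ContinuousLinearMap.comp_apply, hproj, h2,
    traceFunctional_comp_projAlong, traceFunctional_comp_projAlong]
  clear h2 hproj hH hD hT
  generalize outwardNormal X p = N at *
  simp only [ContinuousLinearMap.comp_apply, projAlong_apply, map_sub, map_smul, inner_sub_left,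
    inner_sub_right, inner_smul_left, inner_smul_right, conj_trivial, smul_eq_mul, map_add,
    add_apply, smul_apply, traceFunctional_smulRight, ContinuousLinearMap.smulRight_apply,
    innerSL_apply_apply, inner_add_right, hself] at h1 ⊢
  rw [real_inner_comm (D W) N, real_inner_comm (D N) N, real_inner_comm W N,
    real_inner_comm V N, real_inner_comm (D W) V, real_inner_comm (D N) V] at *
  linear_combination (-c * ⟪V, N⟫_ℝ) * h1

/-- For smooth functions the energy form is an expression in which only `v` is differentiated
twice, and which is visibly symmetric in `u` and `w`. -/
lemma energyForm_eq_of_contDiff (hX : IsBoundedSmoothDomain X) (hu : ContDiff ℝ ∞ u)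
    (hv : ContDiff ℝ ∞ v) (hw : ContDiff ℝ ∞ w) :
    energyForm X u v w =
      (1 / 2) * (∫ x in X, (traceFunctional n (fderiv ℝ (gradient v) x) *
          ⟪gradient u x, gradient w x⟫_ℝ -
        ⟪gradient u x, fderiv ℝ (gradient v) x (gradient w x)⟫_ℝ)) -
      (1 / 2) * ∫ p, ⟪gradient v p, outwardNormal X p⟫_ℝ * (⟪gradient u p, gradient w p⟫_ℝ -
        ⟪gradient u p, outwardNormal X p⟫_ℝ * ⟪gradient w p, outwardNormal X p⟫_ℝ)
          ∂(surfaceMeasure X) := by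
  obtain ⟨N, hN, hNX⟩ := hX.exists_smooth_normal_extension
  have hgu := contDiff_gradient hu
  have hgv := contDiff_gradient hv
  have hgw := contDiff_gradient hw
  have mu : u ∈ C2Closure X := mem_C2Closure_of_contDiff hu
  have mv : v ∈ C2Closure X := mem_C2Closure_of_contDiff hv
  have mw : w ∈ C2Closure X := mem_C2Closure_of_contDiff hw
  set S : Rn n → Rn n := fun x => u x • gradient w x with hS
  set T : Rn n → Rn n := fun x => (⟪gradient v x, N x⟫_ℝ * u x) • gradient w x with hT
  have hSs : ContDiff ℝ ∞ S := hu.smul hgw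
  have hTs : ContDiff ℝ ∞ T := ((hgv.inner ℝ hN).mul hu).smul hgw
  -- the interior integral, after integration by parts
  have hinterior : ∫ x in X, u x * sigmaTwo v w x =
      (1 / 2) * ∫ x, ⟪outwardNormal X x, cofactorField (gradient v) S x⟫_ℝ ∂(surfaceMeasure X) -
      (1 / 2) * ∫ x in X, (traceFunctional n (fderiv ℝ (gradient v) x) *
          ⟪gradient u x, gradient w x⟫_ℝ -
        ⟪gradient u x, fderiv ℝ (gradient v) x (gradient w x)⟫_ℝ) := by
    have hHv : ContDiff ℝ ∞ (fderiv ℝ (gradient v)) := hgv.fderiv_right (by simp)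
    have hi : IntegrableOn (fun x => traceFunctional n (fderiv ℝ (gradient v) x) *
          ⟪gradient u x, gradient w x⟫_ℝ -
        ⟪gradient u x, fderiv ℝ (gradient v) x (gradient w x)⟫_ℝ) X :=
      hX.integrableOn ((((traceFunctional n).continuous.comp hHv.continuous).mul
        (hgu.continuous.inner hgw.continuous)).sub
          (hgu.continuous.inner (hHv.continuous.clm_apply hgw.continuous))).continuousOn
    have hσ := integrable_interior hX mu mv mw
    have key : ∀ x ∈ X, traceFunctional n (fderiv ℝ (gradient v) x) *
          traceFunctional n (fderiv ℝ S x) -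
          traceFunctional n ((fderiv ℝ (gradient v) x).comp (fderiv ℝ S x)) =
        2 * (u x * sigmaTwo v w x) + (traceFunctional n (fderiv ℝ (gradient v) x) *
          ⟪gradient u x, gradient w x⟫_ℝ -
        ⟪gradient u x, fderiv ℝ (gradient v) x (gradient w x)⟫_ℝ) := by
      intro x hx
      have hSd : HasFDerivAt S _ x :=
        (hasFDerivAt_innerSL_gradient hu x).smul (hasFDerivAt_gradient hw x)
      rw [hSd.fderiv, sigmaTwo_eq hX mv mw hx, endSigmaTwo_eq_trace,
        closureHessian_eq_fderiv_gradient hX hv (subset_closure hx),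
        closureHessian_eq_fderiv_gradient hX hw (subset_closure hx),
        ContinuousLinearMap.comp_add, ContinuousLinearMap.comp_smul,
        show (fderiv ℝ (gradient v) x).comp ((innerSL ℝ (gradient u x)).smulRight (gradient w x)) =
          (innerSL ℝ (gradient u x)).smulRight (fderiv ℝ (gradient v) x (gradient w x)) by
            ext1 a; simp]
      simp only [map_add, map_smul, traceFunctional_smulRight, smul_eq_mul, innerSL_apply_apply]
      ring
    rw [← hX.integral_cofactorField hgv hSs, setIntegral_congr_fun hX.isOpen.measurableSet key,
      integral_add (hσ.const_mul 2) hi, integral_const_mul]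
    ring
  -- the boundary integral
  have hcomm := hX.integral_cofactorField_comm hN hTs
  have i1 := hX.integrable_inner_outwardNormal (contDiff_cofactorField hgv hSs).continuous
  have i2 := integrable_boundary hX mu mv mw
  have i3 := hX.integrable_inner_outwardNormal (contDiff_cofactorField hN hTs).continuous
  have i4 := hX.integrable_inner_outwardNormal (contDiff_cofactorField hTs hN).continuous
  have hboundary : ∫ p, (-(1 / 2) * ⟪outwardNormal X p, cofactorField (gradient v) S p⟫_ℝ
        + u p * boundaryOperator X v w p
        + (1 / 2) * (⟪outwardNormal X p, cofactorField N T p⟫_ℝ -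
          ⟪outwardNormal X p, cofactorField T N p⟫_ℝ)) ∂(surfaceMeasure X) =
      ∫ p, -(1 / 2) * (⟪gradient v p, outwardNormal X p⟫_ℝ * (⟪gradient u p, gradient w p⟫_ℝ -
        ⟪gradient u p, outwardNormal X p⟫_ℝ * ⟪gradient w p, outwardNormal X p⟫_ℝ))
          ∂(surfaceMeasure X) := by
    refine setIntegral_congr_fun isClosed_frontier.measurableSet fun p hp => ?_
    have hp' := frontier_subset_closure hp
    have hNd := (hN.differentiable (by simp) p).hasFDerivAt
    have hD : tangentialDeriv X (outwardNormal X) p =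
        (fderiv ℝ N p).comp (projAlong (outwardNormal X p)) := by
      rw [← tangentialDeriv_congr hp fun q hq => hNX q hq]
      exact tangentialDeriv_eq hX hp hNd.hasFDerivWithinAt
    have hTd : fderiv ℝ T p = (⟪gradient v p, outwardNormal X p⟫_ℝ * u p) •
          fderiv ℝ (gradient w) p +
        ((⟪gradient v p, outwardNormal X p⟫_ℝ • innerSL ℝ (gradient u p)) +
          u p • ((innerSL ℝ (outwardNormal X p)).comp (fderiv ℝ (gradient v) p) +
            (innerSL ℝ (gradient v p)).comp (fderiv ℝ N p))).smulRight (gradient w p) := by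
      have h : HasFDerivAt T _ p := ((((hasFDerivAt_gradient hv p).inner ℝ hNd).mul
        (hasFDerivAt_innerSL_gradient hu p)).smul (hasFDerivAt_gradient hw p))
      rw [h.fderiv, ← hNX p hp]
      congr 3
      ext a
      simp [real_inner_comm, add_comm, mul_add]
    have := boundary_integrand_eq hX hp hD hTd
    rw [boundaryOperator_eq hX mv mw hp, closureGradient_eq_gradient hX hv hp',
      closureGradient_eq_gradient hX hw hp', closureHessian_eq_fderiv_gradient hX hv hp',
      closureHessian_eq_fderiv_gradient hX hw hp', ← this]
    simp only [cofactorField, hNX p hp]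
    rw [hS, map_smul, smul_comm _ (u p), ← smul_sub]
    congr 4
    simp only [hT, hNX p hp]
  have i12 : Integrable (fun p => -(1 / 2) * ⟪outwardNormal X p, cofactorField (gradient v) S p⟫_ℝ
      + u p * boundaryOperator X v w p) (surfaceMeasure X) := (i1.const_mul _).add i2
  have i34 : Integrable (fun p => (1 / 2) * (⟪outwardNormal X p, cofactorField N T p⟫_ℝ -
      ⟪outwardNormal X p, cofactorField T N p⟫_ℝ)) (surfaceMeasure X) := (i3.sub i4).const_mul _
  rw [integral_add i12 i34,
    integral_add (i1.const_mul _) i2, integral_const_mul, integral_const_mul, integral_const_mul,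
    integral_sub i3 i4, hcomm, sub_self] at hboundary
  rw [energyForm, hinterior]
  linear_combination hboundary

lemma energyForm_swap_of_contDiff (hX : IsBoundedSmoothDomain X) (hu : ContDiff ℝ ∞ u)
    (hv : ContDiff ℝ ∞ v) (hw : ContDiff ℝ ∞ w) : energyForm X u v w = energyForm X w v u := by
  rw [energyForm_eq_of_contDiff hX hu hv hw, energyForm_eq_of_contDiff hX hw hv hu]
  congr 3
  · ext x
    rw [real_inner_comm, ← inner_fderiv_gradient_comm hv, real_inner_comm (gradient w x)]
  · ext x
    rw [real_inner_comm (gradient w x) (gradient u x), mul_comm ⟪gradient u x, _⟫_ℝ]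

end Smooth

/-! ### The symmetric trilinear form -/

section Trilinear

variable {n : ℕ} {X : Set (Rn n)} {u u' v w : Rn n → ℝ}

/-- The symmetry for smooth functions extends to `C²(X̄)` by density and continuity. -/
lemma energyForm_swap_left_right (hX : IsBoundedSmoothDomain X) (hu : u ∈ C2Closure X)
    (hv : v ∈ C2Closure X) (hw : w ∈ C2Closure X) : energyForm X u v w = energyForm X w v u := by
  obtain ⟨f, hfs, hf⟩ := hX.exists_smooth_jetTendsto hu
  obtain ⟨g, hgs, hg⟩ := hX.exists_smooth_jetTendsto hv
  obtain ⟨h, hhs, hh⟩ := hX.exists_smooth_jetTendsto hw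
  refine tendsto_nhds_unique (tendsto_energyForm hX hv hw hf hg hh) ?_
  simp only [energyForm_swap_of_contDiff hX (hfs _) (hgs _) (hhs _)]
  exact tendsto_energyForm hX hv hu hh hg hf

lemma energyForm_swap_right (hX : IsBoundedSmoothDomain X) (hv : v ∈ C2Closure X)
    (hw : w ∈ C2Closure X) : energyForm X u v w = energyForm X u w v := by
  rw [energyForm, energyForm]
  congr 1
  · refine congrArg Neg.neg (setIntegral_congr_fun hX.isOpen.measurableSet fun x hx => ?_)
    simp only [sigmaTwo_eq hX hv hw hx, sigmaTwo_eq hX hw hv hx, endSigmaTwo_comm]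
  · refine setIntegral_congr_fun isClosed_frontier.measurableSet fun p hp => ?_
    simp only [boundaryOperator_symm hX hp (differentiableWithinAt_of_mem (C2Closure_le hv) hp)
      (differentiableWithinAt_of_mem (C2Closure_le hw) hp)]

lemma energyForm_swap_left (hX : IsBoundedSmoothDomain X) (hu : u ∈ C2Closure X)
    (hv : v ∈ C2Closure X) (hw : w ∈ C2Closure X) : energyForm X u v w = energyForm X v u w := by
  rw [energyForm_swap_right hX hv hw, energyForm_swap_left_right hX hu hw hv,
    energyForm_swap_right hX hw hu]

lemma energyForm_add (hX : IsBoundedSmoothDomain X) (hu : u ∈ C2Closure X)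
    (hu' : u' ∈ C2Closure X) (hv : v ∈ C2Closure X) (hw : w ∈ C2Closure X) :
    energyForm X (u + u') v w = energyForm X u v w + energyForm X u' v w := by
  simp only [energyForm, Pi.add_apply, add_mul]
  rw [integral_add (integrable_interior hX hu hv hw) (integrable_interior hX hu' hv hw),
    integral_add (integrable_boundary hX hu hv hw) (integrable_boundary hX hu' hv hw)]
  ring

lemma energyForm_smul (c : ℝ) : energyForm X (c • u) v w = c * energyForm X u v w := by
  simp only [energyForm, Pi.smul_apply, smul_eq_mul, mul_assoc, integral_const_mul]
  ring

lemma energyForm_comp_perm (hX : IsBoundedSmoothDomain X) (τ : Equiv.Perm (Fin 3))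
    (f : Fin 3 → C2Closure X) :
    energyForm X (f (τ 0)) (f (τ 1)) (f (τ 2)) = energyForm X (f 0) (f 1) (f 2) := by
  have h01 : ∀ f : Fin 3 → C2Closure X,
      energyForm X (f 1) (f 0) (f 2) = energyForm X (f 0) (f 1) (f 2) := fun f =>
    energyForm_swap_left hX (f 1).2 (f 0).2 (f 2).2
  have h12 : ∀ f : Fin 3 → C2Closure X,
      energyForm X (f 0) (f 2) (f 1) = energyForm X (f 0) (f 1) (f 2) := fun f =>
    energyForm_swap_right hX (f 2).2 (f 1).2
  have h02 : ∀ f : Fin 3 → C2Closure X,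
      energyForm X (f 2) (f 1) (f 0) = energyForm X (f 0) (f 1) (f 2) := fun f =>
    energyForm_swap_left_right hX (f 2).2 (f 1).2 (f 0).2
  induction τ using Equiv.Perm.swap_induction_on' generalizing f with
  | one => rfl
  | mul_swap τ i j hij ih =>
    rw [← ih]
    simp only [Equiv.Perm.mul_apply]
    fin_cases i <;> fin_cases j <;> first
      | exact absurd rfl hij
      | exact h01 (f ∘ τ)
      | exact h12 (f ∘ τ)
      | exact h02 (f ∘ τ)

/-- The energy form as a trilinear form: linearity in the first argument is linearity of the
integral, and the other two arguments are moved to the first place by symmetry. -/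
noncomputable def trilinearEnergyForm (hX : IsBoundedSmoothDomain X) :
    MultilinearMap ℝ (fun _ : Fin 3 => C2Closure X) ℝ where
  toFun f := energyForm X (f 0) (f 1) (f 2)
  map_update_add' {inst} f i x y := by
    obtain rfl := Subsingleton.elim inst (instDecidableEqFin 3)
    rw [← energyForm_comp_perm hX (Equiv.swap 0 i), ← energyForm_comp_perm hX (Equiv.swap 0 i)
      (Function.update f i x), ← energyForm_comp_perm hX (Equiv.swap 0 i) (Function.update f i y)]
    have h : ∀ j : Fin 3, j ≠ 0 → Equiv.swap 0 i j ≠ i := fun j hj h =>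
      hj ((Equiv.swap 0 i).injective (h.trans (Equiv.swap_apply_left 0 i).symm))
    simp only [Equiv.swap_apply_left, Function.update_self,
      Function.update_of_ne (h 1 (by decide)), Function.update_of_ne (h 2 (by decide))]
    exact energyForm_add hX x.2 y.2 (Subtype.prop _) (Subtype.prop _)
  map_update_smul' {inst} f i c x := by
    obtain rfl := Subsingleton.elim inst (instDecidableEqFin 3)
    rw [← energyForm_comp_perm hX (Equiv.swap 0 i), ← energyForm_comp_perm hX (Equiv.swap 0 i)
      (Function.update f i x)]
    have h : ∀ j : Fin 3, j ≠ 0 → Equiv.swap 0 i j ≠ i := fun j hj h =>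
      hj ((Equiv.swap 0 i).injective (h.trans (Equiv.swap_apply_left 0 i).symm))
    simp only [Equiv.swap_apply_left, Function.update_self,
      Function.update_of_ne (h 1 (by decide)), Function.update_of_ne (h 2 (by decide))]
    exact energyForm_smul c

end Trilinear

end HessianTrace

theorem proposition1p2 {n : ℕ} (X : Set (HessianTrace.Rn n))
    (hX : HessianTrace.IsBoundedSmoothDomain X) :
    -- `B₂` is a bilinear operator from `C¹(X̄) ∩ C²(M)` to `C⁰(M)`
    (∃ B : HessianTrace.C1ClosureC2Boundary X →ₗ[ℝ]
        HessianTrace.C1ClosureC2Boundary X →ₗ[ℝ] C(frontier X, ℝ),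
      ∀ (v w : HessianTrace.C1ClosureC2Boundary X) (p : frontier X),
        B v w p = HessianTrace.boundaryOperator X v w p) ∧
    -- the integrals that define `Q₂` converge on `C²(X̄)`
    (∀ u v w : HessianTrace.C2Closure X,
      MeasureTheory.Integrable
          (fun x => (u : HessianTrace.Rn n → ℝ) x * HessianTrace.sigmaTwo v w x)
          (MeasureTheory.volume.restrict X) ∧
        MeasureTheory.Integrable
          (fun p => (u : HessianTrace.Rn n → ℝ) p * HessianTrace.boundaryOperator X v w p)
          (HessianTrace.surfaceMeasure X)) ∧
    -- `Q₂` is a symmetric trilinear form on `C²(X̄)`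
    ∃ Q : MultilinearMap ℝ (fun _ : Fin 3 => HessianTrace.C2Closure X) ℝ,
      (∀ u v w : HessianTrace.C2Closure X,
        Q ![u, v, w] = HessianTrace.energyForm X u v w) ∧
      ∀ (τ : Equiv.Perm (Fin 3)) (f : Fin 3 → HessianTrace.C2Closure X), Q (f ∘ τ) = Q f := by
  exact ⟨HessianTrace.exists_bilinear_boundaryOperator hX,
    fun u v w => ⟨HessianTrace.integrable_interior hX u.2 v.2 w.2,
      HessianTrace.integrable_boundary hX u.2 v.2 w.2⟩,
    HessianTrace.trilinearEnergyForm hX, fun _ _ _ => rfl,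
    fun τ f => HessianTrace.energyForm_comp_perm hX τ f⟩
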